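/- For every $n\ge 1$ let $p=p(n)$ and $m=m(n)$ be arbitrary (no relation between $p$, $m$ and $n$ is assumed), let $\Gamma=\Gamma_n$ be a real $p\times m$ matrix, $\mu=\mu_n\in\mathbb R^p$, $\Sigma=\Sigma_n=(\sigma_{ij})=\Gamma\Gamma^T$, and let $$X_i=\Gamma Z_i+\mu,\qquad i=1,\dots,n,$$ where $Z_1,\dots,Z_n$ are i.i.d. random vectors $Z_i=(Z_{i1},\dots,Z_{im})^T$ (whose law may depend on $n$) such that $\mathrm E Z_1=0$, $\operatorname{var}(Z_1)=I_m$, $\mathrm E Z_{11}^4=\dots=\mathrm E Z_{1m}^4=3+\Delta>1$, $\mathrm E Z_{1k}^8\le C$ for $k=1,\dots,m$, with constants $\Delta, C$ that do not depend on $n$, and $$\mathrm E\big(Z_{1i_1}^{l_1}\cdots Z_{1i_h}^{l_h}\big)=\mathrm E\big(Z_{1i_1}^{l_1}\big)\cdots\mathrm E\big(Z_{1i_h}^{l_h}\big)$$ for all $h\ge1$, distinct $i_1,\dots,i_h$ and integers $l_v\ge0$ with $\sum_{v=1}^h l_v\le 8$. Suppose that $\sum_{i,j=1}^p\sigma_{ij}>0$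 for every $n$. Let $N=\lfloor n/2\rfloor$ and $\mathbf 1_p=(1,\dots,1)^T\in\mathbb R^p$. For a $p\times p$ matrix $S$ and $1\le i\le N$ put $Y_j=(X_j-\mu)(X_j-\mu)^T$ and $$R_i(S)=\Big(\operatorname{tr}\big((Y_i-S)(Y_{i+N}-S)\big),\ \mathbf 1_p^T(Y_i+Y_{i+N}-2S)\mathbf 1_p\Big)^T .$$ With $\bar X^1=\frac1N\sum_{i=1}^N X_i$ and $\bar X^2=\frac1N\sum_{i=N+1}^{2N}X_i$, put $Y_i^*=(X_i-\bar X^1)(X_i-\bar X^1)^T$, $Y_{i+N}^*=(X_{i+N}-\bar X^2)(X_{i+N}-\bar X^2)^T$ and $$R_i^*(S)=\Big(\operatorname{tr}\big((Y_i^*-\tfrac{N-1}NS)(Y_{i+N}^*-\tfrac{N-1}NS)\big),\ \mathbf 1_p^T(Y_i^*+Y_{i+N}^*-\tfrac{2(N-1)}NS)\mathbf 1_p\Big)^T .$$ Let $$L_1(S)=\sup\Big\{\prod_{i=1}^N(Nq_i):\ q_1,\dots,q_N\ge0,\ \sum_{i=1}^N q_i=1,\ \sum_{i=1}^N q_iR_i(S)=0\Big\},$$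 and let $L_2(S)$ be the same supremum with $R_i^*(S)$ in place of $R_i(S)$, where $\sup\emptyset=0$ and $-2\log0=+\infty$. Then under $H_0:\Sigma=\Sigma_0$ (where $\Sigma_0=\Sigma_{0,n}$ is a given matrix), both $-2\log L_1(\Sigma_0)$ and $-2\log L_2(\Sigma_0)$ converge in distribution, as $n\to\infty$, to the chi-square distribution with two degrees of freedom. -/

import Mathlib

open MeasureTheory ProbabilityTheory Filter Matrix
open scoped ENNReal Topology

noncomputable section

/-- The chi-square distribution with `k` degrees of freedom: the law of the sum of the squares of
`k` independent standard normal random variables. -/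
def chiSquare (k : ℕ) : Measure ℝ :=
  (Measure.pi (fun _ : Fin k => gaussianReal 0 1)).map (fun x => ∑ i, x i ^ 2)

instance chiSquare_isProbabilityMeasure (k : ℕ) : IsProbabilityMeasure (chiSquare k) := by
  unfold chiSquare
  have h : Measurable (fun x : Fin k → ℝ => ∑ i, x i ^ 2) := by fun_prop
  exact Measure.isProbabilityMeasure_map h.aemeasurable

/-- The multivariate model: the observations `X i` (for `i < n`) are `Γ Z_i + μ`, where `Γ Γᵀ = S`
and the `Z_i` are i.i.d. `m`-dimensional random vectors with mean `0`, covariance `I_m`, all fourth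
moments equal to `3 + Δ > 1`, eighth moments at most `C`, and mixed moments of total order at most
`8` that factorize over the coordinates (a coordinate with exponent `0` contributes the
factor `1`, so `l : Fin m → ℕ` encodes the choice of distinct coordinates with exponents). -/
structure MultivariateModel {Ω : Type*} [MeasurableSpace Ω] (P : Measure Ω) {n p m : ℕ}
    (X : Fin n → Ω → Fin p → ℝ) (Γ : Matrix (Fin p) (Fin m) ℝ) (Z : Fin n → Ω → Fin m → ℝ)
    (μ : Fin p → ℝ) (S : Matrix (Fin p) (Fin p) ℝ) (Δ C : ℝ) : Prop where
  decomposition : ∀ i ω, X i ω = Γ *ᵥ Z i ω + μ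
  factor : Γ * Γᵀ = S
  measurable : ∀ i, Measurable (Z i)
  indep : iIndepFun Z P
  identDistrib : ∀ i j, IdentDistrib (Z i) (Z j) P P
  memLp_eight : ∀ i k, MemLp (fun ω => Z i ω k) 8 P
  mean_zero : ∀ i k, ∫ ω, Z i ω k ∂P = 0
  cov_one : ∀ i k l,
    covariance (fun ω => Z i ω k) (fun ω => Z i ω l) P = (1 : Matrix (Fin m) (Fin m) ℝ) k l
  fourth_moment : ∀ i k, ∫ ω, Z i ω k ^ 4 ∂P = 3 + Δ
  one_lt_fourth : 1 < 3 + Δ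
  eighth_moment_le : ∀ i k, ∫ ω, Z i ω k ^ 8 ∂P ≤ C
  moment_factorization : ∀ (i : Fin n) (l : Fin m → ℕ), ∑ k, l k ≤ 8 →
    ∫ ω, ∏ k, Z i ω k ^ l k ∂P = ∏ k, ∫ ω, Z i ω k ^ l k ∂P

/-- The empirical likelihood ratio
`sup {∏ (N q_i) : q_i ≥ 0, ∑ q_i = 1, ∑ q_i R_i = 0}`; it is `0` if no such weights exist. -/
def empiricalLikelihoodRatio {N : ℕ} (R : Fin N → ℝ × ℝ) : ℝ≥0∞ :=
  sSup {L : ℝ≥0∞ | ∃ q : Fin N → ℝ, (∀ i, 0 ≤ q i) ∧ ∑ i, q i = 1 ∧ ∑ i, q i • R i = 0 ∧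
    L = ENNReal.ofReal (∏ i, ((N : ℝ) * q i))}

/-- The `i`-th observation of the first half of the sample (`N = ⌊n/2⌋`). -/
def firstHalf {n : ℕ} (i : Fin (n / 2)) : Fin n := ⟨i, by omega⟩

/-- The `(N + i)`-th observation, that is, the `i`-th one of the second half of the sample. -/
def secondHalf {n : ℕ} (i : Fin (n / 2)) : Fin n := ⟨n / 2 + i, by omega⟩

/-- `(x - a)(x - a)ᵀ`. -/
def centeredOuter {p : ℕ} (x a : Fin p → ℝ) : Matrix (Fin p) (Fin p) ℝ :=
  vecMulVec (x - a) (x - a)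

/-- The pair `(tr((Y - M)(Y' - M)), 1ᵀ(Y + Y' - 2M)1)`. -/
def estimatingPair {p : ℕ} (Y Y' M : Matrix (Fin p) (Fin p) ℝ) : ℝ × ℝ :=
  (trace ((Y - M) * (Y' - M)), 1 ⬝ᵥ ((Y + Y' - (2 : ℝ) • M) *ᵥ 1))

/-- `R_i(S)`, for a known mean `μ`. -/
def pairKnown {n p : ℕ} (x : Fin n → Fin p → ℝ) (μ : Fin p → ℝ) (S : Matrix (Fin p) (Fin p) ℝ)
    (i : Fin (n / 2)) : ℝ × ℝ :=
  estimatingPair (centeredOuter (x (firstHalf i)) μ) (centeredOuter (x (secondHalf i)) μ) S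

/-- The mean of the first half of the sample. -/
def meanFirst {n p : ℕ} (x : Fin n → Fin p → ℝ) : Fin p → ℝ :=
  ((n / 2 : ℕ) : ℝ)⁻¹ • ∑ i, x (firstHalf i)

/-- The mean of the second half of the sample. -/
def meanSecond {n p : ℕ} (x : Fin n → Fin p → ℝ) : Fin p → ℝ :=
  ((n / 2 : ℕ) : ℝ)⁻¹ • ∑ i, x (secondHalf i)

/-- `R*_i(S)`, for an unknown mean: the sample means replace `μ`, and `(N - 1) S / N`
replaces `S`. -/
def pairUnknown {n p : ℕ} (x : Fin n → Fin p → ℝ) (S : Matrix (Fin p) (Fin p) ℝ)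
    (i : Fin (n / 2)) : ℝ × ℝ :=
  estimatingPair (centeredOuter (x (firstHalf i)) (meanFirst x))
    (centeredOuter (x (secondHalf i)) (meanSecond x))
    (((((n / 2 : ℕ) : ℝ) - 1) / ((n / 2 : ℕ) : ℝ)) • S)

/-- `L₁(S)`, for the data `x` and the known mean `μ`. -/
def likelihoodKnown {n p : ℕ} (x : Fin n → Fin p → ℝ) (μ : Fin p → ℝ)
    (S : Matrix (Fin p) (Fin p) ℝ) : ℝ≥0∞ :=
  empiricalLikelihoodRatio (pairKnown x μ S)

/-- `L₂(S)`, for the data `x`. -/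
def likelihoodUnknown {n p : ℕ} (x : Fin n → Fin p → ℝ) (S : Matrix (Fin p) (Fin p) ℝ) : ℝ≥0∞ :=
  empiricalLikelihoodRatio (pairUnknown x S)

end

/-! Under `H₀` an estimating pair depends on the data only through the vectors `Z`. With `B = ΓᵀΓ`
and `b = Γᵀ1`, its first entry is `tr((ZZᵀ - I) B (Z'Z'ᵀ - I) B)`, quadratic in each of two
independent vectors, and its second entry is a sum of two centered quadratic forms with coefficients
`b bᵀ`. The two entries are uncorrelated: against a function of one vector alone, the trace form
always leaves a mean-zero factor in the other vector. The likelihood ratio does not change when each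
coordinate is rescaled, so both entries may be given unit variance, and the claim becomes Wilks'
theorem for a triangular array with identity covariance.

No relation between `p`, `m` and `n` is needed because all moment estimates are dimension-free. The
fourth moments of the forms are at most a constant times the squares of the squared coefficient
norms (`sqrt_integral_quadratic_pow_four_le`, `integral_biquadForm_pow_four_le`), while the
variances are at least a positive constant times the same norms (`le_sumVariance`,
`le_traceVariance`), as `2 + Δ > 0`. The normalized fourth moments are therefore bounded in terms of
`Δ` and `C` only, and a Lyapunov central limit theorem applies
(`tendstoInDistribution_normalizedSum`).

The likelihood ratio is handled deterministically. Lagrangian duality bounds it above, explicit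
feasible weights bound it below, and both bounds agree with the squared norm of the normalized sum
up to a small relative error, provided the empirical second moments are near the identity and no
observation is large compared with `√N`. Markov's inequality gives these conditions off a set of
small probability, and a Slutsky argument concludes.

For an unknown mean, centering replaces the weight vector `e_i` by its projection `e_i - 1/N`
orthogonal to the constants. Both versions of a statistic are forms of the same type in the long
vector of all observations, and the norm of the difference of their coefficients is read off from
Gram matrices. The difference is `O(1/N)` in mean square for one observation and `O(1)` for the sum
over the sample, both negligible. The known mean is the case of zero perturbation in
`tendstoInDistribution_neg_two_log_empiricalLikelihoodRatio`. -/

open scoped BoundedContinuousFunction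

set_option linter.unusedSectionVars false

/-! ### Empirical likelihood: duality and feasible weights. -/

section EmpiricalLikelihood

variable {N : ℕ}

theorem one_add_log_lower {t ρ : ℝ} (ht : |t| ≤ ρ) (hρ : ρ ≤ 1 / 2) :
    t - (1 / 2 + 2 * ρ) * t ^ 2 ≤ Real.log (1 + t) := by
  have h := Real.abs_log_sub_add_sum_range_le (x := -t) (by rw [abs_neg]; linarith) 2
  simp only [Finset.sum_range_succ, Finset.sum_range_zero, abs_neg, sub_neg_eq_add] at h
  -- The Taylor remainder, with `1 - |t| ≥ 1/2`.
  have h1 : |t| ^ 3 / (1 - |t|) ≤ 2 * ρ * t ^ 2 := by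
    rw [div_le_iff₀ (by linarith), ← sq_abs t]
    have h0 := abs_nonneg t
    have : |t| * |t| ^ 2 ≤ ρ * |t| ^ 2 := by gcongr
    nlinarith [mul_nonneg (sq_nonneg |t|) (le_trans h0 ht)]
  have h2 := (abs_le.mp (h.trans h1)).1
  norm_num at h2
  linarith

/-- The constraint is homogeneous in each coordinate. This is what allows the pairs to be normalized
by their unknown variances. -/
theorem empiricalLikelihoodRatio_smul (R : Fin N → ℝ × ℝ) {a b : ℝ} (ha : a ≠ 0) (hb : b ≠ 0) :
    empiricalLikelihoodRatio (fun i => (a * (R i).1, b * (R i).2)) =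
      empiricalLikelihoodRatio R := by
  unfold empiricalLikelihoodRatio
  have h : ∀ q : Fin N → ℝ,
      ∑ i, q i • ((a * (R i).1, b * (R i).2) : ℝ × ℝ) = 0 ↔ ∑ i, q i • R i = 0 := by
    intro q
    simp only [Prod.ext_iff, Prod.fst_sum, Prod.snd_sum, Prod.smul_fst, Prod.smul_snd,
      smul_eq_mul, Prod.fst_zero, Prod.snd_zero, mul_left_comm _ a, mul_left_comm _ b,
      ← Finset.mul_sum, mul_eq_zero, ha, hb, false_or]
  simp only [h]

/-- Weak duality for a Lagrange multiplier `(l₁, l₂)`. Each factor `u = N q_i (1 + l·R_i)` satisfies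
`u ≤ exp (u - 1)`, and by the constraints the exponents add up to zero. -/
theorem empiricalLikelihoodRatio_le (R : Fin N → ℝ × ℝ) (l₁ l₂ : ℝ)
    (h : ∀ i, 0 < 1 + (l₁ * (R i).1 + l₂ * (R i).2)) :
    empiricalLikelihoodRatio R ≤
      ENNReal.ofReal (Real.exp (-∑ i, Real.log (1 + (l₁ * (R i).1 + l₂ * (R i).2)))) := by
  refine sSup_le ?_
  rintro L ⟨q, hq0, hq1, hq2, rfl⟩
  refine ENNReal.ofReal_le_ofReal ?_
  have e1 : ∑ i, q i * (R i).1 = 0 := by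
    simpa [Prod.fst_sum] using congrArg Prod.fst hq2
  have e2 : ∑ i, q i * (R i).2 = 0 := by
    simpa [Prod.snd_sum] using congrArg Prod.snd hq2
  have hprod : ∏ i, ((N : ℝ) * q i * (1 + (l₁ * (R i).1 + l₂ * (R i).2))) ≤ 1 := by
    calc ∏ i, ((N : ℝ) * q i * (1 + (l₁ * (R i).1 + l₂ * (R i).2)))
        ≤ ∏ i, Real.exp ((N : ℝ) * q i * (1 + (l₁ * (R i).1 + l₂ * (R i).2)) - 1) := by
          refine Finset.prod_le_prod (fun i _ => ?_) (fun i _ => ?_)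
          · exact mul_nonneg (mul_nonneg (Nat.cast_nonneg _) (hq0 i)) (h i).le
          · have := Real.add_one_le_exp ((N : ℝ) * q i * (1 + (l₁ * (R i).1 + l₂ * (R i).2)) - 1)
            linarith
      _ = Real.exp (N * ∑ i, q i + N * l₁ * ∑ i, q i * (R i).1 + N * l₂ * ∑ i, q i * (R i).2
            - N) := by
          rw [← Real.exp_sum]
          congr 1
          rw [Finset.sum_sub_distrib]
          simp only [Finset.mul_sum, ← Finset.sum_add_distrib]
          simp only [Finset.sum_const, Finset.card_univ, Fintype.card_fin, nsmul_eq_mul, mul_one]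
          congr 1
          exact Finset.sum_congr rfl fun i _ => by ring
      _ = 1 := by rw [e1, e2, hq1]; simp
  rw [Finset.prod_mul_distrib] at hprod
  rw [Real.exp_neg, Real.exp_sum]
  simp only [Real.exp_log (h _)]
  rw [← one_div, le_div_iff₀ (Finset.prod_pos fun i _ => h i)]
  exact hprod

/-- The weights `(1 - t i) / N` are feasible. -/
theorem le_empiricalLikelihoodRatio (hN : 0 < N) (R : Fin N → ℝ × ℝ) (t : Fin N → ℝ)
    (ht : ∀ i, |t i| < 1) (h0 : ∑ i, t i = 0) (h1 : ∑ i, (1 - t i) * (R i).1 = 0)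
    (h2 : ∑ i, (1 - t i) * (R i).2 = 0) :
    ENNReal.ofReal (Real.exp (∑ i, Real.log (1 - t i))) ≤ empiricalLikelihoodRatio R := by
  have hN' : (N : ℝ) ≠ 0 := by positivity
  have hpos : ∀ i, 0 < 1 - t i := fun i => by linarith [(abs_lt.mp (ht i)).2]
  refine le_sSup ⟨fun i => (1 - t i) / N, fun i => div_nonneg (hpos i).le (Nat.cast_nonneg _),
    ?_, ?_, ?_⟩
  · rw [← Finset.sum_div, Finset.sum_sub_distrib, h0]
    simp [hN']
  · refine Prod.ext ?_ ?_
    · simp only [Prod.fst_sum, Prod.smul_fst, smul_eq_mul, Prod.fst_zero, div_mul_eq_mul_div,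
        ← Finset.sum_div, h1, zero_div]
    · simp only [Prod.snd_sum, Prod.smul_snd, smul_eq_mul, Prod.snd_zero, div_mul_eq_mul_div,
        ← Finset.sum_div, h2, zero_div]
  · congr 1
    rw [Real.exp_sum]
    exact Finset.prod_congr rfl fun i _ => by rw [Real.exp_log (hpos i)]; field_simp

theorem neg_two_mul_log_of_mem {L : ℝ≥0∞} {a b : ℝ}
    (h1 : ENNReal.ofReal (Real.exp b) ≤ L) (h2 : L ≤ ENNReal.ofReal (Real.exp a)) :
    ∃ g : ℝ, (-2 : EReal) * ENNReal.log L = (g : EReal) ∧ -2 * a ≤ g ∧ g ≤ -2 * b := by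
  have hL : L ≠ ⊤ := ne_top_of_le_ne_top ENNReal.ofReal_ne_top h2
  have hx : Real.exp b ≤ L.toReal := by
    rwa [← ENNReal.ofReal_le_iff_le_toReal hL]
  have hx' : L.toReal ≤ Real.exp a := ENNReal.toReal_le_of_le_ofReal (Real.exp_pos _).le h2
  have hpos : 0 < L.toReal := (Real.exp_pos _).trans_le hx
  refine ⟨-2 * Real.log L.toReal, ?_, ?_, ?_⟩
  · rw [← ENNReal.ofReal_toReal hL, ENNReal.log_ofReal_of_pos hpos, ENNReal.toReal_ofReal hpos.le]
    push_cast
    rfl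
  · have := (Real.log_le_iff_le_exp hpos).2 hx'
    linarith
  · have := (Real.le_log_iff_exp_le hpos).2 hx
    linarith

theorem quadraticForm_le {a b c u v ε : ℝ} (ha : a ≤ 1 + ε) (hb : |b| ≤ ε) (hc : c ≤ 1 + ε) :
    a * u ^ 2 + 2 * b * (u * v) + c * v ^ 2 ≤ (1 + 2 * ε) * (u ^ 2 + v ^ 2) := by
  have h1 : 2 * b * (u * v) ≤ ε * (u ^ 2 + v ^ 2) := by
    have h2 : 2 * (b * (u * v)) ≤ 2 * (|b| * (|u| * |v|)) := by
      rw [← abs_mul u, ← abs_mul]; linarith [le_abs_self (b * (u * v))]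
    have h3 : 2 * (|u| * |v|) ≤ u ^ 2 + v ^ 2 := by
      nlinarith [sq_nonneg (|u| - |v|), sq_abs u, sq_abs v]
    have h4 : |b| * (2 * (|u| * |v|)) ≤ ε * (u ^ 2 + v ^ 2) := by
      have := abs_nonneg b
      gcongr
      exact this.trans hb
    linarith
  nlinarith [mul_le_mul_of_nonneg_right ha (sq_nonneg u),
    mul_le_mul_of_nonneg_right hc (sq_nonneg v)]

end EmpiricalLikelihood

/-! ### Quadratic approximation of the log-likelihood ratio. -/

section EmpiricalLikelihood

variable {N : ℕ}

theorem sum_log_one_add_lower (t : Fin N → ℝ) {ρ : ℝ} (ht : ∀ i, |t i| ≤ ρ) (hρ : ρ ≤ 1 / 2) :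
    ∑ i, t i - (1 / 2 + 2 * ρ) * ∑ i, t i ^ 2 ≤ ∑ i, Real.log (1 + t i) := by
  rw [Finset.mul_sum, ← Finset.sum_sub_distrib]
  exact Finset.sum_le_sum fun i _ => one_add_log_lower (ht i) hρ

/-- Any multiplier gives a bound, so the nearly optimal choice `l` = sample mean suffices and the
covariance matrix need not be inverted. With `W` the squared norm of the normalized sum, `∑ l·R_i =
W` and `∑ (l·R_i)² ≤ (1 + 2δ) W`; the logarithm is then expanded to second order. -/
theorem empiricalLikelihoodRatio_upper (hN : 0 < N) (x y : Fin N → ℝ) {δ A : ℝ}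
    (hδ0 : 0 < δ) (hδ : δ ≤ 1 / 20)
    (h11 : |(∑ i, x i ^ 2) / N - 1| ≤ δ) (h12 : |(∑ i, x i * y i) / N| ≤ δ)
    (h22 : |(∑ i, y i ^ 2) / N - 1| ≤ δ)
    (hA : (∑ i, x i) ^ 2 / N + (∑ i, y i) ^ 2 / N ≤ A)
    (hx : ∀ i, 8 * (1 + A) * |x i| ≤ δ * √N) (hy : ∀ i, 8 * (1 + A) * |y i| ≤ δ * √N) :
    ∃ a : ℝ, empiricalLikelihoodRatio (fun i => (x i, y i)) ≤ ENNReal.ofReal (Real.exp a) ∧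
      (1 - 4 * δ) * ((∑ i, x i) ^ 2 / N + (∑ i, y i) ^ 2 / N) ≤ -2 * a := by
  have hs : 0 < √(N : ℝ) := Real.sqrt_pos.2 (by exact_mod_cast hN)
  have hs2 : √(N : ℝ) ^ 2 = N := Real.sq_sqrt (Nat.cast_nonneg _)
  have hNpos : (0 : ℝ) < N := by exact_mod_cast hN
  set s := √(N : ℝ) with hsdef
  set a := (∑ i, x i) with hadef
  set b := (∑ i, y i) with hbdef
  set W := a ^ 2 / N + b ^ 2 / N with hW
  have hW0 : 0 ≤ W := by positivity
  have hA0 : 0 ≤ A := hW0.trans hA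
  -- `1 + A` replaces `√A` so that the estimates stay polynomial in `A`.
  have bound : ∀ c : ℝ, c ^ 2 / N ≤ A → |c| ≤ (1 + A) * s := by
    intro c hc
    rw [div_le_iff₀ hNpos] at hc
    refine abs_le_of_sq_le_sq ?_ (by positivity)
    rw [mul_pow, hs2]
    nlinarith [mul_nonneg hA0 hNpos.le]
  have ha : |a| ≤ (1 + A) * s := bound a (le_trans (by rw [hW]; linarith [div_nonneg (sq_nonneg b) hNpos.le]) hA)
  have hb : |b| ≤ (1 + A) * s := bound b (le_trans (by rw [hW]; linarith [div_nonneg (sq_nonneg a) hNpos.le]) hA)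
  have ht : ∀ i, |a / N * x i + b / N * y i| ≤ δ / 4 := by
    intro i
    have key : ∀ c z : ℝ, |c| ≤ (1 + A) * s → 8 * (1 + A) * |z| ≤ δ * s →
        |c / N * z| ≤ δ / 8 := by
      intro c z hc hz
      rw [abs_mul, abs_div, abs_of_pos hNpos, div_mul_eq_mul_div, div_le_iff₀ hNpos, ← hs2]
      have : |c| * |z| ≤ (1 + A) * s * |z| := by gcongr
      nlinarith
    calc _ ≤ |a / N * x i| + |b / N * y i| := abs_add_le _ _
      _ ≤ δ / 8 + δ / 8 := add_le_add (key _ _ ha (hx i)) (key _ _ hb (hy i))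
      _ = δ / 4 := by ring
  have hlog := sum_log_one_add_lower (fun i => a / N * x i + b / N * y i) ht (by linarith)
  have hsum : ∑ i, (a / N * x i + b / N * y i) = W := by
    rw [Finset.sum_add_distrib, ← Finset.mul_sum, ← Finset.mul_sum, ← hadef, ← hbdef, hW]
    ring
  have hsq : ∑ i, (a / N * x i + b / N * y i) ^ 2 ≤ (1 + 2 * δ) * W := by
    have e : ∑ i, (a / N * x i + b / N * y i) ^ 2
        = ((∑ i, x i ^ 2) / N) * (a / s) ^ 2 + 2 * ((∑ i, x i * y i) / N) * ((a / s) * (b / s)) +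
          ((∑ i, y i ^ 2) / N) * (b / s) ^ 2 := by
      have : ∑ i, (a / N * x i + b / N * y i) ^ 2 = (a / N) ^ 2 * (∑ i, x i ^ 2) +
          2 * (a / N) * (b / N) * (∑ i, x i * y i) + (b / N) ^ 2 * (∑ i, y i ^ 2) := by
        simp only [Finset.mul_sum, ← Finset.sum_add_distrib]
        exact Finset.sum_congr rfl fun i _ => by ring
      rw [this, ← hs2]; field_simp
    have eW : W = (a / s) ^ 2 + (b / s) ^ 2 := by rw [hW, ← hs2]; field_simp
    rw [e, eW]
    exact quadraticForm_le (by linarith [(abs_le.mp h11).2]) h12 (by linarith [(abs_le.mp h22).2])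
  refine ⟨_, empiricalLikelihoodRatio_le (fun i => (x i, y i)) (a / N) (b / N) fun i => ?_, ?_⟩
  · have := (abs_le.mp (ht i)).1
    simp only
    linarith
  · rw [hsum] at hlog
    simp only
    have := mul_le_mul_of_nonneg_left hsq (by linarith : (0 : ℝ) ≤ 1 / 2 + 2 * (δ / 4))
    have h3 : (1 / 2 + 2 * (δ / 4)) * ((1 + 2 * δ) * W) ≤ (1 / 2 + 2 * δ) * W := by
      rw [← mul_assoc]
      refine mul_le_mul_of_nonneg_right ?_ hW0
      nlinarith
    linarith

theorem one_le_of_small {δ D : ℝ} (hδ0 : 0 < δ) (hδ : δ ≤ 1 / 20) (hD : 1 - 4 * δ ≤ D) :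
    1 ≤ (1 + 5 * δ) * D := by
  nlinarith

theorem poly_le_of_small {δ : ℝ} (hδ0 : 0 < δ) (hδ : δ ≤ 1 / 20) :
    (1 + 4 * δ) * ((1 + 4 * δ) * (1 + 5 * δ)) ≤ 1 + 20 * δ := by
  have hd2 : δ ^ 2 ≤ δ / 20 := by nlinarith
  have hd3 : δ ^ 3 ≤ δ / 400 := by nlinarith
  nlinarith

/-- Size of a multiplier given by Cramer's rule: since `2δ ≤ 1/10`, the numerator is at most `(11/10
+ 1/10)(1 + A)` after scaling by `s`, and dividing by `D ≥ 4/5` gives `3/2`. -/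
theorem abs_cramer_bound {p q r t D s A δ : ℝ} (hs : 0 ≤ s) (hA : 0 ≤ A)
    (hδ : δ ≤ 1 / 20) (hD : 4 / 5 ≤ D) (hp : |p - 1| ≤ 2 * δ) (hq : |q| ≤ 2 * δ)
    (hr : |r| * s ≤ 1 + A) (ht : |t| * s ≤ 1 + A) :
    |(p * r - q * t) / D| * s ≤ 3 / 2 * (1 + A) := by
  have hDpos : 0 < D := by linarith
  have hp' : |p| ≤ 11 / 10 := by
    rw [abs_le] at hp ⊢; constructor <;> linarith
  have h1 : |p * r - q * t| * s ≤ 6 / 5 * (1 + A) := by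
    calc |p * r - q * t| * s ≤ (|p| * |r| + |q| * |t|) * s := by
          gcongr
          rw [← abs_mul, ← abs_mul]; exact abs_sub _ _
      _ = |p| * (|r| * s) + |q| * (|t| * s) := by ring
      _ ≤ 11 / 10 * (1 + A) + 1 / 10 * (1 + A) := by
          gcongr
          linarith
      _ = 6 / 5 * (1 + A) := by ring
  rw [abs_div, abs_of_pos hDpos, div_mul_eq_mul_div, div_le_iff₀ hDpos]
  have h2 : 3 / 2 * (1 + A) * (4 / 5) ≤ 3 / 2 * (1 + A) * D := by gcongr
  linarith

theorem abs_mul_sub_bound {l z w s A δ : ℝ} (hs : 0 < s) (hA : 0 ≤ A) (hδ : 0 ≤ δ)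
    (hl : |l| * s ≤ 3 / 2 * (1 + A)) (hz : 8 * (1 + A) * |z| ≤ δ * s)
    (hw : 8 * (1 + A) * |w| ≤ δ * s) : |l * (z - w)| ≤ δ / 2 := by
  have h1 : 8 * (1 + A) * |z - w| ≤ 2 * (δ * s) := by
    have h8 : 8 * (1 + A) * |z - w| ≤ 8 * (1 + A) * (|z| + |w|) := by
      gcongr; exact abs_sub _ _
    linarith
  rw [abs_mul]
  have h2 : (8 * (1 + A) * |z - w|) * (|l| * s) ≤ 2 * (δ * s) * (3 / 2 * (1 + A)) := by
    gcongr
  have hpos : 0 < 8 * (1 + A) * s := by positivity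
  refine le_of_mul_le_mul_left ?_ hpos
  have h3 : 0 ≤ δ * s * (1 + A) := by positivity
  linarith

set_option maxHeartbeats 1000000 in
-- Here exact feasibility is needed, so the empirical covariance matrix `c` is inverted: `t i =
-- l·(R_i - R̄)` with `c l = R̄`. Centering makes the `t i` sum to zero, and the normal equations
-- make the tilted mean vanish. Then `∑ (t i)² = N R̄ᵀ c⁻¹ R̄`, which is close to `N |R̄|²`.
theorem empiricalLikelihoodRatio_lower (hN : 0 < N) (x y : Fin N → ℝ) {δ A : ℝ}
    (hδ0 : 0 < δ) (hδ : δ ≤ 1 / 20)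
    (h11 : |(∑ i, x i ^ 2) / N - 1| ≤ δ) (h12 : |(∑ i, x i * y i) / N| ≤ δ)
    (h22 : |(∑ i, y i ^ 2) / N - 1| ≤ δ)
    (hA : (∑ i, x i) ^ 2 / N + (∑ i, y i) ^ 2 / N ≤ A) (hAN : A / N ≤ δ)
    (hx : ∀ i, 8 * (1 + A) * |x i| ≤ δ * √N) (hy : ∀ i, 8 * (1 + A) * |y i| ≤ δ * √N) :
    ∃ a : ℝ, ENNReal.ofReal (Real.exp a) ≤ empiricalLikelihoodRatio (fun i => (x i, y i)) ∧
      -2 * a ≤ (1 + 20 * δ) * ((∑ i, x i) ^ 2 / N + (∑ i, y i) ^ 2 / N) := by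
  have hs : 0 < √(N : ℝ) := Real.sqrt_pos.2 (by exact_mod_cast hN)
  have hs2 : √(N : ℝ) ^ 2 = N := Real.sq_sqrt (Nat.cast_nonneg _)
  have hNpos : (0 : ℝ) < N := by exact_mod_cast hN
  set s := √(N : ℝ) with hsdef
  obtain ⟨X, hX⟩ : ∃ X, X = (∑ i, x i) / N := ⟨_, rfl⟩
  obtain ⟨Y, hY⟩ : ∃ Y, Y = (∑ i, y i) / N := ⟨_, rfl⟩
  have eX : ∑ i, x i = N * X := by rw [hX]; field_simp
  have eY : ∑ i, y i = N * Y := by rw [hY]; field_simp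
  have eW : (∑ i, x i) ^ 2 / N + (∑ i, y i) ^ 2 / N = N * (X ^ 2 + Y ^ 2) := by
    rw [eX, eY]; field_simp
  rw [eW] at hA ⊢
  have hA0 : 0 ≤ A := le_trans (by positivity) hA
  have hXY : X ^ 2 + Y ^ 2 ≤ δ := by
    refine le_trans ?_ hAN
    rw [le_div_iff₀ hNpos]; linarith
  obtain ⟨c11, hc11⟩ : ∃ c, c = (∑ i, x i ^ 2) / N - X ^ 2 := ⟨_, rfl⟩
  obtain ⟨c12, hc12⟩ : ∃ c, c = (∑ i, x i * y i) / N - X * Y := ⟨_, rfl⟩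
  obtain ⟨c22, hc22⟩ : ∃ c, c = (∑ i, y i ^ 2) / N - Y ^ 2 := ⟨_, rfl⟩
  have e11 : ∑ i, x i ^ 2 = N * (c11 + X ^ 2) := by rw [hc11]; field_simp; ring
  have e12 : ∑ i, x i * y i = N * (c12 + X * Y) := by rw [hc12]; field_simp; ring
  have e22 : ∑ i, y i ^ 2 = N * (c22 + Y ^ 2) := by rw [hc22]; field_simp; ring
  have hX2 := sq_nonneg X
  have hY2 := sq_nonneg Y
  have b11 : |c11 - 1| ≤ 2 * δ := by
    rw [hc11, abs_le]; rw [abs_le] at h11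
    constructor <;> linarith
  have b22 : |c22 - 1| ≤ 2 * δ := by
    rw [hc22, abs_le]; rw [abs_le] at h22
    constructor <;> linarith
  have b12 : |c12| ≤ 2 * δ := by
    have hxy : |X * Y| ≤ δ := by
      rw [abs_le]
      constructor <;> linarith [sq_nonneg (X - Y), sq_nonneg (X + Y), sub_sq X Y, add_sq X Y]
    rw [hc12]
    exact (abs_sub _ _).trans (by linarith)
  obtain ⟨D, hD⟩ : ∃ D, D = c11 * c22 - c12 ^ 2 := ⟨_, rfl⟩
  have hDlow : 1 - 4 * δ ≤ D := by
    have h1 : (1 - 2 * δ) * (1 - 2 * δ) ≤ c11 * c22 :=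
      mul_le_mul (by linarith [(abs_le.mp b11).1]) (by linarith [(abs_le.mp b22).1])
        (by linarith) (by linarith [(abs_le.mp b11).1])
    have h2 : c12 ^ 2 ≤ (2 * δ) ^ 2 := sq_le_sq' (abs_le.mp b12).1 (abs_le.mp b12).2
    have h3 : (1 - 2 * δ) * (1 - 2 * δ) - (2 * δ) ^ 2 = 1 - 4 * δ := by ring
    linarith
  have hDpos : 0 < D := by linarith
  have hD45 : 4 / 5 ≤ D := by linarith
  -- Cramer's rule for the normal equations `n1` and `n2`.
  obtain ⟨l₁, hl₁⟩ : ∃ l, l = (c22 * X - c12 * Y) / D := ⟨_, rfl⟩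
  obtain ⟨l₂, hl₂⟩ : ∃ l, l = (c11 * Y - c12 * X) / D := ⟨_, rfl⟩
  have n1 : l₁ * c11 + l₂ * c12 = X := by
    rw [hl₁, hl₂]; field_simp; rw [hD]; ring
  have n2 : l₁ * c12 + l₂ * c22 = Y := by
    rw [hl₁, hl₂]; field_simp; rw [hD]; ring
  have bX : ∀ c : ℝ, N * c ^ 2 ≤ A → |c| * s ≤ 1 + A := by
    intro c hc
    have h2 : (|c| * s) ^ 2 ≤ (1 + A) ^ 2 := by
      rw [mul_pow, hs2, sq_abs, add_sq]; linarith [sq_nonneg A]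
    exact abs_le_of_sq_le_sq' h2 (by positivity) |>.2
  have bX' : |X| * s ≤ 1 + A := bX X (by linarith [mul_nonneg hNpos.le (sq_nonneg Y)])
  have bY' : |Y| * s ≤ 1 + A := bX Y (by linarith [mul_nonneg hNpos.le (sq_nonneg X)])
  have bl1 : |l₁| * s ≤ 3 / 2 * (1 + A) := by rw [hl₁]; exact abs_cramer_bound hs.le hA0 hδ hD45 b22 b12 bX' bY'
  have bl2 : |l₂| * s ≤ 3 / 2 * (1 + A) := by rw [hl₂]; exact abs_cramer_bound hs.le hA0 hδ hD45 b11 b12 bY' bX'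
  have mean_bound : ∀ z : Fin N → ℝ, (∀ i, 8 * (1 + A) * |z i| ≤ δ * s) →
      8 * (1 + A) * |(∑ i, z i) / N| ≤ δ * s := by
    intro z hz
    rw [abs_div, abs_of_pos hNpos, mul_div_assoc', div_le_iff₀ hNpos]
    calc 8 * (1 + A) * |∑ i, z i| ≤ 8 * (1 + A) * ∑ i, |z i| := by
          gcongr; exact Finset.abs_sum_le_sum_abs _ _
      _ = ∑ i, 8 * (1 + A) * |z i| := by rw [Finset.mul_sum]
      _ ≤ ∑ _i : Fin N, δ * s := Finset.sum_le_sum fun i _ => hz i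
      _ = δ * s * N := by simp; ring
  have hXm := mean_bound x hx
  have hYm := mean_bound y hy
  rw [← hX] at hXm
  rw [← hY] at hYm
  have ht : ∀ i, |l₁ * (x i - X) + l₂ * (y i - Y)| ≤ δ := by
    intro i
    calc _ ≤ |l₁ * (x i - X)| + |l₂ * (y i - Y)| := abs_add_le _ _
      _ ≤ δ / 2 + δ / 2 := add_le_add (abs_mul_sub_bound hs hA0 hδ0.le bl1 (hx i) hXm)
          (abs_mul_sub_bound hs hA0 hδ0.le bl2 (hy i) hYm)
      _ = δ := by ring
  have hsum0 : ∑ i, (l₁ * (x i - X) + l₂ * (y i - Y)) = 0 := by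
    simp only [mul_sub, Finset.sum_add_distrib, Finset.sum_sub_distrib, ← Finset.mul_sum, eX, eY]
    simp
  have hsum1 : ∑ i, (1 - (l₁ * (x i - X) + l₂ * (y i - Y))) * x i = 0 := by
    have : ∑ i, (1 - (l₁ * (x i - X) + l₂ * (y i - Y))) * x i = (1 + l₁ * X + l₂ * Y) * ∑ i, x i
        - l₁ * ∑ i, x i ^ 2 - l₂ * ∑ i, x i * y i := by
      simp only [Finset.mul_sum, ← Finset.sum_sub_distrib]
      exact Finset.sum_congr rfl fun i _ => by ring
    rw [this, eX, e11, e12]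
    linear_combination (-(N : ℝ)) * n1
  have hsum2 : ∑ i, (1 - (l₁ * (x i - X) + l₂ * (y i - Y))) * y i = 0 := by
    have : ∑ i, (1 - (l₁ * (x i - X) + l₂ * (y i - Y))) * y i = (1 + l₁ * X + l₂ * Y) * ∑ i, y i
        - l₁ * ∑ i, x i * y i - l₂ * ∑ i, y i ^ 2 := by
      simp only [Finset.mul_sum, ← Finset.sum_sub_distrib]
      exact Finset.sum_congr rfl fun i _ => by ring
    rw [this, eY, e22, e12]
    linear_combination (-(N : ℝ)) * n2
  have hsq : ∑ i, (l₁ * (x i - X) + l₂ * (y i - Y)) ^ 2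
      ≤ (1 + 4 * δ) * (1 + 5 * δ) * (N * (X ^ 2 + Y ^ 2)) := by
    have e : ∑ i, (l₁ * (x i - X) + l₂ * (y i - Y)) ^ 2
        = N * ((c22 * X ^ 2 + 2 * (-c12) * (X * Y) + c11 * Y ^ 2) / D) := by
      have h1 : ∑ i, (l₁ * (x i - X) + l₂ * (y i - Y)) ^ 2 = l₁ ^ 2 * (∑ i, x i ^ 2) +
          2 * l₁ * l₂ * (∑ i, x i * y i) + l₂ ^ 2 * (∑ i, y i ^ 2)
          - 2 * (l₁ * X + l₂ * Y) * l₁ * ∑ i, x i - 2 * (l₁ * X + l₂ * Y) * l₂ * ∑ i, y i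
          + ∑ _i : Fin N, (l₁ * X + l₂ * Y) ^ 2 := by
        simp only [Finset.mul_sum, ← Finset.sum_add_distrib, ← Finset.sum_sub_distrib]
        exact Finset.sum_congr rfl fun i _ => by ring
      have h2 : ∑ _i : Fin N, (l₁ * X + l₂ * Y) ^ 2 = N * (l₁ * X + l₂ * Y) ^ 2 := by simp
      rw [h1, h2, eX, eY, e11, e12, e22]
      have h3 : l₁ * X + l₂ * Y = (c22 * X ^ 2 + 2 * (-c12) * (X * Y) + c11 * Y ^ 2) / D := by
        rw [hl₁, hl₂]; field_simp; ring
      rw [← h3]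
      linear_combination (N : ℝ) * l₁ * n1 + (N : ℝ) * l₂ * n2
    rw [e]
    have h4 : c22 * X ^ 2 + 2 * (-c12) * (X * Y) + c11 * Y ^ 2 ≤
        (1 + 2 * (2 * δ)) * (X ^ 2 + Y ^ 2) :=
      quadraticForm_le (by linarith [(abs_le.mp b22).2]) (by rwa [abs_neg])
        (by linarith [(abs_le.mp b11).2])
    -- The numerator is the form of the adjugate of `c`, which is near the identity together with
    -- `c`; the factor `1 + 5 * δ` pays for `1 / D`.
    have h5 : (c22 * X ^ 2 + 2 * (-c12) * (X * Y) + c11 * Y ^ 2) / D ≤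
        (1 + 4 * δ) * (1 + 5 * δ) * (X ^ 2 + Y ^ 2) := by
      rw [div_le_iff₀ hDpos]
      have hZ : 0 ≤ X ^ 2 + Y ^ 2 := by positivity
      have h6 : 1 ≤ (1 + 5 * δ) * D := one_le_of_small hδ0 hδ hDlow
      have h7 : 0 ≤ (1 + 4 * δ) * (X ^ 2 + Y ^ 2) := by positivity
      have h8 := mul_le_mul_of_nonneg_left h6 h7
      linarith
    calc _ ≤ (N : ℝ) * ((1 + 4 * δ) * (1 + 5 * δ) * (X ^ 2 + Y ^ 2)) := by gcongr
      _ = _ := by ring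
  have hlog := sum_log_one_add_lower (fun i => -(l₁ * (x i - X) + l₂ * (y i - Y)))
    (fun i => by rw [abs_neg]; exact ht i) (by linarith)
  refine ⟨_, le_empiricalLikelihoodRatio hN (fun i => (x i, y i)) _
    (fun i => (ht i).trans_lt (by linarith)) hsum0 hsum1 hsum2, ?_⟩
  simp only [Finset.sum_neg_distrib, hsum0, neg_sq, neg_zero, zero_sub, ← sub_eq_add_neg] at hlog
  have hW0 : 0 ≤ N * (X ^ 2 + Y ^ 2) := by positivity
  have h8 := mul_le_mul_of_nonneg_left hsq (by linarith : (0 : ℝ) ≤ 1 + 4 * δ)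
  have h9 : (1 + 4 * δ) * ((1 + 4 * δ) * (1 + 5 * δ) * (N * (X ^ 2 + Y ^ 2))) ≤
      (1 + 20 * δ) * (N * (X ^ 2 + Y ^ 2)) := by
    have := mul_le_mul_of_nonneg_right (poly_le_of_small hδ0 hδ) hW0
    linarith
  linarith

/-- Under a normalized second moment matrix and a small maximum, the empirical log-likelihood ratio
statistic is close to the squared norm of the normalized sum. -/
theorem neg_two_log_empiricalLikelihoodRatio_approx (hN : 0 < N) (x y : Fin N → ℝ) {δ A : ℝ}
    (hδ0 : 0 < δ) (hδ : δ ≤ 1 / 20)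
    (h11 : |(∑ i, x i ^ 2) / N - 1| ≤ δ) (h12 : |(∑ i, x i * y i) / N| ≤ δ)
    (h22 : |(∑ i, y i ^ 2) / N - 1| ≤ δ)
    (hA : (∑ i, x i) ^ 2 / N + (∑ i, y i) ^ 2 / N ≤ A) (hAN : A / N ≤ δ)
    (hx : ∀ i, 8 * (1 + A) * |x i| ≤ δ * √N) (hy : ∀ i, 8 * (1 + A) * |y i| ≤ δ * √N) :
    ∃ g : ℝ, (-2 : EReal) * ENNReal.log (empiricalLikelihoodRatio (fun i => (x i, y i)))
        = (g : EReal) ∧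
      |g - ((∑ i, x i) ^ 2 / N + (∑ i, y i) ^ 2 / N)| ≤ 20 * δ * A := by
  obtain ⟨a, ha1, ha2⟩ := empiricalLikelihoodRatio_upper hN x y hδ0 hδ h11 h12 h22 hA hx hy
  obtain ⟨b, hb1, hb2⟩ := empiricalLikelihoodRatio_lower hN x y hδ0 hδ h11 h12 h22 hA hAN hx hy
  obtain ⟨g, hg, hg1, hg2⟩ := neg_two_mul_log_of_mem hb1 ha1
  refine ⟨g, hg, ?_⟩
  have hW0 : 0 ≤ (∑ i, x i) ^ 2 / N + (∑ i, y i) ^ 2 / N := by positivity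
  rw [abs_le]
  constructor <;> nlinarith

end EmpiricalLikelihood

/-! ### Measurability of the likelihood ratio. -/

section Measurability

variable {N : ℕ}

/-- Upper semicontinuity by compactness: for fixed `d`, the data admitting simplex weights with
product at least `d` form the projection of a closed set along the compact simplex. Intersecting
over `d < c` avoids showing that the supremum is attained. -/
theorem isClosed_le_empiricalLikelihoodRatio (c : ℝ≥0∞) :
    IsClosed {R : Fin N → ℝ × ℝ | c ≤ empiricalLikelihoodRatio R} := by
  let K : Set (Fin N → ℝ) := stdSimplex ℝ (Fin N)
  have hK : IsCompact K := isCompact_stdSimplex ℝ (Fin N)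
  have hcl : ∀ d : ℝ≥0∞, IsClosed {R : Fin N → ℝ × ℝ | ∃ q ∈ K, ∑ i, q i • R i = 0 ∧
      d ≤ ENNReal.ofReal (∏ i, ((N : ℝ) * q i))} := by
    intro d
    have hc1 : IsClosed ({z : K × (Fin N → ℝ × ℝ) | ∑ i, z.1.1 i • z.2 i = 0} ∩
        {z | d ≤ ENNReal.ofReal (∏ i, ((N : ℝ) * z.1.1 i))}) := by
      refine IsClosed.inter (isClosed_eq ?_ continuous_const) (isClosed_le continuous_const ?_)
      · refine continuous_finsetSum _ fun i _ => ?_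
        exact (((continuous_apply i).comp (continuous_subtype_val.comp continuous_fst))).smul
          ((continuous_apply i).comp continuous_snd)
      · refine ENNReal.continuous_ofReal.comp (continuous_finsetProd _ fun i _ => ?_)
        exact continuous_const.mul
          ((continuous_apply i).comp (continuous_subtype_val.comp continuous_fst))
    have : CompactSpace K := isCompact_iff_compactSpace.mp hK
    have hmap := isClosedMap_snd_of_compactSpace (X := K) (Y := Fin N → ℝ × ℝ) _ hc1
    convert hmap using 1
    ext R
    constructor
    · rintro ⟨q, hq, h⟩
      exact ⟨(⟨q, hq⟩, R), h, rfl⟩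
    · rintro ⟨⟨q, R'⟩, h, rfl⟩
      exact ⟨q.1, q.2, h⟩
  have heq : {R : Fin N → ℝ × ℝ | c ≤ empiricalLikelihoodRatio R} =
      ⋂ d ∈ Set.Iio c, {R : Fin N → ℝ × ℝ | ∃ q ∈ K, ∑ i, q i • R i = 0 ∧
        d ≤ ENNReal.ofReal (∏ i, ((N : ℝ) * q i))} := by
    ext R
    simp only [Set.mem_ofPred_eq, Set.mem_iInter, Set.mem_Iio]
    constructor
    · intro h d hd
      obtain ⟨L, ⟨q, h0, h1, h2, rfl⟩, hL⟩ := lt_sSup_iff.mp (hd.trans_le h)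
      exact ⟨q, ⟨h0, h1⟩, h2, hL.le⟩
    · intro h
      refine le_of_forall_lt fun d hd => ?_
      obtain ⟨e, hde, hec⟩ := exists_between hd
      obtain ⟨q, ⟨h0, h1⟩, h2, h3⟩ := h e hec
      exact hde.trans_le (h3.trans (le_sSup ⟨q, h0, h1, h2, rfl⟩))
  rw [heq]
  exact isClosed_biInter fun d _ => hcl d

theorem measurable_empiricalLikelihoodRatio :
    Measurable (empiricalLikelihoodRatio : (Fin N → ℝ × ℝ) → ℝ≥0∞) := by
  refine measurable_of_Ici fun c => ?_
  exact (isClosed_le_empiricalLikelihoodRatio c).measurableSet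

theorem measurable_neg_two_log_empiricalLikelihoodRatio {Ω : Type*} [MeasurableSpace Ω]
    {R : Fin N → Ω → ℝ × ℝ} (hR : ∀ i, Measurable (R i)) :
    Measurable fun ω => (-2 : EReal) *
      ENNReal.log (empiricalLikelihoodRatio fun i => R i ω) := by
  have h : Measurable fun ω => ENNReal.log (empiricalLikelihoodRatio fun i => R i ω) :=
    ENNReal.measurable_log.comp
      (measurable_empiricalLikelihoodRatio.comp (measurable_pi_lambda _ hR))
  have h2 : Antitone fun x : EReal => (-2 : EReal) * x := by
    intro x y hxy
    have h : (-2 : EReal) = -(2 : EReal) := rfl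
    simp only [neg_mul]
    exact EReal.neg_le_neg_iff.2 (mul_le_mul_of_nonneg_left hxy (by norm_num))
  exact h2.measurable.comp h

end Measurability

/-! ### Moment inequalities and polynomials in variables with factorized moments. -/

section Moments

variable {Ω : Type*} [MeasurableSpace Ω] {P : Measure Ω}

theorem sq_integral_mul_le {f g : Ω → ℝ} (hf : Integrable (fun ω => f ω ^ 2) P)
    (hg : Integrable (fun ω => g ω ^ 2) P) (hfg : Integrable (fun ω => f ω * g ω) P) :
    (∫ ω, f ω * g ω ∂P) ^ 2 ≤ (∫ ω, f ω ^ 2 ∂P) * ∫ ω, g ω ^ 2 ∂P := by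
  have h : ∀ t : ℝ, 0 ≤ (∫ ω, f ω ^ 2 ∂P) * (t * t) + (2 * ∫ ω, f ω * g ω ∂P) * t
      + ∫ ω, g ω ^ 2 ∂P := by
    intro t
    have e : (∫ ω, f ω ^ 2 ∂P) * (t * t) + (2 * ∫ ω, f ω * g ω ∂P) * t + ∫ ω, g ω ^ 2 ∂P =
        ∫ ω, (t * f ω + g ω) ^ 2 ∂P := by
      have : ∀ ω, (t * f ω + g ω) ^ 2 = (t * t) * f ω ^ 2 + (2 * t) * (f ω * g ω) + g ω ^ 2 :=
        fun ω => by ring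
      simp only [this]
      rw [integral_add ((hf.const_mul _).fun_add (hfg.const_mul _)) hg,
        integral_add (hf.const_mul _) (hfg.const_mul _), integral_const_mul, integral_const_mul]
      ring
    rw [e]
    exact integral_nonneg fun ω => sq_nonneg _
  have := discrim_le_zero h
  rw [discrim] at this
  nlinarith

theorem integral_mul_le_sqrt_mul_sqrt {f g : Ω → ℝ} (hf : Integrable (fun ω => f ω ^ 2) P)
    (hg : Integrable (fun ω => g ω ^ 2) P) (hfg : Integrable (fun ω => f ω * g ω) P) :
    ∫ ω, f ω * g ω ∂P ≤ √(∫ ω, f ω ^ 2 ∂P) * √(∫ ω, g ω ^ 2 ∂P) := by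
  rw [← Real.sqrt_mul (integral_nonneg fun ω => sq_nonneg _)]
  exact Real.le_sqrt_of_sq_le (sq_integral_mul_le hf hg hfg)

/-- A martingale-type increment bound for fourth moments. -/
theorem sqrt_integral_add_pow_four_le {f g : Ω → ℝ} (h40 : Integrable (fun ω => f ω ^ 4) P)
    (h31 : Integrable (fun ω => f ω ^ 3 * g ω) P)
    (h22 : Integrable (fun ω => f ω ^ 2 * g ω ^ 2) P)
    (h13 : Integrable (fun ω => f ω * g ω ^ 3) P) (h04 : Integrable (fun ω => g ω ^ 4) P)
    (h0 : ∫ ω, f ω ^ 3 * g ω ∂P = 0) :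
    √(∫ ω, (f ω + g ω) ^ 4 ∂P) ≤ √(∫ ω, f ω ^ 4 ∂P) + 4 * √(∫ ω, g ω ^ 4 ∂P) := by
  have e : ∫ ω, (f ω + g ω) ^ 4 ∂P = ∫ ω, f ω ^ 4 ∂P + 6 * ∫ ω, f ω ^ 2 * g ω ^ 2 ∂P
      + 4 * ∫ ω, f ω * g ω ^ 3 ∂P + ∫ ω, g ω ^ 4 ∂P := by
    have : ∀ ω, (f ω + g ω) ^ 4 = f ω ^ 4 + 4 * (f ω ^ 3 * g ω) + 6 * (f ω ^ 2 * g ω ^ 2)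
        + 4 * (f ω * g ω ^ 3) + g ω ^ 4 := fun ω => by ring
    simp only [this]
    rw [integral_add (((h40.fun_add (h31.const_mul _)).fun_add (h22.const_mul _)).fun_add (h13.const_mul _))
        h04, integral_add ((h40.fun_add (h31.const_mul _)).fun_add (h22.const_mul _)) (h13.const_mul _),
      integral_add (h40.fun_add (h31.const_mul _)) (h22.const_mul _),
      integral_add h40 (h31.const_mul _)]
    simp only [integral_const_mul, h0]
    ring
  have hA : 0 ≤ ∫ ω, f ω ^ 4 ∂P := integral_nonneg fun ω => by positivity
  have hB : 0 ≤ ∫ ω, g ω ^ 4 ∂P := integral_nonneg fun ω => by positivity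
  have hcs : ∫ ω, f ω ^ 2 * g ω ^ 2 ∂P ≤ √(∫ ω, f ω ^ 4 ∂P) * √(∫ ω, g ω ^ 4 ∂P) := by
    have := integral_mul_le_sqrt_mul_sqrt (f := fun ω => f ω ^ 2) (g := fun ω => g ω ^ 2)
      (P := P) (by simpa only [← pow_mul] using h40) (by simpa only [← pow_mul] using h04) h22
    simpa only [← pow_mul] using this
  have h3 : 2 * ∫ ω, f ω * g ω ^ 3 ∂P ≤ ∫ ω, f ω ^ 2 * g ω ^ 2 ∂P + ∫ ω, g ω ^ 4 ∂P := by
    rw [← integral_const_mul, ← integral_add h22 h04]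
    refine integral_mono (h13.const_mul _) (h22.add h04) fun ω => ?_
    nlinarith [sq_nonneg (f ω * g ω - g ω ^ 2)]
  obtain ⟨F, hF⟩ : ∃ F, F = √(∫ ω, f ω ^ 4 ∂P) := ⟨_, rfl⟩
  obtain ⟨G, hG⟩ : ∃ G, G = √(∫ ω, g ω ^ 4 ∂P) := ⟨_, rfl⟩
  have hF2 : ∫ ω, f ω ^ 4 ∂P = F ^ 2 := by rw [hF, Real.sq_sqrt hA]
  have hG2 : ∫ ω, g ω ^ 4 ∂P = G ^ 2 := by rw [hG, Real.sq_sqrt hB]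
  have hF0 : 0 ≤ F := hF ▸ Real.sqrt_nonneg _
  have hG0 : 0 ≤ G := hG ▸ Real.sqrt_nonneg _
  rw [← hF, ← hG] at hcs ⊢
  -- By `hcs` and `h3` the expansion is at most `F² + 8FG + 3G²`, which is below `(F + 4G)²`.
  refine Real.sqrt_le_iff.mpr ⟨by positivity, ?_⟩
  rw [e]
  nlinarith

variable {ι : Type*} [Fintype ι]

/-- A random vector with mean zero, unit variances, common fourth moments `3 + Δ`, eighth moments
at most `C`, and mixed moments of order at most `8` that factorize. -/
structure HasFactorizedMoments (P : Measure Ω) (ζ : ι → Ω → ℝ) (Δ C : ℝ) : Prop where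
  measurable : ∀ x, Measurable (ζ x)
  memLp_eight : ∀ x, MemLp (ζ x) 8 P
  mean_zero : ∀ x, ∫ ω, ζ x ω ∂P = 0
  second_moment : ∀ x, ∫ ω, ζ x ω ^ 2 ∂P = 1
  fourth_moment : ∀ x, ∫ ω, ζ x ω ^ 4 ∂P = 3 + Δ
  eighth_moment_le : ∀ x, ∫ ω, ζ x ω ^ 8 ∂P ≤ C
  factorization : ∀ l : ι → ℕ, ∑ x, l x ≤ 8 →
    ∫ ω, ∏ x, ζ x ω ^ l x ∂P = ∏ x, ∫ ω, ζ x ω ^ l x ∂P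

/-- The span of the monomials of degree at most `d` in the variables `ζ x`, `x ∈ s`. -/
def monomialSpan (ζ : ι → Ω → ℝ) (s : Finset ι) (d : ℕ) : Submodule ℝ (Ω → ℝ) :=
  Submodule.span ℝ {f | ∃ l : ι → ℕ, (∀ x, x ∉ s → l x = 0) ∧ ∑ x, l x ≤ d ∧
    f = fun ω => ∏ x, ζ x ω ^ l x}

variable {ζ : ι → Ω → ℝ} {s t : Finset ι} {d e : ℕ} {f g : Ω → ℝ}

theorem monomialSpan_mono (hst : s ⊆ t) (hde : d ≤ e) :
    monomialSpan ζ s d ≤ monomialSpan ζ t e := by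
  refine Submodule.span_mono ?_
  rintro f ⟨l, h1, h2, h3⟩
  exact ⟨l, fun x hx => h1 x fun h => hx (hst h), h2.trans hde, h3⟩

theorem mul_mem_monomialSpan (hf : f ∈ monomialSpan ζ s d) (hg : g ∈ monomialSpan ζ s e) :
    f * g ∈ monomialSpan ζ s (d + e) := by
  unfold monomialSpan at hf hg
  induction hf using Submodule.span_induction with
  | zero => rw [zero_mul]; exact Submodule.zero_mem _
  | add x y _ _ hx hy => rw [add_mul]; exact Submodule.add_mem _ hx hy
  | smul a x _ hx => rw [smul_mul_assoc]; exact Submodule.smul_mem _ _ hx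
  | mem f hf =>
    obtain ⟨l, h1, h2, rfl⟩ := hf
    induction hg using Submodule.span_induction with
    | zero => rw [mul_zero]; exact Submodule.zero_mem _
    | add x y _ _ hx hy => rw [mul_add]; exact Submodule.add_mem _ hx hy
    | smul a x _ hx => rw [mul_smul_comm]; exact Submodule.smul_mem _ _ hx
    | mem g hg =>
      obtain ⟨l', h1', h2', rfl⟩ := hg
      refine Submodule.subset_span ⟨l + l', fun x hx => ?_, ?_, ?_⟩
      · simp [h1 x hx, h1' x hx]
      · simp only [Pi.add_apply, Finset.sum_add_distrib]
        omega
      · ext ω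
        simp only [Pi.mul_apply, Pi.add_apply, pow_add, Finset.prod_mul_distrib]

theorem const_mem_monomialSpan (c : ℝ) : (fun _ => c) ∈ monomialSpan ζ s d := by
  have h : (fun _ : Ω => (1 : ℝ)) ∈ monomialSpan ζ s d :=
    Submodule.subset_span ⟨0, by simp, by simp, by ext; simp⟩
  have := Submodule.smul_mem _ c h
  convert this using 1
  ext; simp

theorem coord_mem_monomialSpan {x : ι} (hx : x ∈ s) (hd : 1 ≤ d) :
    ζ x ∈ monomialSpan ζ s d := by
  classical
  refine Submodule.subset_span ⟨Pi.single x 1, fun y hy => ?_, by simpa using hd, ?_⟩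
  · rw [Pi.single_eq_of_ne]
    rintro rfl
    exact hy hx
  · ext ω
    rw [Finset.prod_eq_single x]
    · simp
    · intro y _ hy; simp [Pi.single_eq_of_ne hy]
    · simp

theorem pow_mem_monomialSpan (hf : f ∈ monomialSpan ζ s d) (k : ℕ) :
    f ^ k ∈ monomialSpan ζ s (d * k) := by
  induction k with
  | zero => rw [pow_zero]; exact const_mem_monomialSpan 1
  | succ k ih => rw [pow_succ, Nat.mul_succ]; exact mul_mem_monomialSpan ih hf

theorem measurable_of_mem_monomialSpan (hζ : ∀ x, Measurable (ζ x))
    (hf : f ∈ monomialSpan ζ s d) : Measurable f := by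
  induction hf using Submodule.span_induction with
  | zero => exact measurable_const
  | add x y _ _ hx hy => exact hx.add hy
  | smul a x _ hx => exact hx.const_smul a
  | mem f hf =>
    obtain ⟨l, -, -, rfl⟩ := hf
    exact Finset.measurable_fun_prod _ fun x _ => (hζ x).pow_const _

namespace HasFactorizedMoments

variable [IsProbabilityMeasure P] {Δ C : ℝ} (h : HasFactorizedMoments P ζ Δ C)
include h

theorem integrable_pow_eight (x : ι) : Integrable (fun ω => ζ x ω ^ 8) P := by
  have := (h.memLp_eight x).integrable_norm_pow (p := 8) (by norm_num)
  refine this.congr (Eventually.of_forall fun ω => ?_)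
  simp only [Real.norm_eq_abs]
  exact Even.pow_abs (by decide) _

/-- A monomial is dominated by `1 + ∑ ζ_x⁸`: either all variables are at most `1` in absolute value,
or the power `8` of the largest one dominates. -/
theorem integrable_of_mem (hf : f ∈ monomialSpan ζ s d) (hd : d ≤ 8) : Integrable f P := by
  induction hf using Submodule.span_induction with
  | zero => exact integrable_zero _ _ _
  | add x y _ _ hx hy => exact hx.add hy
  | smul a x _ hx => exact hx.smul a
  | mem f hf =>
    obtain ⟨l, -, hl, rfl⟩ := hf
    have hdom : Integrable (fun ω => 1 + ∑ x, ζ x ω ^ 8) P :=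
      (integrable_const _).add (integrable_finsetSum _ fun x _ => h.integrable_pow_eight x)
    refine hdom.mono'
      (Finset.measurable_fun_prod _ fun x _ => (h.measurable x).pow_const _).aestronglyMeasurable
      (Eventually.of_forall fun ω => ?_)
    have hnn : ∀ x, 0 ≤ ζ x ω ^ 8 := fun x => by positivity
    rw [Real.norm_eq_abs, Finset.abs_prod]
    simp only [abs_pow]
    by_cases hbig : ∀ x, |ζ x ω| ≤ 1
    · calc ∏ x, |ζ x ω| ^ l x ≤ ∏ _x : ι, (1 : ℝ) :=
            Finset.prod_le_prod (fun x _ => by positivity)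
              fun x _ => pow_le_one₀ (abs_nonneg _) (hbig x)
        _ = 1 := by simp
        _ ≤ 1 + ∑ x, ζ x ω ^ 8 := le_add_of_nonneg_right (Finset.sum_nonneg fun x _ => hnn x)
    · push Not at hbig
      obtain ⟨x₁, hx₁⟩ := hbig
      obtain ⟨x₀, -, hx₀⟩ := Finset.exists_max_image Finset.univ (fun x => |ζ x ω|) ⟨x₁, by simp⟩
      have h1 : 1 ≤ |ζ x₀ ω| := hx₁.le.trans (hx₀ x₁ (by simp))
      calc ∏ x, |ζ x ω| ^ l x ≤ ∏ x, |ζ x₀ ω| ^ l x :=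
            Finset.prod_le_prod (fun x _ => by positivity)
              fun x _ => pow_le_pow_left₀ (abs_nonneg _) (hx₀ x (by simp)) _
        _ = |ζ x₀ ω| ^ (∑ x, l x) := by rw [Finset.prod_pow_eq_pow_sum]
        _ ≤ |ζ x₀ ω| ^ 8 := pow_le_pow_right₀ h1 (hl.trans hd)
        _ = ζ x₀ ω ^ 8 := Even.pow_abs (by decide) _
        _ ≤ ∑ x, ζ x ω ^ 8 :=
            Finset.single_le_sum (f := fun x => ζ x ω ^ 8) (fun x _ => hnn x) (Finset.mem_univ x₀)
        _ ≤ 1 + ∑ x, ζ x ω ^ 8 := by linarith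

/-- A substitute for independence: a variable that does not occur in a polynomial factors out, as
long as the total degree is at most `8`. By linearity it is enough to treat monomials, where the
exponent vector acquires the entry `j` at `x`. -/
theorem integral_mul_pow (hf : f ∈ monomialSpan ζ s d) {x : ι} (hx : x ∉ s) {j : ℕ}
    (hdj : d + j ≤ 8) :
    ∫ ω, f ω * ζ x ω ^ j ∂P = (∫ ω, f ω ∂P) * ∫ ω, ζ x ω ^ j ∂P := by
  classical
  have hint : ∀ f ∈ monomialSpan ζ s d, Integrable (fun ω => f ω * ζ x ω ^ j) P := by
    intro f hf
    have h1 : f ∈ monomialSpan ζ Finset.univ d :=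
      monomialSpan_mono (Finset.subset_univ _) le_rfl hf
    have h2 := pow_mem_monomialSpan
      (coord_mem_monomialSpan (ζ := ζ) (s := Finset.univ) (Finset.mem_univ x) le_rfl) j
    exact h.integrable_of_mem (mul_mem_monomialSpan h1 h2) (by omega)
  have hint' : ∀ f ∈ monomialSpan ζ s d, Integrable f P := fun f hf =>
    h.integrable_of_mem hf (by omega)
  induction hf using Submodule.span_induction with
  | zero => simp
  | add u v hu hv hu' hv' =>
    simp only [Pi.add_apply, add_mul]
    rw [integral_add (hint u hu) (hint v hv), hu', hv', integral_add (hint' u hu) (hint' v hv)]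
    ring
  | smul a u hu hu' =>
    simp only [Pi.smul_apply, smul_eq_mul, mul_assoc]
    rw [integral_const_mul, hu', integral_const_mul]
    ring
  | mem f hf =>
    obtain ⟨l, hl0, hl, rfl⟩ := hf
    have e1 : ∀ ω, (∏ y, ζ y ω ^ l y) * ζ x ω ^ j = ∏ y, ζ y ω ^ (l + Pi.single x j : ι → ℕ) y := by
      intro ω
      simp only [Pi.add_apply, pow_add, Finset.prod_mul_distrib]
      congr 1
      rw [Finset.prod_eq_single x]
      · simp
      · intro y _ hy; simp [Pi.single_eq_of_ne hy]
      · simp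
    simp only [e1]
    have hsingle : ∑ y, (Pi.single x j : ι → ℕ) y = j := by simp
    have hfac := h.factorization (l + Pi.single x j) (by
      simp only [Pi.add_apply, Finset.sum_add_distrib]
      omega)
    rw [h.factorization l (by omega), hfac]
    have e2 : ∫ ω, ζ x ω ^ j ∂P = ∏ y, if y = x then ∫ ω, ζ x ω ^ j ∂P else 1 := by simp
    rw [e2, ← Finset.prod_mul_distrib]
    refine Finset.prod_congr rfl fun y _ => ?_
    by_cases hy : y = x
    · subst hy
      simp [hl0 y hx]
    · simp [hy]

end HasFactorizedMoments

end Moments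

/-! ### Moments of centered quadratic forms, by adding one variable at a time. -/

section QuadraticForms

theorem sum_insert_insert {ι M : Type*} [AddCommMonoid M] [DecidableEq ι] {s : Finset ι} {x : ι}
    (hx : x ∉ s) (F : ι → ι → M) :
    ∑ a ∈ insert x s, ∑ b ∈ insert x s, F a b =
      ∑ a ∈ s, ∑ b ∈ s, F a b + (F x x + ∑ y ∈ s, (F x y + F y x)) := by
  simp only [Finset.sum_insert hx, Finset.sum_add_distrib]
  abel

variable {Ω : Type*} [MeasurableSpace Ω] {P : Measure Ω} [IsProbabilityMeasure P]
  {ι : Type*} [Fintype ι] [DecidableEq ι] {ζ : ι → Ω → ℝ} {Δ C : ℝ} {s : Finset ι}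

/-- `ζ_x ζ_y - δ_{xy}`. -/
def centeredProduct (ζ : ι → Ω → ℝ) (x y : ι) (ω : Ω) : ℝ :=
  ζ x ω * ζ y ω - if x = y then 1 else 0

theorem sum_mem_monomialSpan (a : ι → ℝ) :
    (fun ω => ∑ y ∈ s, a y * ζ y ω) ∈ monomialSpan ζ s 1 := by
  have : (fun ω => ∑ y ∈ s, a y * ζ y ω) = ∑ y ∈ s, a y • ζ y := by
    ext ω; simp
  rw [this]
  exact Submodule.sum_mem _ fun y hy => Submodule.smul_mem _ _ (coord_mem_monomialSpan hy le_rfl)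

theorem centeredProduct_mem_monomialSpan {x y : ι} (hx : x ∈ s) (hy : y ∈ s) :
    centeredProduct ζ x y ∈ monomialSpan ζ s 2 :=
  Submodule.sub_mem _ (mul_mem_monomialSpan (d := 1) (e := 1) (coord_mem_monomialSpan hx le_rfl)
    (coord_mem_monomialSpan hy le_rfl)) (const_mem_monomialSpan _)

theorem sum_centeredProduct_mem_monomialSpan (A : ι → ι → ℝ) :
    (fun ω => ∑ x ∈ s, ∑ y ∈ s, A x y * centeredProduct ζ x y ω) ∈ monomialSpan ζ s 2 := by
  have : (fun ω => ∑ x ∈ s, ∑ y ∈ s, A x y * centeredProduct ζ x y ω) =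
      ∑ x ∈ s, ∑ y ∈ s, A x y • centeredProduct ζ x y := by
    ext ω; simp
  rw [this]
  exact Submodule.sum_mem _ fun x hx => Submodule.sum_mem _ fun y hy =>
    Submodule.smul_mem _ _ (centeredProduct_mem_monomialSpan hx hy)

/-- The increment caused by a new variable has the structure of a martingale difference: `ζ_x² - 1`
and `ζ_x` have mean zero, and their coefficients involve only the earlier variables. -/
theorem sum_insert_centeredProduct {x : ι} (hx : x ∉ s) (A : ι → ι → ℝ) (ω : Ω) :
    ∑ a ∈ insert x s, ∑ b ∈ insert x s, A a b * centeredProduct ζ a b ω =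
      ∑ a ∈ s, ∑ b ∈ s, A a b * centeredProduct ζ a b ω +
        (A x x * (ζ x ω ^ 2 - 1) + (∑ y ∈ s, (A x y + A y x) * ζ y ω) * ζ x ω) := by
  rw [sum_insert_insert hx, Finset.sum_mul]
  congr 2
  · simp [centeredProduct]; left; ring
  · refine Finset.sum_congr rfl fun y hy => ?_
    have hxy : x ≠ y := fun e => hx (e ▸ hy)
    simp only [centeredProduct, hxy, hxy.symm, if_false]
    ring

namespace HasFactorizedMoments

variable (h : HasFactorizedMoments P ζ Δ C)
include h

theorem integral_linear (a : ι → ℝ) (s : Finset ι) : ∫ ω, ∑ y ∈ s, a y * ζ y ω ∂P = 0 := by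
  rw [integral_finsetSum]
  · simp only [integral_const_mul, h.mean_zero, mul_zero, Finset.sum_const_zero]
  · exact fun y _ => ((h.memLp_eight y).integrable (by norm_num)).const_mul _

/-- The square root of the fourth moment is subadditive along the increments, up to the factor `4`
of `sqrt_integral_add_pow_four_le`; the cubic cross term vanishes because the new variable has mean
zero. Hence the bound is additive in the squares of the coefficients. -/
theorem sqrt_integral_linear_pow_four_le (a : ι → ℝ) (s : Finset ι) :
    √(∫ ω, (∑ y ∈ s, a y * ζ y ω) ^ 4 ∂P) ≤ 4 * √(3 + Δ) * ∑ y ∈ s, a y ^ 2 := by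
  induction s using Finset.induction_on with
  | empty => simp
  | insert x s hx ih =>
    have e : ∀ ω, ∑ y ∈ insert x s, a y * ζ y ω = ∑ y ∈ s, a y * ζ y ω + a x * ζ x ω := fun ω => by
      rw [Finset.sum_insert hx, add_comm]
    have hf : (fun ω => ∑ y ∈ s, a y * ζ y ω) ∈ monomialSpan ζ Finset.univ 1 :=
      monomialSpan_mono (Finset.subset_univ s) le_rfl (sum_mem_monomialSpan a)
    have hg : (fun ω => a x * ζ x ω) ∈ monomialSpan ζ Finset.univ 1 :=
      Submodule.smul_mem _ (a x) (coord_mem_monomialSpan (Finset.mem_univ x) le_rfl)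
    have hmul := fun i j => mul_mem_monomialSpan (pow_mem_monomialSpan hf i)
      (pow_mem_monomialSpan hg j)
    have key := sqrt_integral_add_pow_four_le (P := P)
      (f := fun ω => ∑ y ∈ s, a y * ζ y ω) (g := fun ω => a x * ζ x ω)
      (h.integrable_of_mem (pow_mem_monomialSpan hf 4) (by norm_num))
      (by simpa using! h.integrable_of_mem (hmul 3 1) (by norm_num))
      (by simpa using! h.integrable_of_mem (hmul 2 2) (by norm_num))
      (by simpa using! h.integrable_of_mem (hmul 1 3) (by norm_num))
      (h.integrable_of_mem (pow_mem_monomialSpan hg 4) (by norm_num)) (by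
        have := h.integral_mul_pow (pow_mem_monomialSpan (sum_mem_monomialSpan (s := s) a) 3) hx
          (j := 1) (by norm_num)
        simp only [pow_one, h.mean_zero, mul_zero, Pi.pow_apply] at this
        simp only [mul_left_comm _ (a x), integral_const_mul, this, mul_zero])
    simp only [e]
    refine key.trans ?_
    have e4 : √(∫ ω, (a x * ζ x ω) ^ 4 ∂P) = a x ^ 2 * √(3 + Δ) := by
      simp only [mul_pow, integral_const_mul, h.fourth_moment]
      rw [Real.sqrt_mul (by positivity), show a x ^ 4 = (a x ^ 2) ^ 2 by ring,
        Real.sqrt_sq (sq_nonneg _)]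
    rw [e4, Finset.sum_insert hx]
    linarith

theorem integral_linear_sq (a : ι → ℝ) (s : Finset ι) :
    ∫ ω, (∑ y ∈ s, a y * ζ y ω) ^ 2 ∂P = ∑ y ∈ s, a y ^ 2 := by
  induction s using Finset.induction_on with
  | empty => simp
  | insert x s hx ih =>
    have hf : (fun ω => ∑ y ∈ s, a y * ζ y ω) ∈ monomialSpan ζ s 1 := sum_mem_monomialSpan a
    have hf' : (fun ω => ∑ y ∈ s, a y * ζ y ω) ∈ monomialSpan ζ Finset.univ 1 :=
      monomialSpan_mono (Finset.subset_univ s) le_rfl hf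
    have hx' : ζ x ∈ monomialSpan ζ Finset.univ 1 := coord_mem_monomialSpan (Finset.mem_univ x) le_rfl
    have e : ∀ ω, (∑ y ∈ insert x s, a y * ζ y ω) ^ 2 = (∑ y ∈ s, a y * ζ y ω) ^ 2 +
        (2 * a x) * ((∑ y ∈ s, a y * ζ y ω) * ζ x ω) + a x ^ 2 * ζ x ω ^ 2 := fun ω => by
      rw [Finset.sum_insert hx]; ring
    have i1 : Integrable (fun ω => (∑ y ∈ s, a y * ζ y ω) ^ 2) P :=
      h.integrable_of_mem (pow_mem_monomialSpan hf' 2) (by norm_num)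
    have i2 : Integrable (fun ω => (∑ y ∈ s, a y * ζ y ω) * ζ x ω) P :=
      h.integrable_of_mem (mul_mem_monomialSpan hf' hx') (by norm_num)
    have i3 : Integrable (fun ω => ζ x ω ^ 2) P :=
      h.integrable_of_mem (pow_mem_monomialSpan hx' 2) (by norm_num)
    have := h.integral_mul_pow hf hx (j := 1) (by norm_num)
    simp only [pow_one, h.mean_zero, mul_zero] at this
    simp only [e]
    rw [integral_add (i1.fun_add (i2.const_mul _)) (i3.const_mul _),
      integral_add i1 (i2.const_mul _), integral_const_mul, integral_const_mul, this, ih,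
      h.second_moment, Finset.sum_insert hx]
    ring

/-- A constant for the fourth moments of centered quadratic forms. -/
def _root_.quadraticMomentConst (Δ C : ℝ) : ℝ := 16 * (64 * (|C| + 1) + 512 * (3 + Δ) ^ 2)

theorem sqrt_integral_increment_pow_four_le (A : ι → ι → ℝ) {x : ι} (hx : x ∉ s) :
    4 * √(∫ ω, (A x x * (ζ x ω ^ 2 - 1) + (∑ y ∈ s, (A x y + A y x) * ζ y ω) * ζ x ω) ^ 4 ∂P) ≤
      √(quadraticMomentConst Δ C) * (A x x ^ 2 + ∑ y ∈ s, (A x y ^ 2 + A y x ^ 2)) := by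
  set L : Ω → ℝ := fun ω => ∑ y ∈ s, (A x y + A y x) * ζ y ω with hL
  have hLs : L ∈ monomialSpan ζ s 1 := sum_mem_monomialSpan fun y => A x y + A y x
  have hLu : L ∈ monomialSpan ζ Finset.univ 1 := monomialSpan_mono (Finset.subset_univ s) le_rfl hLs
  have hx' : ζ x ∈ monomialSpan ζ Finset.univ 1 := coord_mem_monomialSpan (Finset.mem_univ x) le_rfl
  have i1 : Integrable (fun ω => ζ x ω ^ 8) P := h.integrable_pow_eight x
  have i2 : Integrable (fun ω => L ω ^ 4 * ζ x ω ^ 4) P :=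
    h.integrable_of_mem (mul_mem_monomialSpan (pow_mem_monomialSpan hLu 4)
      (pow_mem_monomialSpan hx' 4)) (by norm_num)
  obtain ⟨S, hS⟩ : ∃ S, S = ∑ y ∈ s, (A x y ^ 2 + A y x ^ 2) := ⟨_, rfl⟩
  have hS0 : 0 ≤ S := hS ▸ Finset.sum_nonneg fun y _ => by positivity
  have hΔ : 0 ≤ 3 + Δ := by
    rw [← h.fourth_moment x]; exact integral_nonneg fun ω => by positivity
  have hL4 : ∫ ω, L ω ^ 4 ∂P ≤ 64 * (3 + Δ) * S ^ 2 := by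
    have h1 := h.sqrt_integral_linear_pow_four_le (fun y => A x y + A y x) s
    have h2 : ∑ y ∈ s, (A x y + A y x) ^ 2 ≤ 2 * S := by
      rw [hS, Finset.mul_sum]
      exact Finset.sum_le_sum fun y _ => by nlinarith [sq_nonneg (A x y - A y x)]
    have h3 : √(∫ ω, L ω ^ 4 ∂P) ≤ 4 * √(3 + Δ) * (2 * S) := h1.trans (by gcongr)
    have h4 := (Real.sqrt_le_left (by positivity)).mp h3
    calc _ ≤ _ := h4
      _ = 64 * (√(3 + Δ)) ^ 2 * S ^ 2 := by ring
      _ = _ := by rw [Real.sq_sqrt hΔ]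
  have hLx : ∫ ω, L ω ^ 4 * ζ x ω ^ 4 ∂P = (∫ ω, L ω ^ 4 ∂P) * (3 + Δ) := by
    have := h.integral_mul_pow (pow_mem_monomialSpan hLs 4) hx (j := 4) (by norm_num)
    rwa [h.fourth_moment] at this
  have hg : ∫ ω, (A x x * (ζ x ω ^ 2 - 1) + L ω * ζ x ω) ^ 4 ∂P ≤
      (64 * (|C| + 1) + 512 * (3 + Δ) ^ 2) * (A x x ^ 2 + S) ^ 2 := by
    calc ∫ ω, (A x x * (ζ x ω ^ 2 - 1) + L ω * ζ x ω) ^ 4 ∂P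
        ≤ ∫ ω, (64 * A x x ^ 4 * (ζ x ω ^ 8 + 1) + 8 * (L ω ^ 4 * ζ x ω ^ 4)) ∂P := by
          refine integral_mono_of_nonneg (Eventually.of_forall fun ω => by positivity)
            (((i1.fun_add (integrable_const _)).const_mul _).fun_add (i2.const_mul _))
            (Eventually.of_forall fun ω => ?_)
          have p4 : ∀ u v : ℝ, (u + v) ^ 4 ≤ 8 * (u ^ 4 + v ^ 4) := fun u v => by
            have h1 : (u + v) ^ 2 ≤ 2 * (u ^ 2 + v ^ 2) := by nlinarith [sq_nonneg (u - v)]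
            calc (u + v) ^ 4 = ((u + v) ^ 2) ^ 2 := by ring
              _ ≤ (2 * (u ^ 2 + v ^ 2)) ^ 2 := by gcongr
              _ ≤ 8 * (u ^ 4 + v ^ 4) := by nlinarith [sq_nonneg (u ^ 2 - v ^ 2)]
          have h1 := p4 (A x x * (ζ x ω ^ 2 - 1)) (L ω * ζ x ω)
          have h2 := p4 (ζ x ω ^ 2) (-1)
          have h3 : A x x ^ 4 * (ζ x ω ^ 2 + -1) ^ 4 ≤
              A x x ^ 4 * (8 * ((ζ x ω ^ 2) ^ 4 + (-1) ^ 4)) := by gcongr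
          simp only
          calc _ ≤ _ := h1
            _ = 8 * (A x x ^ 4 * (ζ x ω ^ 2 + -1) ^ 4) + 8 * (L ω ^ 4 * ζ x ω ^ 4) := by ring
            _ ≤ 8 * (A x x ^ 4 * (8 * ((ζ x ω ^ 2) ^ 4 + (-1) ^ 4)))
                + 8 * (L ω ^ 4 * ζ x ω ^ 4) := by gcongr
            _ = _ := by ring
      _ = 64 * A x x ^ 4 * (∫ ω, ζ x ω ^ 8 ∂P + 1) + 8 * ((∫ ω, L ω ^ 4 ∂P) * (3 + Δ)) := by
          rw [integral_add ((i1.fun_add (integrable_const _)).const_mul _) (i2.const_mul _),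
            integral_const_mul, integral_const_mul, integral_add i1 (integrable_const _), hLx]
          simp
      _ ≤ 64 * A x x ^ 4 * (|C| + 1) + 8 * ((64 * (3 + Δ) * S ^ 2) * (3 + Δ)) := by
          gcongr
          exact (h.eighth_moment_le x).trans (le_abs_self C)
      _ = 64 * (|C| + 1) * (A x x ^ 2) ^ 2 + 512 * (3 + Δ) ^ 2 * S ^ 2 := by ring
      _ ≤ 64 * (|C| + 1) * (A x x ^ 2 + S) ^ 2 + 512 * (3 + Δ) ^ 2 * (A x x ^ 2 + S) ^ 2 := by
          gcongr
          · exact le_add_of_nonneg_right hS0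
          · exact le_add_of_nonneg_left (sq_nonneg _)
      _ = _ := by ring
  rw [← hS]
  -- The factor `16` in the constant absorbs the `4` of the increment inequality.
  have h16 : √(quadraticMomentConst Δ C) = 4 * √(64 * (|C| + 1) + 512 * (3 + Δ) ^ 2) := by
    rw [quadraticMomentConst, Real.sqrt_mul (by norm_num), show (16 : ℝ) = 4 ^ 2 by norm_num,
      Real.sqrt_sq (by norm_num)]
  rw [h16, mul_assoc]
  refine mul_le_mul_of_nonneg_left ?_ (by norm_num)
  refine (Real.sqrt_le_sqrt hg).trans ?_
  rw [Real.sqrt_mul (by positivity), Real.sqrt_sq (by positivity)]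

/-- Same induction as for linear forms, applied to the martingale-type increments. The constant
depends only on `Δ` and `C`, not on the number of variables; this is the source of the
dimension-free estimates. -/
theorem sqrt_integral_quadratic_pow_four_le (A : ι → ι → ℝ) (s : Finset ι) :
    √(∫ ω, (∑ x ∈ s, ∑ y ∈ s, A x y * centeredProduct ζ x y ω) ^ 4 ∂P) ≤
      √(quadraticMomentConst Δ C) * ∑ x ∈ s, ∑ y ∈ s, A x y ^ 2 := by
  induction s using Finset.induction_on with
  | empty => simp
  | insert x s hx ih =>
    have hQs := sum_centeredProduct_mem_monomialSpan (ζ := ζ) (s := s) A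
    have hLs := sum_mem_monomialSpan (ζ := ζ) (s := s) fun y => A x y + A y x
    set Q : Ω → ℝ := fun ω => ∑ x ∈ s, ∑ y ∈ s, A x y * centeredProduct ζ x y ω with hQ
    set L : Ω → ℝ := fun ω => ∑ y ∈ s, (A x y + A y x) * ζ y ω with hL
    have hQu : Q ∈ monomialSpan ζ Finset.univ 2 :=
      monomialSpan_mono (Finset.subset_univ s) le_rfl hQs
    have hLu : L ∈ monomialSpan ζ Finset.univ 1 :=
      monomialSpan_mono (Finset.subset_univ s) le_rfl hLs
    have hx' : ζ x ∈ monomialSpan ζ Finset.univ 1 :=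
      coord_mem_monomialSpan (Finset.mem_univ x) le_rfl
    have hg1 := mul_mem_monomialSpan hLu hx'
    have hg2 := pow_mem_monomialSpan hx' 2
    norm_num only at hg1 hg2
    have hg : (fun ω => A x x * (ζ x ω ^ 2 - 1) + L ω * ζ x ω) ∈ monomialSpan ζ Finset.univ 2 :=
      Submodule.add_mem _ (Submodule.smul_mem _ (A x x)
        (Submodule.sub_mem _ hg2 (const_mem_monomialSpan 1))) hg1
    set g : Ω → ℝ := fun ω => A x x * (ζ x ω ^ 2 - 1) + L ω * ζ x ω with hgdef
    -- `Q³ g` has degree `8`, exactly the order up to which moments factorize.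
    have h0 : ∫ ω, Q ω ^ 3 * g ω ∂P = 0 := by
      have h2 := h.integral_mul_pow (pow_mem_monomialSpan hQs 3) hx (j := 2) (by norm_num)
      have h1 := h.integral_mul_pow (mul_mem_monomialSpan (pow_mem_monomialSpan hQs 3) hLs) hx
        (j := 1) (by norm_num)
      simp only [h.second_moment, mul_one, Pi.pow_apply] at h2
      simp only [pow_one, h.mean_zero, mul_zero, Pi.mul_apply, Pi.pow_apply] at h1
      have i2 : Integrable (fun ω => Q ω ^ 3 * ζ x ω ^ 2) P :=
        h.integrable_of_mem (mul_mem_monomialSpan (pow_mem_monomialSpan hQu 3)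
          (pow_mem_monomialSpan hx' 2)) (by norm_num)
      have i0 : Integrable (fun ω => Q ω ^ 3) P :=
        h.integrable_of_mem (pow_mem_monomialSpan hQu 3) (by norm_num)
      have i1 : Integrable (fun ω => Q ω ^ 3 * L ω * ζ x ω) P :=
        h.integrable_of_mem (mul_mem_monomialSpan (mul_mem_monomialSpan
          (pow_mem_monomialSpan hQu 3) hLu) hx') (by norm_num)
      have e : ∀ ω, Q ω ^ 3 * g ω =
          A x x * (Q ω ^ 3 * ζ x ω ^ 2 - Q ω ^ 3) + Q ω ^ 3 * L ω * ζ x ω := fun ω => by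
        rw [hgdef]; ring
      simp only [e]
      rw [integral_add ((i2.sub' i0).const_mul _) i1, integral_const_mul, integral_sub i2 i0,
        h2, h1]
      ring
    have i40 : Integrable (fun ω => Q ω ^ 4) P :=
      h.integrable_of_mem (pow_mem_monomialSpan hQu 4) (by norm_num)
    have i31 : Integrable (fun ω => Q ω ^ 3 * g ω) P :=
      h.integrable_of_mem (mul_mem_monomialSpan (pow_mem_monomialSpan hQu 3) hg) (by norm_num)
    have i22 : Integrable (fun ω => Q ω ^ 2 * g ω ^ 2) P :=
      h.integrable_of_mem (mul_mem_monomialSpan (pow_mem_monomialSpan hQu 2)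
        (pow_mem_monomialSpan hg 2)) (by norm_num)
    have i13 : Integrable (fun ω => Q ω * g ω ^ 3) P :=
      h.integrable_of_mem (mul_mem_monomialSpan hQu (pow_mem_monomialSpan hg 3)) (by norm_num)
    have i04 : Integrable (fun ω => g ω ^ 4) P :=
      h.integrable_of_mem (pow_mem_monomialSpan hg 4) (by norm_num)
    have key := sqrt_integral_add_pow_four_le i40 i31 i22 i13 i04 h0
    have e : ∀ ω, ∑ a ∈ insert x s, ∑ b ∈ insert x s, A a b * centeredProduct ζ a b ω =
        Q ω + g ω := sum_insert_centeredProduct hx A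
    simp only [e]
    refine key.trans ?_
    rw [sum_insert_insert hx, mul_add]
    exact add_le_add ih (h.sqrt_integral_increment_pow_four_le A hx)

theorem integral_quadratic (A : ι → ι → ℝ) (s : Finset ι) :
    ∫ ω, ∑ x ∈ s, ∑ y ∈ s, A x y * centeredProduct ζ x y ω ∂P = 0 := by
  induction s using Finset.induction_on with
  | empty => simp
  | insert x s hx ih =>
    have hQs := sum_centeredProduct_mem_monomialSpan (ζ := ζ) (s := s) A
    have hLs := sum_mem_monomialSpan (ζ := ζ) (s := s) fun y => A x y + A y x
    simp only [sum_insert_centeredProduct hx A]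
    set L : Ω → ℝ := fun ω => ∑ y ∈ s, (A x y + A y x) * ζ y ω with hL
    have hLu : L ∈ monomialSpan ζ Finset.univ 1 :=
      monomialSpan_mono (Finset.subset_univ s) le_rfl hLs
    have hx' : ζ x ∈ monomialSpan ζ Finset.univ 1 :=
      coord_mem_monomialSpan (Finset.mem_univ x) le_rfl
    have h1 := h.integral_mul_pow hLs hx (j := 1) (by norm_num)
    simp only [pow_one, h.mean_zero, mul_zero] at h1
    have i2 : Integrable (fun ω => ζ x ω ^ 2) P :=
      h.integrable_of_mem (pow_mem_monomialSpan hx' 2) (by norm_num)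
    have i1 : Integrable (fun ω => L ω * ζ x ω) P :=
      h.integrable_of_mem (mul_mem_monomialSpan hLu hx') (by norm_num)
    rw [integral_add (h.integrable_of_mem hQs (by norm_num))
      (((i2.sub' (integrable_const _)).const_mul _).fun_add i1), ih,
      integral_add ((i2.sub' (integrable_const _)).const_mul _) i1, integral_const_mul,
      integral_sub i2 (integrable_const _), h1, h.second_moment]
    simp

/-- The exact second moment, needed for lower bounds. The diagonal contributes `3 + Δ - 1 = 2 + Δ`
per square: `2` from the double sum and the rest from the last term. -/
theorem integral_quadratic_sq (A : ι → ι → ℝ) (s : Finset ι) :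
    ∫ ω, (∑ x ∈ s, ∑ y ∈ s, A x y * centeredProduct ζ x y ω) ^ 2 ∂P =
      ∑ x ∈ s, ∑ y ∈ s, (A x y ^ 2 + A x y * A y x) + Δ * ∑ x ∈ s, A x x ^ 2 := by
  induction s using Finset.induction_on with
  | empty => simp
  | insert x s hx ih =>
    have hQs := sum_centeredProduct_mem_monomialSpan (ζ := ζ) (s := s) A
    have hLs := sum_mem_monomialSpan (ζ := ζ) (s := s) fun y => A x y + A y x
    have hL2 := h.integral_linear_sq (fun y => A x y + A y x) s
    have hL1 := h.integral_linear (fun y => A x y + A y x) s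
    set Q : Ω → ℝ := fun ω => ∑ x ∈ s, ∑ y ∈ s, A x y * centeredProduct ζ x y ω with hQ
    set L : Ω → ℝ := fun ω => ∑ y ∈ s, (A x y + A y x) * ζ y ω with hL
    have hQu : Q ∈ monomialSpan ζ Finset.univ 2 :=
      monomialSpan_mono (Finset.subset_univ s) le_rfl hQs
    have hLu : L ∈ monomialSpan ζ Finset.univ 1 :=
      monomialSpan_mono (Finset.subset_univ s) le_rfl hLs
    have hx' : ζ x ∈ monomialSpan ζ Finset.univ 1 :=
      coord_mem_monomialSpan (Finset.mem_univ x) le_rfl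
    have iQQ : Integrable (fun ω => Q ω ^ 2) P :=
      h.integrable_of_mem (pow_mem_monomialSpan hQu 2) (by norm_num)
    have iQ : Integrable Q P := h.integrable_of_mem hQu (by norm_num)
    have iQx : Integrable (fun ω => Q ω * ζ x ω ^ 2) P :=
      h.integrable_of_mem (mul_mem_monomialSpan hQu (pow_mem_monomialSpan hx' 2)) (by norm_num)
    have iQL : Integrable (fun ω => Q ω * L ω * ζ x ω) P :=
      h.integrable_of_mem (mul_mem_monomialSpan (mul_mem_monomialSpan hQu hLu) hx') (by norm_num)
    have i4 : Integrable (fun ω => ζ x ω ^ 4) P :=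
      h.integrable_of_mem (pow_mem_monomialSpan hx' 4) (by norm_num)
    have i2 : Integrable (fun ω => ζ x ω ^ 2) P :=
      h.integrable_of_mem (pow_mem_monomialSpan hx' 2) (by norm_num)
    have iL3 : Integrable (fun ω => L ω * ζ x ω ^ 3) P :=
      h.integrable_of_mem (mul_mem_monomialSpan hLu (pow_mem_monomialSpan hx' 3)) (by norm_num)
    have iL1 : Integrable (fun ω => L ω * ζ x ω ^ 1) P :=
      h.integrable_of_mem (mul_mem_monomialSpan hLu (pow_mem_monomialSpan hx' 1)) (by norm_num)
    have iL2 : Integrable (fun ω => L ω ^ 2 * ζ x ω ^ 2) P :=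
      h.integrable_of_mem (mul_mem_monomialSpan (pow_mem_monomialSpan hLu 2)
        (pow_mem_monomialSpan hx' 2)) (by norm_num)
    have vQx : ∫ ω, Q ω * ζ x ω ^ 2 ∂P = ∫ ω, Q ω ∂P := by
      rw [h.integral_mul_pow hQs hx (by norm_num), h.second_moment, mul_one]
    have vQL : ∫ ω, Q ω * L ω * ζ x ω ∂P = 0 := by
      have := h.integral_mul_pow (mul_mem_monomialSpan hQs hLs) hx (j := 1) (by norm_num)
      simpa only [pow_one, h.mean_zero, mul_zero, Pi.mul_apply] using this
    have vL3 : ∫ ω, L ω * ζ x ω ^ 3 ∂P = 0 := by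
      rw [h.integral_mul_pow hLs hx (by norm_num), hL1, zero_mul]
    have vL1 : ∫ ω, L ω * ζ x ω ^ 1 ∂P = 0 := by
      rw [h.integral_mul_pow hLs hx (by norm_num), hL1, zero_mul]
    have vL2 : ∫ ω, L ω ^ 2 * ζ x ω ^ 2 ∂P = ∑ y ∈ s, (A x y + A y x) ^ 2 := by
      have := h.integral_mul_pow (pow_mem_monomialSpan hLs 2) hx (j := 2) (by norm_num)
      rw [h.second_moment, mul_one] at this
      exact this.trans hL2
    have e : ∀ ω, (Q ω + (A x x * (ζ x ω ^ 2 - 1) + L ω * ζ x ω)) ^ 2 =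
        Q ω ^ 2 + (2 * A x x) * (Q ω * ζ x ω ^ 2 - Q ω) + 2 * (Q ω * L ω * ζ x ω) +
        A x x ^ 2 * (ζ x ω ^ 4 - 2 * ζ x ω ^ 2 + 1) +
        (2 * A x x) * (L ω * ζ x ω ^ 3 - L ω * ζ x ω ^ 1) + L ω ^ 2 * ζ x ω ^ 2 := fun ω => by ring
    have e' : ∀ ω, ∑ a ∈ insert x s, ∑ b ∈ insert x s, A a b * centeredProduct ζ a b ω =
        Q ω + (A x x * (ζ x ω ^ 2 - 1) + L ω * ζ x ω) := sum_insert_centeredProduct hx A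
    simp only [e', e]
    have j1 := (iQx.sub' iQ).const_mul (2 * A x x)
    have j2 := iQL.const_mul 2
    have j3 := ((i4.sub' (i2.const_mul 2)).fun_add (integrable_const (1 : ℝ))).const_mul
      (A x x ^ 2)
    have j4 := (iL3.sub' iL1).const_mul (2 * A x x)
    rw [integral_add ((((iQQ.fun_add j1).fun_add j2).fun_add j3).fun_add j4) iL2,
      integral_add (((iQQ.fun_add j1).fun_add j2).fun_add j3) j4,
      integral_add ((iQQ.fun_add j1).fun_add j2) j3,
      integral_add (iQQ.fun_add j1) j2, integral_add iQQ j1]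
    simp only [integral_const_mul]
    rw [integral_sub iQx iQ, integral_sub iL3 iL1,
      integral_add (i4.sub' (i2.const_mul 2)) (integrable_const (1 : ℝ)),
      integral_sub i4 (i2.const_mul 2), integral_const_mul, vQx, vQL, vL3, vL1, vL2, ih,
      h.fourth_moment, h.second_moment, sum_insert_insert hx, Finset.sum_insert hx]
    have e2 : ∑ y ∈ s, (A x y + A y x) ^ 2 =
        ∑ y ∈ s, (A x y ^ 2 + A x y * A y x + (A y x ^ 2 + A y x * A x y)) :=
      Finset.sum_congr rfl fun y _ => by ring
    rw [e2]
    simp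
    ring

end HasFactorizedMoments

end QuadraticForms

/-! ### Forms that are quadratic in each of two independent vectors. -/

section BilinearForms

variable {Ω : Type*} [MeasurableSpace Ω] {P : Measure Ω}

theorem memLp_four_of_integrable_pow {f : Ω → ℝ} (hf : AEStronglyMeasurable f P)
    (h : Integrable (fun ω => f ω ^ 4) P) : MemLp f 4 P := by
  rw [← integrable_norm_rpow_iff hf (by norm_num) (by norm_num)]
  refine h.congr (Eventually.of_forall fun ω => ?_)
  have : (4 : ℝ≥0∞).toReal = ((4 : ℕ) : ℝ) := by norm_num
  simp only [this, Real.rpow_natCast, Real.norm_eq_abs]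
  exact (Even.pow_abs (by decide) _).symm

theorem MeasureTheory.MemLp.integrable_pow_four {f : Ω → ℝ} (h : MemLp f 4 P) :
    Integrable (fun ω => f ω ^ 4) P := by
  refine (h.integrable_norm_pow (p := 4) (by norm_num)).congr (Eventually.of_forall fun ω => ?_)
  simp only [Real.norm_eq_abs]
  exact Even.pow_abs (by decide) _

variable [IsProbabilityMeasure P]

theorem MeasureTheory.MemLp.integral_sq_le_sqrt {f : Ω → ℝ} (h : MemLp f 4 P) :
    ∫ ω, f ω ^ 2 ∂P ≤ √(∫ ω, f ω ^ 4 ∂P) := by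
  have h2 : Integrable (fun ω => f ω ^ 2) P :=
    (h.mono_exponent (by norm_num : (2 : ℝ≥0∞) ≤ 4)).integrable_sq
  have := integral_mul_le_sqrt_mul_sqrt (f := fun ω => f ω ^ 2) (g := fun _ => (1 : ℝ)) (P := P)
    (by simpa only [← pow_mul] using h.integrable_pow_four) (integrable_const _)
    (by simpa using h2)
  simpa [← pow_mul] using this

/-- Fubini for the product law of `(U, V)`, pulled back to two copies of `Ω`, so that one argument
can be frozen. -/
theorem ProbabilityTheory.IndepFun.integral_comp_eq_integral_integral {α β : Type*}
    [MeasurableSpace α] [MeasurableSpace β] {U : Ω → α} {V : Ω → β} (hUV : IndepFun U V P)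
    (hU : Measurable U) (hV : Measurable V) {F : α × β → ℝ} (hF : Measurable F)
    (hi : Integrable (fun ω => F (U ω, V ω)) P) :
    ∫ ω, F (U ω, V ω) ∂P = ∫ ω', ∫ ω, F (U ω, V ω') ∂P ∂P ∧
      Integrable (fun ω' => ∫ ω, F (U ω, V ω') ∂P) P := by
  have hm : P.map (fun ω => (U ω, V ω)) = (P.map U).prod (P.map V) :=
    (indepFun_iff_map_prod_eq_prod_map_map hU.aemeasurable hV.aemeasurable).mp hUV
  have : IsProbabilityMeasure (P.map U) := Measure.isProbabilityMeasure_map hU.aemeasurable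
  have : IsProbabilityMeasure (P.map V) := Measure.isProbabilityMeasure_map hV.aemeasurable
  have hi' : Integrable F ((P.map U).prod (P.map V)) := by
    rw [← hm]
    exact (integrable_map_measure hF.aestronglyMeasurable
      (hU.prodMk hV).aemeasurable).mpr hi
  have hinner : ∀ v, ∫ u, F (u, v) ∂(P.map U) = ∫ ω, F (U ω, v) ∂P := fun v =>
    integral_map hU.aemeasurable (hF.comp measurable_prodMk_right).aestronglyMeasurable
  constructor
  · rw [← integral_map (φ := fun ω => (U ω, V ω)) (hU.prodMk hV).aemeasurable
      hF.aestronglyMeasurable, hm, integral_prod_symm _ hi']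
    simp only [hinner]
    rw [integral_map hV.aemeasurable]
    have := hi'.integral_prod_right.aestronglyMeasurable
    simpa only [hinner] using this
  · have := hi'.integral_prod_right
    simp only [hinner] at this
    exact (integrable_map_measure this.aestronglyMeasurable hV.aemeasurable).mp this

theorem quadraticMomentConst_nonneg (Δ C : ℝ) : 0 ≤ quadraticMomentConst Δ C := by
  unfold quadraticMomentConst; positivity

variable {ι : Type*} [Fintype ι] [DecidableEq ι] {ζ ζ' : ι → Ω → ℝ} {Δ C : ℝ}

/-- The second moment of a centered quadratic form with coefficients `A`. -/
def secondMomentForm (Δ : ℝ) (A : ι × ι → ℝ) : ℝ :=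
  ∑ α : ι × ι, (A α ^ 2 + A α * A α.swap) + Δ * ∑ x, A (x, x) ^ 2

/-- A centered quadratic form. -/
def quadForm (ζ : ι → Ω → ℝ) (A : ι × ι → ℝ) (ω : Ω) : ℝ :=
  ∑ α : ι × ι, A α * centeredProduct ζ α.1 α.2 ω

/-- A form that is quadratic in both `ζ` and `ζ'`. -/
def biquadForm (ζ ζ' : ι → Ω → ℝ) (A : ι × ι → ι × ι → ℝ) (ω : Ω) : ℝ :=
  ∑ α : ι × ι, quadForm ζ' (A α) ω * centeredProduct ζ α.1 α.2 ω

theorem quadForm_eq (A : ι × ι → ℝ) (ω : Ω) :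
    quadForm ζ A ω = ∑ x, ∑ y, A (x, y) * centeredProduct ζ x y ω := by
  rw [quadForm, Fintype.sum_prod_type]

theorem quadForm_mem_monomialSpan (A : ι × ι → ℝ) :
    quadForm ζ A ∈ monomialSpan ζ Finset.univ 2 := by
  have : quadForm ζ A = fun ω => ∑ x, ∑ y, A (x, y) * centeredProduct ζ x y ω :=
    funext fun ω => quadForm_eq A ω
  rw [this]
  exact sum_centeredProduct_mem_monomialSpan fun x y => A (x, y)

namespace HasFactorizedMoments

section Single

variable (h : HasFactorizedMoments P ζ Δ C)
include h

theorem measurable_quadForm (A : ι × ι → ℝ) : Measurable (quadForm ζ A) :=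
  measurable_of_mem_monomialSpan h.measurable (quadForm_mem_monomialSpan A)

theorem memLp_quadForm (A : ι × ι → ℝ) : MemLp (quadForm ζ A) 4 P :=
  memLp_four_of_integrable_pow (h.measurable_quadForm A).aestronglyMeasurable
    (h.integrable_of_mem (pow_mem_monomialSpan (quadForm_mem_monomialSpan A) 4) (by norm_num))

theorem integrable_quadForm_sq (A : ι × ι → ℝ) : Integrable (fun ω => quadForm ζ A ω ^ 2) P :=
  ((h.memLp_quadForm A).mono_exponent (by norm_num : (2 : ℝ≥0∞) ≤ 4)).integrable_sq

theorem integral_quadForm (A : ι × ι → ℝ) : ∫ ω, quadForm ζ A ω ∂P = 0 := by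
  simp only [quadForm_eq]
  exact h.integral_quadratic (fun x y => A (x, y)) Finset.univ

theorem sqrt_integral_quadForm_pow_four_le (A : ι × ι → ℝ) :
    √(∫ ω, quadForm ζ A ω ^ 4 ∂P) ≤ √(quadraticMomentConst Δ C) * ∑ α, A α ^ 2 := by
  simp only [quadForm_eq, Fintype.sum_prod_type]
  exact h.sqrt_integral_quadratic_pow_four_le (fun x y => A (x, y)) Finset.univ

theorem integral_quadForm_pow_four_le (A : ι × ι → ℝ) :
    ∫ ω, quadForm ζ A ω ^ 4 ∂P ≤ quadraticMomentConst Δ C * (∑ α, A α ^ 2) ^ 2 := by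
  have hS : 0 ≤ ∑ α, A α ^ 2 := Finset.sum_nonneg fun _ _ => sq_nonneg _
  have := (Real.sqrt_le_left (by positivity)).mp (h.sqrt_integral_quadForm_pow_four_le A)
  rwa [mul_pow, Real.sq_sqrt (quadraticMomentConst_nonneg Δ C)] at this

theorem integral_quadForm_sq_le (A : ι × ι → ℝ) :
    ∫ ω, quadForm ζ A ω ^ 2 ∂P ≤ √(quadraticMomentConst Δ C) * ∑ α, A α ^ 2 :=
  (h.memLp_quadForm A).integral_sq_le_sqrt.trans (h.sqrt_integral_quadForm_pow_four_le A)

theorem integral_quadForm_sq (A : ι × ι → ℝ) :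
    ∫ ω, quadForm ζ A ω ^ 2 ∂P = secondMomentForm Δ A := by
  simp only [quadForm_eq, secondMomentForm, Fintype.sum_prod_type, Prod.swap_prod_mk]
  exact h.integral_quadratic_sq (fun x y => A (x, y)) Finset.univ

end Single

variable (h : HasFactorizedMoments P ζ Δ C) (h' : HasFactorizedMoments P ζ' Δ C)
  (hind : IndepFun (fun ω x => ζ x ω) (fun ω x => ζ' x ω) P)

omit [IsProbabilityMeasure P] in
include hind in
theorem indepFun_quadForm (A B : ι × ι → ℝ) : IndepFun (quadForm ζ A) (quadForm ζ' B) P :=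
  hind.comp (φ := fun u : ι → ℝ => ∑ α : ι × ι, A α * (u α.1 * u α.2 - if α.1 = α.2 then 1 else 0))
    (ψ := fun u : ι → ℝ => ∑ α : ι × ι, B α * (u α.1 * u α.2 - if α.1 = α.2 then 1 else 0))
    (by fun_prop) (by fun_prop)

theorem centeredProduct_eq_quadForm (α : ι × ι) :
    centeredProduct ζ α.1 α.2 = quadForm ζ (Pi.single α 1) := by
  ext ω
  rw [quadForm, Finset.sum_eq_single α]
  · simp
  · intro β _ hβ; simp [Pi.single_eq_of_ne hβ]
  · simp

include h h' in
theorem measurable_biquadForm (A : ι × ι → ι × ι → ℝ) : Measurable (biquadForm ζ ζ' A) := by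
  refine Finset.measurable_fun_sum _ fun α _ => (h'.measurable_quadForm (A α)).mul ?_
  rw [centeredProduct_eq_quadForm]
  exact h.measurable_quadForm _

include h h' hind

theorem memLp_quadForm_mul (A B : ι × ι → ℝ) :
    MemLp (fun ω => quadForm ζ' A ω * quadForm ζ B ω) 4 P := by
  refine memLp_four_of_integrable_pow
    ((h'.measurable_quadForm A).mul (h.measurable_quadForm B)).aestronglyMeasurable ?_
  have hi := (indepFun_quadForm hind B A).symm.comp
    (measurable_id.pow_const 4) (measurable_id.pow_const 4)
  have := hi.integrable_mul (h'.memLp_quadForm A).integrable_pow_four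
    (h.memLp_quadForm B).integrable_pow_four
  refine this.congr (Eventually.of_forall fun ω => ?_)
  simp [mul_pow]

theorem memLp_biquadForm (A : ι × ι → ι × ι → ℝ) : MemLp (biquadForm ζ ζ' A) 4 P := by
  unfold biquadForm
  refine memLp_finsetSum _ fun α _ => ?_
  rw [centeredProduct_eq_quadForm]
  exact memLp_quadForm_mul h h' hind _ _

theorem integral_biquadForm (A : ι × ι → ι × ι → ℝ) : ∫ ω, biquadForm ζ ζ' A ω ∂P = 0 := by
  unfold biquadForm
  rw [integral_finsetSum]
  · refine Finset.sum_eq_zero fun α _ => ?_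
    rw [centeredProduct_eq_quadForm, (indepFun_quadForm hind _ _).symm.integral_fun_mul_eq_mul_integral
      (h'.measurable_quadForm _).aestronglyMeasurable (h.measurable_quadForm _).aestronglyMeasurable,
      h.integral_quadForm, mul_zero]
  · intro α _
    rw [centeredProduct_eq_quadForm]
    exact (memLp_quadForm_mul h h' hind _ _).integrable (by norm_num)

/-- With `ζ'` frozen, a biquadratic form is a quadratic form in `ζ` whose coefficients are quadratic
forms in `ζ'`; the results for one vector can then be used twice. -/
theorem integral_biquadForm_pow (A : ι × ι → ι × ι → ℝ) (k : ℕ) (hk : k ≤ 4) :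
    ∫ ω, biquadForm ζ ζ' A ω ^ k ∂P =
      ∫ ω', ∫ ω, quadForm ζ (fun α => quadForm ζ' (A α) ω') ω ^ k ∂P ∂P ∧
    Integrable (fun ω' => ∫ ω, quadForm ζ (fun α => quadForm ζ' (A α) ω') ω ^ k ∂P) P := by
  have hU : Measurable (fun ω x => ζ x ω) := measurable_pi_lambda _ h.measurable
  have hV : Measurable (fun ω x => ζ' x ω) := measurable_pi_lambda _ h'.measurable
  refine hind.integral_comp_eq_integral_integral hU hV
    (F := fun z => (∑ α : ι × ι, (∑ β : ι × ι, A α β *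
      (z.2 β.1 * z.2 β.2 - if β.1 = β.2 then 1 else 0)) *
      (z.1 α.1 * z.1 α.2 - if α.1 = α.2 then 1 else 0)) ^ k) (by fun_prop) ?_
  have h4 := memLp_biquadForm h h' hind A
  have hmono : MemLp (biquadForm ζ ζ' A) k P := h4.mono_exponent (by exact_mod_cast hk)
  have hn := hmono.integrable_norm_pow'
  refine hn.mono' ?_ (Eventually.of_forall fun ω => ?_)
  · exact ((measurable_biquadForm h h' A).pow_const k).aestronglyMeasurable
  · exact (norm_pow _ _).le

/-- The inner integral costs one factor `K` and leaves the square of a sum of squared quadratic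
forms in `ζ'`. Expanding that square and using Cauchy–Schwarz for each product costs another `√K ·
√K`. -/
theorem integral_biquadForm_pow_four_le (A : ι × ι → ι × ι → ℝ) :
    ∫ ω, biquadForm ζ ζ' A ω ^ 4 ∂P ≤
      (quadraticMomentConst Δ C * ∑ α, ∑ β, A α β ^ 2) ^ 2 := by
  obtain ⟨e, hi⟩ := integral_biquadForm_pow h h' hind A 4 le_rfl
  set K := quadraticMomentConst Δ C with hK
  have hK0 : 0 ≤ K := quadraticMomentConst_nonneg Δ C
  have hint : ∀ α β, Integrable (fun ω => quadForm ζ' (A α) ω ^ 2 * quadForm ζ' (A β) ω ^ 2) P := by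
    intro α β
    exact h'.integrable_of_mem (mul_mem_monomialSpan
      (pow_mem_monomialSpan (quadForm_mem_monomialSpan (A α)) 2)
      (pow_mem_monomialSpan (quadForm_mem_monomialSpan (A β)) 2)) (by norm_num)
  have hexp : ∀ ω, (∑ α, quadForm ζ' (A α) ω ^ 2) ^ 2 =
      ∑ α, ∑ β, quadForm ζ' (A α) ω ^ 2 * quadForm ζ' (A β) ω ^ 2 := fun ω => by
    rw [sq, Finset.sum_mul_sum]
  have hsumint : Integrable (fun ω => (∑ α, quadForm ζ' (A α) ω ^ 2) ^ 2) P := by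
    simp only [hexp]
    exact integrable_finsetSum _ fun α _ => integrable_finsetSum _ fun β _ => hint α β
  rw [e]
  calc ∫ ω', ∫ ω, quadForm ζ (fun α => quadForm ζ' (A α) ω') ω ^ 4 ∂P ∂P
      ≤ ∫ ω', K * (∑ α, quadForm ζ' (A α) ω' ^ 2) ^ 2 ∂P :=
        integral_mono hi (hsumint.const_mul K) fun ω' => h.integral_quadForm_pow_four_le _
    _ = K * ∑ α, ∑ β, ∫ ω, quadForm ζ' (A α) ω ^ 2 * quadForm ζ' (A β) ω ^ 2 ∂P := by
        rw [integral_const_mul]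
        simp only [hexp]
        rw [integral_finsetSum _ fun α _ => integrable_finsetSum _ fun β _ => hint α β]
        congr 1
        exact Finset.sum_congr rfl fun α _ => integral_finsetSum _ fun β _ => hint α β
    _ ≤ K * ∑ α, ∑ β, (√K * ∑ γ, A α γ ^ 2) * (√K * ∑ γ, A β γ ^ 2) := by
        refine mul_le_mul_of_nonneg_left ?_ hK0
        refine Finset.sum_le_sum fun α _ => Finset.sum_le_sum fun β _ => ?_
        have h4 : ∀ α, Integrable (fun ω => (quadForm ζ' (A α) ω ^ 2) ^ 2) P := fun α => by
          simpa only [← pow_mul] using (h'.memLp_quadForm (A α)).integrable_pow_four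
        refine (integral_mul_le_sqrt_mul_sqrt (h4 α) (h4 β) (hint α β)).trans ?_
        simp only [← pow_mul]
        exact mul_le_mul (h'.sqrt_integral_quadForm_pow_four_le _)
          (h'.sqrt_integral_quadForm_pow_four_le _) (Real.sqrt_nonneg _)
          (mul_nonneg (Real.sqrt_nonneg _) (Finset.sum_nonneg fun _ _ => sq_nonneg _))
    _ = K * (√K) ^ 2 * (∑ α, ∑ β, A α β ^ 2) ^ 2 := by
        rw [← Finset.sum_mul_sum, ← Finset.mul_sum]; ring
    _ = _ := by rw [Real.sq_sqrt hK0]; ring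

theorem integral_biquadForm_sq_le (A : ι × ι → ι × ι → ℝ) :
    ∫ ω, biquadForm ζ ζ' A ω ^ 2 ∂P ≤ quadraticMomentConst Δ C * ∑ α, ∑ β, A α β ^ 2 := by
  have hS : 0 ≤ ∑ α, ∑ β, A α β ^ 2 :=
    Finset.sum_nonneg fun _ _ => Finset.sum_nonneg fun _ _ => sq_nonneg _
  refine (memLp_biquadForm h h' hind A).integral_sq_le_sqrt.trans ?_
  exact Real.sqrt_le_iff.mpr ⟨mul_nonneg (quadraticMomentConst_nonneg Δ C) hS,
    integral_biquadForm_pow_four_le h h' hind A⟩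

/-- The symmetry `hA` identifies the swapped coefficients, so the inner second moment is a
combination of squares, whose expectations are again exact second moments. -/
theorem integral_biquadForm_sq (A : ι × ι → ι × ι → ℝ)
    (hA : ∀ α ω, quadForm ζ' (A α.swap) ω = quadForm ζ' (A α) ω) :
    ∫ ω, biquadForm ζ ζ' A ω ^ 2 ∂P =
      2 * ∑ α, secondMomentForm Δ (A α) + Δ * ∑ x, secondMomentForm Δ (A (x, x)) := by
  rw [(integral_biquadForm_pow h h' hind A 2 (by norm_num)).1]
  simp only [h.integral_quadForm_sq]
  have e : ∀ ω, secondMomentForm Δ (fun α => quadForm ζ' (A α) ω) =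
      2 * ∑ α, quadForm ζ' (A α) ω ^ 2 + Δ * ∑ x, quadForm ζ' (A (x, x)) ω ^ 2 := fun ω => by
    simp only [secondMomentForm, hA, ← sq, ← two_mul, ← Finset.mul_sum]
  simp only [e]
  have hi := fun B => h'.integrable_quadForm_sq B
  rw [integral_add ((integrable_finsetSum _ fun α _ => hi (A α)).const_mul _)
    ((integrable_finsetSum _ fun x _ => hi (A (x, x))).const_mul _), integral_const_mul,
    integral_const_mul, integral_finsetSum _ fun α _ => hi (A α),
    integral_finsetSum _ fun x _ => hi (A (x, x))]
  simp only [h'.integral_quadForm_sq]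

/-- The reason that the two estimating functions are uncorrelated: each summand is a product of
independent factors, one of them a centered quadratic form in the vector that `B` does not involve.
-/
theorem integral_biquadForm_mul_quadForm (A : ι × ι → ι × ι → ℝ) (B : ι × ι → ℝ) :
    ∫ ω, biquadForm ζ ζ' A ω * quadForm ζ B ω ∂P = 0 ∧
      ∫ ω, biquadForm ζ ζ' A ω * quadForm ζ' B ω ∂P = 0 := by
  have m2 : ∀ (η : ι → Ω → ℝ) (hη : HasFactorizedMoments P η Δ C) (D E : ι × ι → ℝ),
      Measurable (fun ω => quadForm η D ω * quadForm η E ω) := fun η hη D E =>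
    (hη.measurable_quadForm D).mul (hη.measurable_quadForm E)
  have hL2 : ∀ D E, MemLp (fun ω => quadForm ζ' D ω * quadForm ζ E ω) 2 P := fun D E =>
    (memLp_quadForm_mul h h' hind D E).mono_exponent (by norm_num)
  have hq : ∀ (η : ι → Ω → ℝ) (hη : HasFactorizedMoments P η Δ C) (D : ι × ι → ℝ),
      MemLp (quadForm η D) 2 P := fun η hη D => (hη.memLp_quadForm D).mono_exponent (by norm_num)
  let q : (ι × ι → ℝ) → (ι → ℝ) → ℝ := fun A u =>
    ∑ α : ι × ι, A α * (u α.1 * u α.2 - if α.1 = α.2 then 1 else 0)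
  have hqm : ∀ A, Measurable (q A) := fun A => by fun_prop
  constructor
  · simp only [biquadForm, Finset.sum_mul]
    rw [integral_finsetSum]
    · refine Finset.sum_eq_zero fun α _ => ?_
      rw [centeredProduct_eq_quadForm]
      simp only [mul_assoc]
      have hi : IndepFun (quadForm ζ' (A α))
          (fun ω => quadForm ζ (Pi.single α 1) ω * quadForm ζ B ω) P :=
        hind.symm.comp (φ := q (A α)) (ψ := fun u => q (Pi.single α 1) u * q B u)
          (hqm _) ((hqm _).mul (hqm _))
      rw [hi.integral_fun_mul_eq_mul_integral
        (h'.measurable_quadForm _).aestronglyMeasurable (m2 ζ h _ _).aestronglyMeasurable,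
        h'.integral_quadForm, zero_mul]
    · intro α _
      rw [centeredProduct_eq_quadForm]
      exact (hL2 _ _).integrable_mul (hq ζ h B)
  · simp only [biquadForm, Finset.sum_mul]
    rw [integral_finsetSum]
    · refine Finset.sum_eq_zero fun α _ => ?_
      rw [centeredProduct_eq_quadForm]
      simp only [mul_right_comm]
      have hi : IndepFun (fun ω => quadForm ζ' (A α) ω * quadForm ζ' B ω)
          (quadForm ζ (Pi.single α 1)) P :=
        hind.symm.comp (φ := fun u => q (A α) u * q B u) (ψ := q (Pi.single α 1))
          ((hqm _).mul (hqm _)) (hqm _)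
      rw [hi.integral_fun_mul_eq_mul_integral (m2 ζ' h' _ _).aestronglyMeasurable
        (h.measurable_quadForm _).aestronglyMeasurable, h.integral_quadForm, mul_zero]
    · intro α _
      rw [centeredProduct_eq_quadForm]
      exact (hL2 _ _).integrable_mul (hq ζ' h' B)

end HasFactorizedMoments

end BilinearForms

/-! ### A Lyapunov central limit theorem for triangular arrays of pairs. -/

section CentralLimit

/-- Telescoping: exchange the factors one at a time. -/
theorem norm_prod_sub_prod_le {ι : Type*} (s : Finset ι) (a b : ι → ℂ)
    (ha : ∀ i ∈ s, ‖a i‖ ≤ 1) (hb : ∀ i ∈ s, ‖b i‖ ≤ 1) :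
    ‖∏ i ∈ s, a i - ∏ i ∈ s, b i‖ ≤ ∑ i ∈ s, ‖a i - b i‖ := by
  classical
  induction s using Finset.induction_on with
  | empty => simp
  | insert x s hx ih =>
    rw [Finset.prod_insert hx, Finset.prod_insert hx, Finset.sum_insert hx]
    have e : a x * ∏ i ∈ s, a i - b x * ∏ i ∈ s, b i =
        (a x - b x) * ∏ i ∈ s, a i + b x * (∏ i ∈ s, a i - ∏ i ∈ s, b i) := by ring
    have h1 : ‖∏ i ∈ s, a i‖ ≤ 1 := by
      rw [norm_prod]
      exact Finset.prod_le_one (fun _ _ => norm_nonneg _)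
        fun i hi => ha i (Finset.mem_insert_of_mem hi)
    have h2 := ih (fun i hi => ha i (Finset.mem_insert_of_mem hi))
      fun i hi => hb i (Finset.mem_insert_of_mem hi)
    rw [e]
    refine (norm_add_le _ _).trans ?_
    rw [norm_mul, norm_mul]
    have h3 := hb x (Finset.mem_insert_self _ _)
    calc _ ≤ ‖a x - b x‖ * 1 + 1 * ∑ i ∈ s, ‖a i - b i‖ := by gcongr
      _ = _ := by ring

/-- For `|x| ≤ 1` this is the Taylor bound; for `|x| ≥ 1` every term is crudely bounded by a
multiple of `|x|³`. The constant `4` serves both cases. -/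
theorem norm_exp_mul_I_sub_le (x : ℝ) :
    ‖Complex.exp (x * Complex.I) - (1 + x * Complex.I - x ^ 2 / 2)‖ ≤ 4 * |x| ^ 3 := by
  have hn : ‖(x * Complex.I : ℂ)‖ = |x| := by simp
  rcases le_total |x| 1 with hx | hx
  · have h := Complex.exp_bound (x := x * Complex.I) (by rwa [hn]) (n := 3) (by norm_num)
    rw [hn] at h
    have e : ∑ m ∈ Finset.range 3, (x * Complex.I : ℂ) ^ m / (m.factorial : ℂ) =
        1 + x * Complex.I - x ^ 2 / 2 := by
      simp [Finset.sum_range_succ, mul_pow, Nat.factorial]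
      ring
    rw [e] at h
    refine h.trans ?_
    have := pow_nonneg (abs_nonneg x) 3
    norm_num [Nat.factorial]
    linarith
  · have h1 : ‖Complex.exp (x * Complex.I)‖ = 1 := Complex.norm_exp_ofReal_mul_I x
    have h2 : ‖(x ^ 2 / 2 : ℂ)‖ = |x| ^ 2 / 2 := by simp
    calc _ ≤ ‖Complex.exp (x * Complex.I)‖ + (‖(1 : ℂ)‖ + ‖(x * Complex.I : ℂ)‖ + ‖(x ^ 2 / 2 : ℂ)‖) :=
          (norm_sub_le _ _).trans (add_le_add le_rfl ((norm_sub_le _ _).trans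
            (add_le_add (norm_add_le _ _) le_rfl)))
      _ = 2 + |x| + |x| ^ 2 / 2 := by rw [h1, hn, h2, norm_one]; ring
      _ ≤ 4 * |x| ^ 3 := by
          have h3 : |x| ≤ |x| ^ 3 := le_self_pow₀ hx (by norm_num)
          have h4 : |x| ^ 2 ≤ |x| ^ 3 := pow_le_pow_right₀ hx (by norm_num)
          linarith

theorem norm_integral_exp_sub_le {Ω : Type*} [MeasurableSpace Ω] {P : Measure Ω}
    [IsProbabilityMeasure P] {ξ : Ω → ℝ} (hξ : MemLp ξ 4 P) (h0 : ∫ ω, ξ ω ∂P = 0) {r : ℝ}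
    (hr : 0 ≤ r) :
    ‖∫ ω, Complex.exp ((r * ξ ω : ℝ) * Complex.I) ∂P -
      (1 - (r ^ 2 * ∫ ω, ξ ω ^ 2 ∂P : ℝ) / 2)‖ ≤
      2 * r ^ 3 * (∫ ω, ξ ω ^ 2 ∂P + ∫ ω, ξ ω ^ 4 ∂P) := by
  have i1 : Integrable ξ P := hξ.integrable (by norm_num)
  have i2 : Integrable (fun ω => ξ ω ^ 2) P :=
    (hξ.mono_exponent (by norm_num : (2 : ℝ≥0∞) ≤ 4)).integrable_sq
  have i4 := hξ.integrable_pow_four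
  have ie : Integrable (fun ω => Complex.exp ((r * ξ ω : ℝ) * Complex.I)) P := by
    refine Integrable.of_bound (C := 1) ?_ (Eventually.of_forall fun ω => ?_)
    · have hm : AEStronglyMeasurable (fun ω => ((r * ξ ω : ℝ) : ℂ) * Complex.I) P :=
        (Complex.continuous_ofReal.comp_aestronglyMeasurable
          (i1.aestronglyMeasurable.const_mul r)).mul_const _
      exact Complex.continuous_exp.comp_aestronglyMeasurable hm
    · exact (Complex.norm_exp_ofReal_mul_I _).le
  have ip : Integrable (fun ω => (1 + (r * ξ ω : ℝ) * Complex.I - ((r * ξ ω : ℝ) : ℂ) ^ 2 / 2)) P := by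
    refine ((integrable_const _).add ((i1.const_mul r).ofReal.mul_const _)).sub' ?_
    have : Integrable (fun ω => ((r ^ 2 * ξ ω ^ 2 : ℝ) : ℂ) / 2) P :=
      (i2.const_mul (r ^ 2)).ofReal.div_const 2
    refine this.congr (Eventually.of_forall fun ω => ?_)
    push_cast; ring
  have e : ∫ ω, ((1 : ℂ) + (r * ξ ω : ℝ) * Complex.I - ((r * ξ ω : ℝ) : ℂ) ^ 2 / 2) ∂P =
      1 - ((r ^ 2 * ∫ ω, ξ ω ^ 2 ∂P : ℝ) : ℂ) / 2 := by
    have e1 : ∀ ω, ((1 : ℂ) + (r * ξ ω : ℝ) * Complex.I - ((r * ξ ω : ℝ) : ℂ) ^ 2 / 2) =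
        ((1 : ℂ) + (r * ξ ω : ℝ) * Complex.I) - ((r ^ 2 * ξ ω ^ 2 : ℝ) : ℂ) / 2 := fun ω => by
      push_cast; ring
    simp only [e1]
    rw [integral_sub ((integrable_const _).fun_add ((i1.const_mul r).ofReal.mul_const _))
      ((i2.const_mul (r ^ 2)).ofReal.div_const 2),
      integral_add (integrable_const _) ((i1.const_mul r).ofReal.mul_const _), integral_div,
      integral_mul_const, integral_complex_ofReal, integral_complex_ofReal, integral_const_mul,
      integral_const_mul, h0]
    simp
  rw [← e, ← integral_sub ie ip]
  calc _ ≤ ∫ ω, ‖Complex.exp ((r * ξ ω : ℝ) * Complex.I) -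
          (1 + (r * ξ ω : ℝ) * Complex.I - ((r * ξ ω : ℝ) : ℂ) ^ 2 / 2)‖ ∂P :=
        norm_integral_le_integral_norm _
    _ ≤ ∫ ω, 2 * r ^ 3 * (ξ ω ^ 2 + ξ ω ^ 4) ∂P := by
        refine integral_mono (ie.sub ip).norm ((i2.fun_add i4).const_mul _) fun ω => ?_
        refine (norm_exp_mul_I_sub_le (r * ξ ω)).trans ?_
        rw [abs_mul, abs_of_nonneg hr, mul_pow]
        -- The third absolute moment is traded for the second and fourth.
        have h2 : 2 * |ξ ω| ^ 3 ≤ ξ ω ^ 2 + ξ ω ^ 4 := by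
          rw [← sq_abs (ξ ω), ← Even.pow_abs (by decide : Even 4) (ξ ω)]
          nlinarith [sq_nonneg (|ξ ω| - |ξ ω| ^ 2)]
        have h3 : 0 ≤ r ^ 3 := pow_nonneg hr 3
        nlinarith [mul_le_mul_of_nonneg_left h2 h3]
    _ = _ := by rw [integral_const_mul, integral_add i2 i4]

variable {Ω : ℕ → Type*} [∀ n, MeasurableSpace (Ω n)] {P : ∀ n, Measure (Ω n)}
  [∀ n, IsProbabilityMeasure (P n)]

/-- Normalized pairs: independent, centered, with unit covariance matrix and bounded fourth
moments. -/
structure NormalizedPairs {Ω : Type*} [MeasurableSpace Ω] (P : Measure Ω) {N : ℕ}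
    (x y : Fin N → Ω → ℝ) (K : ℝ) : Prop where
  measurable_fst : ∀ i, Measurable (x i)
  measurable_snd : ∀ i, Measurable (y i)
  indep : iIndepFun (fun i ω => (x i ω, y i ω)) P
  memLp_fst : ∀ i, MemLp (x i) 4 P
  memLp_snd : ∀ i, MemLp (y i) 4 P
  mean_fst : ∀ i, ∫ ω, x i ω ∂P = 0
  mean_snd : ∀ i, ∫ ω, y i ω ∂P = 0
  second_fst : ∀ i, ∫ ω, x i ω ^ 2 ∂P = 1
  second_snd : ∀ i, ∫ ω, y i ω ^ 2 ∂P = 1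
  cov : ∀ i, ∫ ω, x i ω * y i ω ∂P = 0
  fourth_fst : ∀ i, ∫ ω, x i ω ^ 4 ∂P ≤ K
  fourth_snd : ∀ i, ∫ ω, y i ω ^ 4 ∂P ≤ K

/-- Compares the product of `N` characteristic functions with `(1 - (u² + v²)/(2N))^N`. Each factor
contributes an error of order `N^{-3/2}`; `huv` keeps the comparison factors in the unit disc. -/
theorem NormalizedPairs.norm_integral_exp_sum_sub_le {Ω : Type*} [MeasurableSpace Ω]
    {P : Measure Ω} [IsProbabilityMeasure P] {N : ℕ} {x y : Fin N → Ω → ℝ} {K : ℝ}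
    (h : NormalizedPairs P x y K) (hN : 0 < N) (u v : ℝ) (huv : u ^ 2 + v ^ 2 ≤ 2 * N) :
    ‖∫ ω, Complex.exp (((√(N : ℝ))⁻¹ * ∑ i, (u * x i ω + v * y i ω) : ℝ) * Complex.I) ∂P -
      (1 + ((-(u ^ 2 + v ^ 2) / 2 / N : ℝ) : ℂ)) ^ N‖ ≤
      2 * (u ^ 2 + v ^ 2 + 8 * (u ^ 4 + v ^ 4) * K) * (√(N : ℝ))⁻¹ := by
  obtain ⟨r, hr⟩ : ∃ r, r = (√(N : ℝ))⁻¹ := ⟨_, rfl⟩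
  have hNpos : (0 : ℝ) < N := by exact_mod_cast hN
  have hs : 0 < √(N : ℝ) := Real.sqrt_pos.2 hNpos
  have hr0 : 0 ≤ r := by rw [hr]; positivity
  have hr2 : r ^ 2 * N = 1 := by
    rw [hr, inv_pow, Real.sq_sqrt hNpos.le]; field_simp
  have hr2' : r ^ 2 = 1 / N := by field_simp; linarith
  rw [← hr]
  set ξ : Fin N → Ω → ℝ := fun i ω => u * x i ω + v * y i ω with hξdef
  have hξ : ∀ i, MemLp (ξ i) 4 P := fun i =>
    ((h.memLp_fst i).const_mul u).add ((h.memLp_snd i).const_mul v)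
  have ix : ∀ i, Integrable (x i) P := fun i => (h.memLp_fst i).integrable (by norm_num)
  have iy : ∀ i, Integrable (y i) P := fun i => (h.memLp_snd i).integrable (by norm_num)
  have mx : ∀ i, MemLp (x i) 2 P := fun i => (h.memLp_fst i).mono_exponent (by norm_num)
  have my : ∀ i, MemLp (y i) 2 P := fun i => (h.memLp_snd i).mono_exponent (by norm_num)
  have ixy : ∀ i, Integrable (fun ω => x i ω * y i ω) P := fun i => (mx i).integrable_mul (my i)
  have hξ0 : ∀ i, ∫ ω, ξ i ω ∂P = 0 := fun i => by
    rw [integral_add ((ix i).const_mul u) ((iy i).const_mul v), integral_const_mul,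
      integral_const_mul, h.mean_fst, h.mean_snd]
    simp
  have hξ2 : ∀ i, ∫ ω, ξ i ω ^ 2 ∂P = u ^ 2 + v ^ 2 := fun i => by
    have e : ∀ ω, ξ i ω ^ 2 = u ^ 2 * x i ω ^ 2 + (2 * u * v) * (x i ω * y i ω) +
        v ^ 2 * y i ω ^ 2 := fun ω => by simp only [hξdef]; ring
    simp only [e]
    rw [integral_add (((mx i).integrable_sq.const_mul _).fun_add ((ixy i).const_mul _))
      ((my i).integrable_sq.const_mul _), integral_add ((mx i).integrable_sq.const_mul _)
      ((ixy i).const_mul _), integral_const_mul, integral_const_mul, integral_const_mul,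
      h.second_fst, h.second_snd, h.cov]
    ring
  have hξ4 : ∀ i, ∫ ω, ξ i ω ^ 4 ∂P ≤ 8 * (u ^ 4 + v ^ 4) * K := fun i => by
    have i4x := (h.memLp_fst i).integrable_pow_four
    have i4y := (h.memLp_snd i).integrable_pow_four
    calc ∫ ω, ξ i ω ^ 4 ∂P ≤ ∫ ω, (8 * u ^ 4 * x i ω ^ 4 + 8 * v ^ 4 * y i ω ^ 4) ∂P := by
          refine integral_mono (hξ i).integrable_pow_four
            ((i4x.const_mul _).fun_add (i4y.const_mul _)) fun ω => ?_
          have p4 : ∀ a b : ℝ, (a + b) ^ 4 ≤ 8 * (a ^ 4 + b ^ 4) := fun a b => by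
            have h1 : (a + b) ^ 2 ≤ 2 * (a ^ 2 + b ^ 2) := by nlinarith [sq_nonneg (a - b)]
            calc (a + b) ^ 4 = ((a + b) ^ 2) ^ 2 := by ring
              _ ≤ (2 * (a ^ 2 + b ^ 2)) ^ 2 := by gcongr
              _ ≤ 8 * (a ^ 4 + b ^ 4) := by nlinarith [sq_nonneg (a ^ 2 - b ^ 2)]
          exact (p4 _ _).trans (le_of_eq (by ring))
      _ = 8 * u ^ 4 * ∫ ω, x i ω ^ 4 ∂P + 8 * v ^ 4 * ∫ ω, y i ω ^ 4 ∂P := by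
          rw [integral_add (i4x.const_mul _) (i4y.const_mul _), integral_const_mul,
            integral_const_mul]
      _ ≤ 8 * u ^ 4 * K + 8 * v ^ 4 * K := by
          gcongr
          · exact h.fourth_fst i
          · exact h.fourth_snd i
      _ = _ := by ring
  have hprod : ∫ ω, Complex.exp ((r * ∑ i, ξ i ω : ℝ) * Complex.I) ∂P =
      ∏ i, ∫ ω, Complex.exp ((r * ξ i ω : ℝ) * Complex.I) ∂P := by
    have e : ∀ ω, Complex.exp ((r * ∑ i, ξ i ω : ℝ) * Complex.I) =
        ∏ i, Complex.exp ((r * ξ i ω : ℝ) * Complex.I) := fun ω => by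
      rw [← Complex.exp_sum]
      push_cast
      rw [Finset.mul_sum, Finset.sum_mul]
    simp only [e]
    have hm : Measurable fun z : ℝ × ℝ =>
        Complex.exp ((r * (u * z.1 + v * z.2) : ℝ) * Complex.I) := by fun_prop
    obtain ⟨φ, hφ⟩ : ∃ φ : ℝ × ℝ → ℂ, φ = fun z =>
      Complex.exp ((r * (u * z.1 + v * z.2) : ℝ) * Complex.I) := ⟨_, rfl⟩
    have hφ' : ∀ i ω, Complex.exp ((r * ξ i ω : ℝ) * Complex.I) = φ (x i ω, y i ω) :=
      fun i ω => by rw [hφ]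
    rw [← hφ] at hm
    simp only [hφ']
    exact h.indep.integral_fun_prod_comp (f := fun _ => φ)
      (fun i => ((h.measurable_fst i).prodMk (h.measurable_snd i)).aemeasurable)
      fun i => hm.aestronglyMeasurable
  have hb : (1 + ((-(u ^ 2 + v ^ 2) / 2 / N : ℝ) : ℂ)) ^ N =
      ∏ _i : Fin N, (1 + ((-(u ^ 2 + v ^ 2) / 2 / N : ℝ) : ℂ)) := by simp
  rw [hprod, hb]
  refine (norm_prod_sub_prod_le _ _ _ (fun i _ => ?_) fun i _ => ?_).trans ?_
  · refine (norm_integral_le_integral_norm _).trans ?_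
    simp only [Complex.norm_exp_ofReal_mul_I]
    simp
  · rw [← Complex.ofReal_one, ← Complex.ofReal_add, Complex.norm_real, Real.norm_eq_abs, abs_le]
    have h1 : (u ^ 2 + v ^ 2) / 2 / N ≤ 1 := by
      rw [div_le_one hNpos]; linarith
    have h2 : 0 ≤ (u ^ 2 + v ^ 2) / 2 / N := by positivity
    rw [neg_div, neg_div]
    constructor <;> linarith
  · calc _ ≤ ∑ _i : Fin N, 2 * r ^ 3 * (u ^ 2 + v ^ 2 + 8 * (u ^ 4 + v ^ 4) * K) := by
          refine Finset.sum_le_sum fun i _ => ?_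
          have := norm_integral_exp_sub_le (hξ i) (hξ0 i) hr0
          rw [hξ2 i] at this
          have e : (1 - ((r ^ 2 * (u ^ 2 + v ^ 2) : ℝ) : ℂ) / 2) =
              1 + ((-(u ^ 2 + v ^ 2) / 2 / N : ℝ) : ℂ) := by
            rw [hr2']; push_cast; ring
          rw [e] at this
          refine this.trans ?_
          gcongr
          exact hξ4 i
      _ = 2 * (u ^ 2 + v ^ 2 + 8 * (u ^ 4 + v ^ 4) * K) * (r * (r ^ 2 * N)) := by simp; ring
      _ = _ := by rw [hr2]; ring

theorem chiSquare_two_eq_map_stdGaussian :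
    chiSquare 2 = (stdGaussian (EuclideanSpace ℝ (Fin 2))).map (fun z => ∑ i, z i ^ 2) := by
  rw [← map_pi_eq_stdGaussian, Measure.map_map (by fun_prop) (by fun_prop)]
  rfl

/-- Lévy's continuity theorem in the plane: the characteristic function at `t` only involves the
scalar sums of `t 0 * x + t 1 * y`. Continuous mapping by the squared norm turns the Gaussian limit
into chi-square. -/
theorem tendstoInDistribution_normalizedSum {N : ℕ → ℕ} (hN : Tendsto N atTop atTop)
    {x y : ∀ n, Fin (N n) → Ω n → ℝ} {K : ℝ}
    (h : ∀ n, NormalizedPairs (P n) (x n) (y n) K) :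
    TendstoInDistribution
      (fun n ω => (∑ i, x n i ω) ^ 2 / N n + (∑ i, y n i ω) ^ 2 / N n) atTop id P
      (chiSquare 2) := by
  have mX : ∀ n, Measurable fun ω => ∑ i, x n i ω := fun n =>
    Finset.measurable_fun_sum _ fun i _ => (h n).measurable_fst i
  have mY : ∀ n, Measurable fun ω => ∑ i, y n i ω := fun n =>
    Finset.measurable_fun_sum _ fun i _ => (h n).measurable_snd i
  let U : ∀ n, Ω n → EuclideanSpace ℝ (Fin 2) := fun n ω =>
    !₂[(√(N n : ℝ))⁻¹ * ∑ i, x n i ω, (√(N n : ℝ))⁻¹ * ∑ i, y n i ω]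
  have mU : ∀ n, Measurable (U n) := fun n => by
    refine (WithLp.measurable_toLp 2 _).comp (measurable_pi_lambda _ fun i => ?_)
    fin_cases i
    · exact (mX n).const_mul _
    · exact (mY n).const_mul _
  have hU : TendstoInDistribution U atTop id P (stdGaussian (EuclideanSpace ℝ (Fin 2))) := by
    refine ⟨fun n => (mU n).aemeasurable, aemeasurable_id, ?_⟩
    refine ProbabilityMeasure.tendsto_iff_tendsto_charFun.2 fun t => ?_
    simp only [ProbabilityMeasure.coe_mk, Measure.map_id, charFun_stdGaussian]
    have e1 : ∀ n, charFun ((P n).map (U n)) t =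
        ∫ ω, Complex.exp (((√(N n : ℝ))⁻¹ * ∑ i, (t 0 * x n i ω + t 1 * y n i ω) : ℝ) *
          Complex.I) ∂(P n) := fun n => by
      rw [charFun_apply, integral_map (mU n).aemeasurable (by fun_prop)]
      refine integral_congr_ae (Eventually.of_forall fun ω => ?_)
      have : inner ℝ (U n ω) t =
          (√(N n : ℝ))⁻¹ * ∑ i, (t 0 * x n i ω + t 1 * y n i ω) := by
        simp only [U, PiLp.inner_apply, Fin.sum_univ_two, Finset.sum_add_distrib, ← Finset.mul_sum]
        simp
        ring
      simp only [this]
    simp only [e1]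
    have hNr : Tendsto (fun n => (N n : ℝ)) atTop atTop := tendsto_natCast_atTop_atTop.comp hN
    have hlim : Tendsto (fun n => (1 + ((-(t 0 ^ 2 + t 1 ^ 2) / 2 / N n : ℝ) : ℂ)) ^ N n) atTop
        (𝓝 (Complex.exp (-‖t‖ ^ 2 / 2))) := by
      have h1 := (Complex.tendsto_one_add_div_pow_exp (-(t 0 ^ 2 + t 1 ^ 2 : ℂ) / 2)).comp hN
      have e2 : (-(t 0 ^ 2 + t 1 ^ 2 : ℂ) / 2) = -‖t‖ ^ 2 / 2 := by
        have hn : ‖t‖ ^ 2 = t 0 ^ 2 + t 1 ^ 2 := by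
          rw [EuclideanSpace.real_norm_sq_eq, Fin.sum_univ_two]
        have hn' : (‖t‖ : ℂ) ^ 2 = (t 0 : ℂ) ^ 2 + (t 1 : ℂ) ^ 2 := by exact_mod_cast hn
        rw [hn']
      rw [e2] at h1
      refine h1.congr fun n => ?_
      rw [← e2]
      simp only [Function.comp_apply]
      push_cast; ring
    rw [← sub_zero (Complex.exp _)]
    refine Tendsto.congr (f₁ := fun n => (1 + ((-(t 0 ^ 2 + t 1 ^ 2) / 2 / N n : ℝ) : ℂ)) ^ N n -
      ((1 + ((-(t 0 ^ 2 + t 1 ^ 2) / 2 / N n : ℝ) : ℂ)) ^ N n -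
        ∫ ω, Complex.exp (((√(N n : ℝ))⁻¹ * ∑ i, (t 0 * x n i ω + t 1 * y n i ω) : ℝ) *
          Complex.I) ∂(P n))) (fun n => by ring) (hlim.sub ?_)
    have hz : Tendsto (fun n => 2 * (t 0 ^ 2 + t 1 ^ 2 + 8 * (t 0 ^ 4 + t 1 ^ 4) * K) *
        (√(N n : ℝ))⁻¹) atTop (𝓝 0) := by
      simpa using (tendsto_inv_atTop_zero.comp (Real.tendsto_sqrt_atTop.comp hNr)).const_mul
        (2 * (t 0 ^ 2 + t 1 ^ 2 + 8 * (t 0 ^ 4 + t 1 ^ 4) * K))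
    refine squeeze_zero_norm' ?_ hz
    filter_upwards [hN.eventually_gt_atTop 0, hNr.eventually_ge_atTop ((t 0 ^ 2 + t 1 ^ 2) / 2)]
      with n hn0 hn1
    rw [norm_sub_rev]
    exact (h n).norm_integral_exp_sum_sub_le hn0 _ _ (by linarith)
  have hc := hU.continuous_comp (g := fun z : EuclideanSpace ℝ (Fin 2) => ∑ i, z i ^ 2)
    (by fun_prop)
  refine ⟨fun n => (((mX n).pow_const 2).div_const _ |>.add
    (((mY n).pow_const 2).div_const _)).aemeasurable, aemeasurable_id, ?_⟩
  have e0 : ∀ n, ((fun z : EuclideanSpace ℝ (Fin 2) => ∑ i, z i ^ 2) ∘ U n) =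
      fun ω => (∑ i, x n i ω) ^ 2 / N n + (∑ i, y n i ω) ^ 2 / N n := fun n => by
    ext ω
    simp [U, Fin.sum_univ_two, mul_pow]
    ring
  have hlim : (⟨(chiSquare 2).map id, Measure.isProbabilityMeasure_map aemeasurable_id⟩ :
      ProbabilityMeasure ℝ) = ⟨(stdGaussian (EuclideanSpace ℝ (Fin 2))).map
        ((fun z : EuclideanSpace ℝ (Fin 2) => ∑ i, z i ^ 2) ∘ id),
        Measure.isProbabilityMeasure_map hc.aemeasurable_limit⟩ := by
    apply Subtype.ext
    simp only [Measure.map_id, Function.comp_id]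
    exact chiSquare_two_eq_map_stdGaussian
  rw [hlim]
  refine hc.tendsto.congr fun n => ?_
  apply Subtype.ext
  exact congrArg (fun f => (P n).map f) (e0 n)

end CentralLimit

/-! ### Slutsky-type lemmas with exceptional sets. -/

section Slutsky

theorem abs_integral_sub_integral_le {Ω : Type*} [MeasurableSpace Ω] {P : Measure Ω}
    [IsProbabilityMeasure P] {a b : Ω → ℝ} (ha : Integrable a P) (hb : Integrable b P) {M η θ : ℝ}
    (hM0 : 0 ≤ M) (hη : 0 ≤ η) (hθ : 0 ≤ θ) (hM : ∀ ω, |a ω - b ω| ≤ M) {B : Set Ω}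
    (hB : P B ≤ ENNReal.ofReal θ) (hclose : ∀ ω ∉ B, |a ω - b ω| ≤ η) :
    |∫ ω, a ω ∂P - ∫ ω, b ω ∂P| ≤ η + M * θ := by
  -- The exceptional set need not be measurable; its measurable hull has the same measure.
  set T := toMeasurable P B with hT
  have hTm : MeasurableSet T := measurableSet_toMeasurable P B
  have hPT : P.real T ≤ θ := by
    rw [Measure.real, hT, measure_toMeasurable]
    exact ENNReal.toReal_le_of_le_ofReal hθ hB
  rw [← integral_sub ha hb]
  calc |∫ ω, (a ω - b ω) ∂P| ≤ ∫ ω, |a ω - b ω| ∂P := abs_integral_le_integral_abs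
    _ ≤ ∫ ω, (η + T.indicator (fun _ => M) ω) ∂P := by
        refine integral_mono (ha.sub hb).abs
          ((integrable_const η).fun_add ((integrable_const M).indicator hTm)) fun ω => ?_
        by_cases hω : ω ∈ T
        · simp only [Set.indicator_of_mem hω]
          linarith [hM ω]
        · simp only [Set.indicator_of_notMem hω, add_zero]
          exact hclose ω fun h => hω (subset_toMeasurable P B h)
    _ = η + P.real T * M := by
        rw [integral_add (integrable_const η) ((integrable_const M).indicator hTm),
          integral_indicator_const M hTm]
        simp
    _ ≤ η + M * θ := by rw [mul_comm]; gcongr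

variable {Ω : ℕ → Type*} [∀ n, MeasurableSpace (Ω n)] {P : ∀ n, Measure (Ω n)}
  [∀ n, IsProbabilityMeasure (P n)]

/-- Tested on bounded Lipschitz functions: off the exceptional set the Lipschitz constant controls
the difference, on it the bound on the oscillation does. -/
theorem TendstoInDistribution_of_close_real {W D : ∀ n, Ω n → ℝ} {ν : Measure ℝ}
    [IsProbabilityMeasure ν] (hW : TendstoInDistribution W atTop id P ν)
    (hD : ∀ n, Measurable (D n))
    (hclose : ∀ η > 0, ∀ θ > 0, ∀ᶠ n in atTop, ∃ B : Set (Ω n), P n B ≤ ENNReal.ofReal θ ∧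
      ∀ ω ∉ B, |D n ω - W n ω| ≤ η) :
    TendstoInDistribution D atTop id P ν := by
  refine ⟨fun n => (hD n).aemeasurable, aemeasurable_id, ?_⟩
  have hW' := tendsto_iff_forall_lipschitz_integral_tendsto.mp hW.tendsto
  refine tendsto_iff_forall_lipschitz_integral_tendsto.mpr ?_
  rintro F ⟨C, hC⟩ ⟨L, hL⟩
  have h1 := hW' F ⟨C, hC⟩ ⟨L, hL⟩
  have hFc : Continuous F := hL.continuous
  have hC0 : 0 ≤ C := le_trans dist_nonneg (hC 0 0)
  have hint : ∀ n (f : Ω n → ℝ), AEMeasurable f (P n) → Integrable (fun ω => F (f ω)) (P n) := by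
    intro n f hf
    refine Integrable.of_bound (C := |F 0| + C)
      (hFc.measurable.comp_aemeasurable hf).aestronglyMeasurable (Eventually.of_forall fun ω => ?_)
    have := hC (f ω) 0
    rw [Real.dist_eq] at this
    rw [Real.norm_eq_abs]
    have h2 := abs_sub_abs_le_abs_sub (F (f ω)) (F 0)
    linarith
  have hdiff : Tendsto (fun n => ∫ ω, F (D n ω) ∂(P n) - ∫ ω, F (W n ω) ∂(P n)) atTop (𝓝 0) := by
    rw [Metric.tendsto_nhds]
    intro ε hε
    have hη : 0 < ε / 2 / (L + 1) := by positivity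
    have hθ : 0 < ε / 4 / (C + 1) := by positivity
    filter_upwards [hclose _ hη _ hθ] with n hn
    obtain ⟨B, hB, hB'⟩ := hn
    rw [Real.dist_eq, sub_zero]
    have := abs_integral_sub_integral_le (hint n _ (hD n).aemeasurable)
      (hint n _ (hW.forall_aemeasurable n)) hC0 (by positivity : 0 ≤ ε / 2) hθ.le
      (fun ω => by rw [← Real.dist_eq]; exact hC _ _) hB fun ω hω => by
        rw [← Real.dist_eq]
        refine (hL.dist_le_mul _ _).trans ?_
        rw [Real.dist_eq]
        calc (L : ℝ) * |D n ω - W n ω| ≤ (L + 1) * (ε / 2 / (L + 1)) := by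
              gcongr
              · linarith
              · exact hB' ω hω
          _ = ε / 2 := by field_simp
    have h2 : C * (ε / 4 / (C + 1)) ≤ ε / 4 := by
      rw [mul_div_assoc', div_le_iff₀ (by positivity)]
      nlinarith
    linarith
  have h3 := hdiff.add h1
  rw [zero_add] at h3
  refine h3.congr fun n => ?_
  simp only [ProbabilityMeasure.coe_mk]
  rw [integral_map (hW.forall_aemeasurable n) hFc.aestronglyMeasurable,
    integral_map (hD n).aemeasurable hFc.aestronglyMeasurable]
  ring

/-- A version of Slutsky's lemma for extended real random variables on varying spaces. -/
theorem tendstoInDistribution_of_close {W : ∀ n, Ω n → ℝ} {G : ∀ n, Ω n → EReal} {ν : Measure ℝ}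
    [IsProbabilityMeasure ν] (hW : TendstoInDistribution W atTop id P ν)
    (hG : ∀ n, Measurable (G n))
    (hclose : ∀ η > 0, ∀ θ > 0, ∀ᶠ n in atTop, ∃ B : Set (Ω n), P n B ≤ ENNReal.ofReal θ ∧
      ∀ ω ∉ B, ∃ g : ℝ, G n ω = g ∧ |g - W n ω| ≤ η) :
    TendstoInDistribution G atTop (fun t : ℝ => (t : EReal)) P ν := by
  -- The real part of `G` agrees with `G` off the exceptional set, so the real version applies to
  -- it. Going back to `EReal` then only needs boundedness of the test functions.
  have hDm : ∀ n, Measurable fun ω => (G n ω).toReal := fun n => (hG n).ereal_toReal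
  have hD : TendstoInDistribution (fun n ω => (G n ω).toReal) atTop id P ν := by
    refine TendstoInDistribution_of_close_real hW hDm fun η hη θ hθ => ?_
    filter_upwards [hclose η hη θ hθ] with n ⟨B, hB, hB'⟩
    refine ⟨B, hB, fun ω hω => ?_⟩
    obtain ⟨g, hg, hg'⟩ := hB' ω hω
    rwa [hg, EReal.toReal_coe]
  have hc := hD.continuous_comp (g := fun t : ℝ => (t : EReal)) continuous_coe_real_ereal
  refine ⟨fun n => (hG n).aemeasurable, measurable_coe_real_ereal.aemeasurable, ?_⟩
  have hc' := ProbabilityMeasure.tendsto_iff_forall_integral_tendsto.mp hc.tendsto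
  refine ProbabilityMeasure.tendsto_iff_forall_integral_tendsto.mpr ?_
  intro f
  have h1 := hc' f
  have hint : ∀ n (u : Ω n → EReal), Measurable u → Integrable (fun ω => f (u ω)) (P n) := by
    intro n u hu
    exact Integrable.of_bound (C := ‖f‖) (f.continuous.measurable.comp hu).aestronglyMeasurable
      (Eventually.of_forall fun ω => f.norm_coe_le_norm _)
  have hm : ∀ n, Measurable fun ω => (((G n ω).toReal : ℝ) : EReal) := fun n =>
    measurable_coe_real_ereal.comp (hDm n)
  have hdiff : Tendsto (fun n => ∫ ω, f (G n ω) ∂(P n) -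
      ∫ ω, f (((G n ω).toReal : ℝ) : EReal) ∂(P n)) atTop (𝓝 0) := by
    rw [Metric.tendsto_nhds]
    intro ε hε
    have hθ : 0 < ε / 2 / (2 * ‖f‖ + 1) := by positivity
    filter_upwards [hclose 1 one_pos _ hθ] with n ⟨B, hB, hB'⟩
    rw [Real.dist_eq, sub_zero]
    have := abs_integral_sub_integral_le (hint n _ (hG n)) (hint n _ (hm n))
      (by positivity : 0 ≤ 2 * ‖f‖) le_rfl hθ.le
      (fun ω => by rw [← Real.dist_eq]; exact f.dist_le_two_norm _ _) hB fun ω hω => by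
        obtain ⟨g, hg, -⟩ := hB' ω hω
        simp [hg]
    have h2 : 2 * ‖f‖ * (ε / 2 / (2 * ‖f‖ + 1)) ≤ ε / 2 := by
      rw [mul_div_assoc', div_le_iff₀ (by positivity)]
      nlinarith [norm_nonneg f]
    linarith
  have h3 := hdiff.add h1
  rw [zero_add] at h3
  refine h3.congr fun n => ?_
  have e1 : ∫ x, f x ∂((P n).map ((fun t : ℝ => (t : EReal)) ∘ fun ω => (G n ω).toReal)) =
      ∫ ω, f (((G n ω).toReal : ℝ) : EReal) ∂(P n) :=
    integral_map (hm n).aemeasurable f.continuous.measurable.aestronglyMeasurable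
  have e2 : ∫ x, f x ∂((P n).map (G n)) = ∫ ω, f (G n ω) ∂(P n) :=
    integral_map (hG n).aemeasurable f.continuous.measurable.aestronglyMeasurable
  simp only [ProbabilityMeasure.coe_mk]
  rw [e1, e2]
  ring

end Slutsky

/-! ### Stability of the approximation under small perturbations. -/

section Perturbation

variable {N : ℕ}

/-- Young's inequality with parameter `κ`: a small multiple of the original sizes is accepted in
exchange for a large multiple of the perturbation. -/
theorem abs_sum_mul_sub_le (x y x' y' : Fin N → ℝ) {κ : ℝ} (hκ : 0 < κ) :
    |∑ i, x' i * y' i - ∑ i, x i * y i| ≤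
      (1 + 1 / κ) * ∑ i, ((x' i - x i) ^ 2 + (y' i - y i) ^ 2) +
        κ * ∑ i, (x i ^ 2 + y i ^ 2) := by
  rw [← Finset.sum_sub_distrib, Finset.mul_sum, Finset.mul_sum, ← Finset.sum_add_distrib]
  refine (Finset.abs_sum_le_sum_abs _ _).trans (Finset.sum_le_sum fun i _ => ?_)
  obtain ⟨d, hd⟩ : ∃ d, d = x' i - x i := ⟨_, rfl⟩
  obtain ⟨e, he⟩ : ∃ e, e = y' i - y i := ⟨_, rfl⟩
  have h1 : x' i * y' i - x i * y i = d * y i + x i * e + d * e := by rw [hd, he]; ring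
  have yg : ∀ p q : ℝ, |p * q| ≤ 1 / κ * p ^ 2 + κ * q ^ 2 := by
    intro p q
    have e1 : 1 / κ * p ^ 2 + κ * q ^ 2 - p * q =
        1 / κ * ((p - κ * q / 2) ^ 2 + 3 / 4 * (κ * q) ^ 2) := by field_simp; ring
    have e2 : 1 / κ * p ^ 2 + κ * q ^ 2 + p * q =
        1 / κ * ((p + κ * q / 2) ^ 2 + 3 / 4 * (κ * q) ^ 2) := by field_simp; ring
    have p1 : 0 ≤ 1 / κ * ((p - κ * q / 2) ^ 2 + 3 / 4 * (κ * q) ^ 2) := by positivity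
    have p2 : 0 ≤ 1 / κ * ((p + κ * q / 2) ^ 2 + 3 / 4 * (κ * q) ^ 2) := by positivity
    rw [abs_le]
    constructor <;> linarith
  rw [h1, ← hd, ← he]
  have h2 : |d * e| ≤ d ^ 2 + e ^ 2 := by
    rw [abs_le]
    constructor <;> nlinarith [sq_nonneg (d + e), sq_nonneg (d - e)]
  calc |d * y i + x i * e + d * e| ≤ |d * y i| + |x i * e| + |d * e| := abs_add_three _ _ _
    _ ≤ (1 / κ * d ^ 2 + κ * y i ^ 2) + (1 / κ * e ^ 2 + κ * x i ^ 2) + (d ^ 2 + e ^ 2) :=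
        add_le_add (add_le_add (yg _ _) (by rw [mul_comm]; exact yg _ _)) h2
    _ = _ := by ring

theorem abs_add_sq_sub_sq_le (p q : ℝ) {κ : ℝ} (hκ : 0 < κ) :
    |(p + q) ^ 2 - p ^ 2| ≤ κ * p ^ 2 + (1 + 1 / κ) * q ^ 2 := by
  have e1 : κ * p ^ 2 + (1 + 1 / κ) * q ^ 2 - ((p + q) ^ 2 - p ^ 2) =
      1 / κ * (κ * p - q) ^ 2 := by field_simp; ring
  have e2 : κ * p ^ 2 + (1 + 1 / κ) * q ^ 2 + ((p + q) ^ 2 - p ^ 2) =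
      1 / κ * (κ * p + q) ^ 2 + 2 * q ^ 2 := by field_simp; ring
  have p1 : 0 ≤ 1 / κ * (κ * p - q) ^ 2 := by positivity
  have p2 : 0 ≤ 1 / κ * (κ * p + q) ^ 2 + 2 * q ^ 2 := by positivity
  rw [abs_le]
  constructor <;> linarith

/-- Used for `x, y` and also for `x, x` and `y, y`, where each sum of squares is counted twice;
hence the factors `2` in the hypotheses. The choice `κ = δ / 16` splits the error evenly enough. -/
theorem abs_sum_mul_div_sub_le (hN : 0 < N) (x y x' y' : Fin N → ℝ) {δ a c : ℝ} (hδ0 : 0 < δ)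
    (hδ : δ ≤ 1 / 20) (ha : a ≤ δ ^ 2 / 256)
    (hd : ∑ i, ((x' i - x i) ^ 2 + (y' i - y i) ^ 2) ≤ 2 * (a * N))
    (hs : ∑ i, (x i ^ 2 + y i ^ 2) ≤ 2 * ((1 + a) * N))
    (h : |(∑ i, x i * y i) / N - c| ≤ a) : |(∑ i, x' i * y' i) / N - c| ≤ δ := by
  have hNpos : (0 : ℝ) < N := by exact_mod_cast hN
  have ha1 : a ≤ δ / 256 := ha.trans (by nlinarith)
  have h1 := abs_sum_mul_sub_le x y x' y' (κ := δ / 16) (by positivity)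
  have h2 : |(∑ i, x' i * y' i) / N - (∑ i, x i * y i) / N| ≤ δ / 2 := by
    rw [← sub_div, abs_div, abs_of_pos hNpos, div_le_iff₀ hNpos]
    calc _ ≤ _ := h1
      _ ≤ (1 + 1 / (δ / 16)) * (2 * (δ ^ 2 / 256 * N)) + δ / 16 * (2 * ((1 + 1) * N)) := by
          gcongr
          · exact hd.trans (by gcongr)
          · refine hs.trans ?_
            gcongr
            linarith
      _ = (δ ^ 2 / 128 + δ / 8 + δ / 4) * N := by field_simp; ring
      _ ≤ δ / 2 * N := by gcongr; nlinarith
  calc _ = |((∑ i, x' i * y' i) / N - (∑ i, x i * y i) / N) + ((∑ i, x i * y i) / N - c)| := by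
        congr 1; ring
    _ ≤ δ / 2 + a := (abs_add_le _ _).trans (add_le_add h2 h)
    _ ≤ δ := by linarith

theorem max_bound (x d : ℝ) {s b B δ : ℝ} (hs : 0 ≤ s) (hb : 0 ≤ b) (hb1 : b ≤ 1)
    (hB : 0 ≤ B) (hbB : 16 * B * b ≤ δ)
    (hx : x ^ 4 ≤ b ^ 4 * s ^ 4) (hd : d ^ 2 ≤ b ^ 4 * s ^ 2) : 8 * B * |x + d| ≤ δ * s := by
  have h1 : |x| ≤ b * s := by
    rw [← mul_pow] at hx
    have h0 : |x| ^ 4 ≤ (b * s) ^ 4 := by rwa [Even.pow_abs (by decide)]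
    exact le_of_pow_le_pow_left₀ (by norm_num) (by positivity) h0
  have h2 : |d| ≤ b * s := by
    refine abs_le_of_sq_le_sq ?_ (by positivity)
    refine hd.trans ?_
    rw [mul_pow]
    have : b ^ 4 ≤ b ^ 2 := pow_le_pow_of_le_one hb hb1 (by norm_num)
    gcongr
  have h3 : |x + d| ≤ 2 * (b * s) := (abs_add_le _ _).trans (by linarith)
  calc 8 * B * |x + d| ≤ 8 * B * (2 * (b * s)) := by gcongr
    _ = 16 * B * b * s := by ring
    _ ≤ δ * s := by gcongr

/-- All hypotheses of the unperturbed approximation pass to the perturbed data with `A + 1` in place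
of `A`. The maximum of `|x i|` is controlled by the sum of fourth powers, that of the perturbation
by its sum of squares. In the final error, `20` comes from the approximation and `1` from changing
the sum. -/
theorem neg_two_log_empiricalLikelihoodRatio_perturbed (hN : 0 < N) (x y x' y' : Fin N → ℝ)
    {δ A a b : ℝ} (hδ0 : 0 < δ) (hδ : δ ≤ 1 / 20) (hA : 0 ≤ A) (hδA : δ * (A + 1) ≤ 1)
    (hb0 : 0 ≤ b) (hb1 : b ≤ 1) (hbA : 16 * (1 + (A + 1)) * b ≤ δ) (ha0 : 0 ≤ a)
    (ha : a ≤ δ ^ 2 / 256) (hab : a ≤ b ^ 4) (hAN : (A + 1) / N ≤ δ)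
    (h11 : |(∑ i, x i ^ 2) / N - 1| ≤ a) (h12 : |(∑ i, x i * y i) / N| ≤ a)
    (h22 : |(∑ i, y i ^ 2) / N - 1| ≤ a)
    (hW : (∑ i, x i) ^ 2 / N + (∑ i, y i) ^ 2 / N ≤ A)
    (h4 : ∑ i, (x i ^ 4 + y i ^ 4) ≤ a * N ^ 2)
    (hd : ∑ i, ((x' i - x i) ^ 2 + (y' i - y i) ^ 2) ≤ a * N)
    (hD : (∑ i, (x' i - x i)) ^ 2 + (∑ i, (y' i - y i)) ^ 2 ≤ a * N) :
    ∃ g : ℝ, (-2 : EReal) * ENNReal.log (empiricalLikelihoodRatio (fun i => (x' i, y' i)))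
        = (g : EReal) ∧
      |g - ((∑ i, x i) ^ 2 / N + (∑ i, y i) ^ 2 / N)| ≤ 21 * δ * (A + 1) := by
  have hNpos : (0 : ℝ) < N := by exact_mod_cast hN
  have hs2 : √(N : ℝ) ^ 2 = N := Real.sq_sqrt hNpos.le
  have hs4 : √(N : ℝ) ^ 4 = (N : ℝ) ^ 2 := by
    rw [show √(N : ℝ) ^ 4 = (√(N : ℝ) ^ 2) ^ 2 by ring, hs2]
  have sx : ∑ i, x i ^ 2 ≤ (1 + a) * N := by
    have := (abs_le.mp h11).2
    rw [← div_le_iff₀ hNpos]; linarith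
  have sy : ∑ i, y i ^ 2 ≤ (1 + a) * N := by
    have := (abs_le.mp h22).2
    rw [← div_le_iff₀ hNpos]; linarith
  have dsplit := hd
  rw [Finset.sum_add_distrib] at dsplit
  have dx0 : 0 ≤ ∑ i, (x' i - x i) ^ 2 := Finset.sum_nonneg fun _ _ => sq_nonneg _
  have dy0 : 0 ≤ ∑ i, (y' i - y i) ^ 2 := Finset.sum_nonneg fun _ _ => sq_nonneg _
  have haN : 0 ≤ a * N := by positivity
  have k11 : |(∑ i, x' i ^ 2) / N - 1| ≤ δ := by
    simp only [sq] at h11 ⊢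
    refine abs_sum_mul_div_sub_le hN x x x' x' hδ0 hδ ha ?_ ?_ h11
    · rw [Finset.sum_add_distrib]; linarith
    · rw [Finset.sum_add_distrib]; linarith
  have k22 : |(∑ i, y' i ^ 2) / N - 1| ≤ δ := by
    simp only [sq] at h22 ⊢
    refine abs_sum_mul_div_sub_le hN y y y' y' hδ0 hδ ha ?_ ?_ h22
    · rw [Finset.sum_add_distrib]; linarith
    · rw [Finset.sum_add_distrib]; linarith
  have k12 : |(∑ i, x' i * y' i) / N| ≤ δ := by
    rw [← sub_zero ((∑ i, x i * y i) / N)] at h12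
    rw [← sub_zero ((∑ i, x' i * y' i) / N)]
    refine abs_sum_mul_div_sub_le hN x y x' y' hδ0 hδ ha ?_ ?_ h12
    · linarith
    · rw [Finset.sum_add_distrib]; linarith
  have hWd : |((∑ i, x' i) ^ 2 / N + (∑ i, y' i) ^ 2 / N) -
      ((∑ i, x i) ^ 2 / N + (∑ i, y i) ^ 2 / N)| ≤ δ * (A + 1) := by
    have ex : ∑ i, x' i = ∑ i, x i + ∑ i, (x' i - x i) := by rw [Finset.sum_sub_distrib]; ring
    have ey : ∑ i, y' i = ∑ i, y i + ∑ i, (y' i - y i) := by rw [Finset.sum_sub_distrib]; ring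
    have bx := abs_add_sq_sub_sq_le (∑ i, x i) (∑ i, (x' i - x i)) hδ0
    have by' := abs_add_sq_sub_sq_le (∑ i, y i) (∑ i, (y' i - y i)) hδ0
    rw [← ex] at bx
    rw [← ey] at by'
    have e : ((∑ i, x' i) ^ 2 / N + (∑ i, y' i) ^ 2 / N) -
        ((∑ i, x i) ^ 2 / N + (∑ i, y i) ^ 2 / N) = (((∑ i, x' i) ^ 2 - (∑ i, x i) ^ 2) +
        ((∑ i, y' i) ^ 2 - (∑ i, y i) ^ 2)) / N := by ring
    rw [e, abs_div, abs_of_pos hNpos, div_le_iff₀ hNpos]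
    have hW' : (∑ i, x i) ^ 2 + (∑ i, y i) ^ 2 ≤ A * N := by
      rwa [← add_div, div_le_iff₀ hNpos] at hW
    calc _ ≤ |(∑ i, x' i) ^ 2 - (∑ i, x i) ^ 2| + |(∑ i, y' i) ^ 2 - (∑ i, y i) ^ 2| :=
          abs_add_le _ _
      _ ≤ δ * ((∑ i, x i) ^ 2 + (∑ i, y i) ^ 2) + (1 + 1 / δ) *
          ((∑ i, (x' i - x i)) ^ 2 + (∑ i, (y' i - y i)) ^ 2) := by linarith
      _ ≤ δ * (A * N) + (1 + 1 / δ) * (δ ^ 2 / 256 * N) := by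
          gcongr
          exact hD.trans (by gcongr)
      _ = (δ * A + (δ ^ 2 / 256 + δ / 256)) * N := by field_simp
      _ ≤ δ * (A + 1) * N := by gcongr; nlinarith
  have hA' : (∑ i, x' i) ^ 2 / N + (∑ i, y' i) ^ 2 / N ≤ A + 1 := by
    have := (abs_le.mp hWd).2
    linarith
  have hmax : ∀ z z' : Fin N → ℝ, (∀ i, z i ^ 4 ≤ a * N ^ 2) → (∀ i, (z' i - z i) ^ 2 ≤ a * N) →
      ∀ i, 8 * (1 + (A + 1)) * |z' i| ≤ δ * √N := by
    intro z z' hz hz' i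
    have e : z' i = z i + (z' i - z i) := by ring
    rw [e]
    refine max_bound _ _ (Real.sqrt_nonneg _) hb0 hb1 (by linarith) hbA ?_ ?_
    · rw [hs4]
      exact (hz i).trans (by gcongr)
    · rw [hs2]
      exact (hz' i).trans (by gcongr)
  have s4 : ∀ i, x i ^ 4 + y i ^ 4 ≤ a * N ^ 2 := fun i =>
    (Finset.single_le_sum (f := fun i => x i ^ 4 + y i ^ 4) (fun i _ => by positivity)
      (Finset.mem_univ i)).trans h4
  have sd : ∀ i, (x' i - x i) ^ 2 + (y' i - y i) ^ 2 ≤ a * N := fun i =>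
    (Finset.single_le_sum (f := fun i => (x' i - x i) ^ 2 + (y' i - y i) ^ 2)
      (fun i _ => by positivity) (Finset.mem_univ i)).trans hd
  have mx := hmax x x'
    (fun i => (le_add_of_nonneg_right (by positivity)).trans (s4 i))
    (fun i => (le_add_of_nonneg_right (by positivity)).trans (sd i))
  have my := hmax y y'
    (fun i => (le_add_of_nonneg_left (by positivity)).trans (s4 i))
    (fun i => (le_add_of_nonneg_left (by positivity)).trans (sd i))
  obtain ⟨g, hg, hg'⟩ := neg_two_log_empiricalLikelihoodRatio_approx hN x' y' hδ0 hδ k11 k12 k22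
    hA' hAN mx my
  refine ⟨g, hg, ?_⟩
  have := abs_sub_le g ((∑ i, x' i) ^ 2 / N + (∑ i, y' i) ^ 2 / N)
    ((∑ i, x i) ^ 2 / N + (∑ i, y i) ^ 2 / N)
  linarith

end Perturbation

/-! ### Wilks' theorem for normalized pairs, with perturbations. -/

section Master

theorem measure_ge_le_of_integral_le {Ω : Type*} [MeasurableSpace Ω] {P : Measure Ω}
    [IsProbabilityMeasure P] {f : Ω → ℝ} (hf0 : ∀ ω, 0 ≤ f ω) (hf : Integrable f P) {a c : ℝ}
    (ha : 0 < a) (hc : ∫ ω, f ω ∂P ≤ c) : P {ω | a ≤ f ω} ≤ ENNReal.ofReal (c / a) := by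
  have h := mul_meas_ge_le_integral_of_nonneg (Eventually.of_forall hf0) hf a
  rw [← ENNReal.ofReal_toReal (measure_ne_top P {ω | a ≤ f ω})]
  refine ENNReal.ofReal_le_ofReal ?_
  rw [le_div_iff₀ ha, mul_comm]
  exact h.trans hc

theorem integrable_sq_sum {Ω : Type*} [MeasurableSpace Ω] {P : Measure Ω} {N : ℕ}
    {ξ : Fin N → Ω → ℝ} (hξ : ∀ i, MemLp (ξ i) 2 P) :
    Integrable (fun ω => (∑ i, ξ i ω) ^ 2) P :=
  (memLp_finsetSum Finset.univ fun i _ => hξ i).integrable_sq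

theorem integral_sq_sum_le_of_indep {Ω : Type*} [MeasurableSpace Ω] {P : Measure Ω} {N : ℕ}
    {ξ : Fin N → Ω → ℝ} (hξ : ∀ i, MemLp (ξ i) 2 P) (hind : iIndepFun ξ P)
    (h0 : ∀ i, ∫ ω, ξ i ω ∂P = 0) {K : ℝ} (hK : ∀ i, ∫ ω, ξ i ω ^ 2 ∂P ≤ K) :
    ∫ ω, (∑ i, ξ i ω) ^ 2 ∂P ≤ N * K := by
  have hint : ∀ i j, Integrable (fun ω => ξ i ω * ξ j ω) P := fun i j =>
    (hξ i).integrable_mul (hξ j)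
  have e : ∀ ω, (∑ i, ξ i ω) ^ 2 = ∑ i, ∑ j, ξ i ω * ξ j ω := fun ω => by
    rw [sq, Finset.sum_mul_sum]
  simp only [e]
  rw [integral_finsetSum _ fun i _ => integrable_finsetSum _ fun j _ => hint i j]
  calc _ ≤ ∑ _i : Fin N, K := Finset.sum_le_sum fun i _ => by
        rw [integral_finsetSum _ fun j _ => hint i j, Finset.sum_eq_single i]
        · simpa only [← sq] using hK i
        · intro j _ hj
          rw [(hind.indepFun hj.symm).integral_fun_mul_eq_mul_integral
            (hξ i).aestronglyMeasurable (hξ j).aestronglyMeasurable, h0, zero_mul]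
        · simp
    _ = N * K := by simp

theorem MeasureTheory.MemLp.mul_of_memLp_four {Ω : Type*} [MeasurableSpace Ω] {P : Measure Ω} {z w : Ω → ℝ} (hz : MemLp z 4 P) (hw : MemLp w 4 P) :
    MemLp (fun ω => z ω * w ω) 2 P := by
  refine (memLp_two_iff_integrable_sq
    (hz.aestronglyMeasurable.mul hw.aestronglyMeasurable)).mpr ?_
  refine ((hz.integrable_pow_four).add (hw.integrable_pow_four)).mono'
    ((hz.aestronglyMeasurable.mul hw.aestronglyMeasurable).pow 2) (Eventually.of_forall fun ω => ?_)
  simp only [Pi.mul_apply, Pi.add_apply, norm_pow, Real.norm_eq_abs, sq_abs]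
  nlinarith [sq_nonneg (z ω ^ 2 - w ω ^ 2), sq_nonneg (z ω ^ 2 + w ω ^ 2)]

theorem integral_sum_sq_sub_le_of_indep {Ω : Type*} [MeasurableSpace Ω] {P : Measure Ω}
    [IsProbabilityMeasure P] {N : ℕ} {K : ℝ} {z : Fin N → Ω → ℝ} (hz : ∀ i, MemLp (z i) 4 P)
    (hind : iIndepFun z P) (h2 : ∀ i, ∫ ω, z i ω ^ 2 ∂P = 1)
    (h4 : ∀ i, ∫ ω, z i ω ^ 4 ∂P ≤ K) :
    ∫ ω, (∑ i, (z i ω ^ 2 - 1)) ^ 2 ∂P ≤ N * K ∧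
      ∀ i, MemLp (fun ω => z i ω ^ 2 - 1) 2 P := by
  have hL : ∀ i, MemLp (fun ω => z i ω ^ 2) 2 P := fun i => by
    simpa only [← sq] using (hz i).mul_of_memLp_four (hz i)
  have hL' : ∀ i, MemLp (fun ω => z i ω ^ 2 - 1) 2 P := fun i => (hL i).sub (memLp_const 1)
  refine ⟨integral_sq_sum_le_of_indep hL'
    (hind.comp (fun _ t => t ^ 2 - 1) fun _ => by fun_prop) (fun i => ?_) fun i => ?_, hL'⟩
  · rw [integral_sub ((hL i).integrable (by norm_num)) (integrable_const _), h2]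
    simp
  · have e : ∀ ω, (z i ω ^ 2 - 1) ^ 2 = z i ω ^ 4 - 2 * z i ω ^ 2 + 1 := fun ω => by ring
    have i4 := (hz i).integrable_pow_four
    have i2 : Integrable (fun ω => z i ω ^ 2) P := (hL i).integrable (by norm_num)
    simp only [e]
    rw [integral_add (i4.sub' (i2.const_mul 2)) (integrable_const _),
      integral_sub i4 (i2.const_mul 2), integral_const_mul, h2]
    simp
    linarith [h4 i]

namespace NormalizedPairs

variable {Ω : Type*} [MeasurableSpace Ω] {P : Measure Ω} [IsProbabilityMeasure P] {N : ℕ}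
  {x y : Fin N → Ω → ℝ} {K : ℝ} (h : NormalizedPairs P x y K)
include h

theorem memLp_two_fst (i : Fin N) : MemLp (x i) 2 P := (h.memLp_fst i).mono_exponent (by norm_num)

theorem memLp_two_snd (i : Fin N) : MemLp (y i) 2 P := (h.memLp_snd i).mono_exponent (by norm_num)

theorem integral_sq_norm_le :
    ∫ ω, ((∑ i, x i ω) ^ 2 + (∑ i, y i ω) ^ 2) ∂P ≤ 2 * N := by
  rw [integral_add (integrable_sq_sum h.memLp_two_fst) (integrable_sq_sum h.memLp_two_snd)]
  have h1 := integral_sq_sum_le_of_indep h.memLp_two_fst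
    (h.indep.comp (fun _ => Prod.fst) fun _ => _root_.measurable_fst) h.mean_fst
    (fun i => (h.second_fst i).le)
  have h2 := integral_sq_sum_le_of_indep h.memLp_two_snd
    (h.indep.comp (fun _ => Prod.snd) fun _ => _root_.measurable_snd) h.mean_snd
    (fun i => (h.second_snd i).le)
  linarith

theorem integral_sum_pow_four_le :
    ∫ ω, ∑ i, (x i ω ^ 4 + y i ω ^ 4) ∂P ≤ N * (2 * K) := by
  have ix := fun i => (h.memLp_fst i).integrable_pow_four
  have iy := fun i => (h.memLp_snd i).integrable_pow_four
  rw [integral_finsetSum _ fun i _ => (ix i).fun_add (iy i)]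
  calc _ ≤ ∑ _i : Fin N, 2 * K := Finset.sum_le_sum fun i _ => by
        rw [integral_add (ix i) (iy i)]
        linarith [h.fourth_fst i, h.fourth_snd i]
    _ = _ := by simp

theorem integral_sum_mul_sq_le : ∫ ω, (∑ i, x i ω * y i ω) ^ 2 ∂P ≤ N * K := by
  refine integral_sq_sum_le_of_indep (fun i => (h.memLp_fst i).mul_of_memLp_four (h.memLp_snd i))
    (h.indep.comp (fun _ z => z.1 * z.2) fun _ => by fun_prop) h.cov fun i => ?_
  have ix := (h.memLp_fst i).integrable_pow_four
  have iy := (h.memLp_snd i).integrable_pow_four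
  calc ∫ ω, (x i ω * y i ω) ^ 2 ∂P ≤ ∫ ω, (x i ω ^ 4 / 2 + y i ω ^ 4 / 2) ∂P :=
        integral_mono ((h.memLp_fst i).mul_of_memLp_four (h.memLp_snd i)).integrable_sq
          ((ix.div_const 2).fun_add (iy.div_const 2))
          fun ω => by simp only; nlinarith [sq_nonneg (x i ω ^ 2 - y i ω ^ 2)]
    _ ≤ K := by
        rw [integral_add (ix.div_const 2) (iy.div_const 2), integral_div, integral_div]
        linarith [h.fourth_fst i, h.fourth_snd i]

end NormalizedPairs

end Master

theorem measure_union_le_ofReal_add {Ω : Type*} [MeasurableSpace Ω] {P : Measure Ω} {U V : Set Ω}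
    {u v : ℝ} (hu : 0 ≤ u) (hv : 0 ≤ v) (hU : P U ≤ ENNReal.ofReal u)
    (hV : P V ≤ ENNReal.ofReal v) : P (U ∪ V) ≤ ENNReal.ofReal (u + v) := by
  rw [ENNReal.ofReal_add hu hv]
  exact (measure_union_le _ _).trans (add_le_add hU hV)

namespace NormalizedPairs

/-- Markov's inequality for seven events: a large normalized sum (`2 / A`), three deviations of
second moments (`K / (a² N)` each), a large sum of fourth powers (`2K / (a N)`), and large
perturbations, individually and summed (`2ε / a` each). -/
theorem exists_exceptional_set {Ω : Type*} [MeasurableSpace Ω] {P : Measure Ω}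
    [IsProbabilityMeasure P] {N : ℕ} {x y x' y' : Fin N → Ω → ℝ} {K ε : ℝ}
    (h : NormalizedPairs P x y K) (hN : 0 < N)
    (hx' : ∀ i, MemLp (fun ω => x' i ω - x i ω) 2 P)
    (hy' : ∀ i, MemLp (fun ω => y' i ω - y i ω) 2 P)
    (hx : ∀ i, ∫ ω, (x' i ω - x i ω) ^ 2 ∂P ≤ ε) (hy : ∀ i, ∫ ω, (y' i ω - y i ω) ^ 2 ∂P ≤ ε)
    (hX : ∫ ω, (∑ i, (x' i ω - x i ω)) ^ 2 ∂P ≤ N * ε)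
    (hY : ∫ ω, (∑ i, (y' i ω - y i ω)) ^ 2 ∂P ≤ N * ε)
    {δ A a b : ℝ} (hδ0 : 0 < δ) (hδ : δ ≤ 1 / 20) (hA : 0 < A) (hδA : δ * (A + 1) ≤ 1)
    (hb0 : 0 ≤ b) (hb1 : b ≤ 1) (hbA : 16 * (1 + (A + 1)) * b ≤ δ) (ha0 : 0 < a)
    (ha : a ≤ δ ^ 2 / 256) (hab : a ≤ b ^ 4) (hAN : (A + 1) / N ≤ δ) :
    ∃ B, P B ≤ ENNReal.ofReal (2 / A + (3 * K / a ^ 2 + 2 * K / a) / N + 4 * ε / a) ∧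
      ∀ ω ∉ B, ∃ g : ℝ,
        (-2 : EReal) * ENNReal.log (empiricalLikelihoodRatio (fun i => (x' i ω, y' i ω)))
          = (g : EReal) ∧
        |g - ((∑ i, x i ω) ^ 2 / N + (∑ i, y i ω) ^ 2 / N)| ≤ 21 * δ * (A + 1) := by
  have hNpos : (0 : ℝ) < N := by exact_mod_cast hN
  have hK : 0 ≤ K := (integral_nonneg fun ω => by positivity).trans (h.fourth_fst ⟨0, hN⟩)
  have hε : 0 ≤ ε := (integral_nonneg fun ω => by positivity).trans (hx ⟨0, hN⟩)
  obtain ⟨q11, m11⟩ := integral_sum_sq_sub_le_of_indep h.memLp_fst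
    (h.indep.comp (fun _ => Prod.fst) fun _ => _root_.measurable_fst) h.second_fst h.fourth_fst
  obtain ⟨q22, m22⟩ := integral_sum_sq_sub_le_of_indep h.memLp_snd
    (h.indep.comp (fun _ => Prod.snd) fun _ => _root_.measurable_snd) h.second_snd h.fourth_snd
  have ix := fun i => (h.memLp_fst i).integrable_pow_four
  have iy := fun i => (h.memLp_snd i).integrable_pow_four
  have e1 := measure_ge_le_of_integral_le (a := A * N) (fun ω => by positivity)
    ((integrable_sq_sum h.memLp_two_fst).fun_add (integrable_sq_sum h.memLp_two_snd))
    (by positivity) h.integral_sq_norm_le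
  have e2 := measure_ge_le_of_integral_le (a := (a * N) ^ 2) (fun ω => sq_nonneg _)
    (integrable_sq_sum m11) (by positivity) q11
  have e3 := measure_ge_le_of_integral_le (a := (a * N) ^ 2) (fun ω => sq_nonneg _)
    (integrable_sq_sum fun i => (h.memLp_fst i).mul_of_memLp_four (h.memLp_snd i))
    (by positivity) h.integral_sum_mul_sq_le
  have e4 := measure_ge_le_of_integral_le (a := (a * N) ^ 2) (fun ω => sq_nonneg _)
    (integrable_sq_sum m22) (by positivity) q22
  have e5 := measure_ge_le_of_integral_le (a := a * N ^ 2)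
    (fun ω => Finset.sum_nonneg fun i _ => by positivity)
    (integrable_finsetSum _ fun i _ => (ix i).fun_add (iy i))
    (by positivity) h.integral_sum_pow_four_le
  have jx := fun i => (hx' i).integrable_sq
  have jy := fun i => (hy' i).integrable_sq
  have q6 : ∫ ω, ∑ i, ((x' i ω - x i ω) ^ 2 + (y' i ω - y i ω) ^ 2) ∂P ≤ N * (2 * ε) := by
    rw [integral_finsetSum _ fun i _ => (jx i).fun_add (jy i)]
    calc _ ≤ ∑ _i : Fin N, 2 * ε := Finset.sum_le_sum fun i _ => by
          rw [integral_add (jx i) (jy i)]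
          linarith [hx i, hy i]
      _ = _ := by simp
  have e6 := measure_ge_le_of_integral_le (a := a * N)
    (fun ω => Finset.sum_nonneg fun i _ => by positivity)
    (integrable_finsetSum _ fun i _ => (jx i).fun_add (jy i)) (by positivity) q6
  have q7 : ∫ ω, ((∑ i, (x' i ω - x i ω)) ^ 2 + (∑ i, (y' i ω - y i ω)) ^ 2) ∂P ≤
      N * (2 * ε) := by
    rw [integral_add (integrable_sq_sum hx') (integrable_sq_sum hy')]
    linarith
  have e7 := measure_ge_le_of_integral_le (a := a * N) (fun ω => by positivity)
    ((integrable_sq_sum hx').fun_add (integrable_sq_sum hy')) (by positivity) q7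
  have u := measure_union_le_ofReal_add (by positivity) (by positivity) e1
    (measure_union_le_ofReal_add (by positivity) (by positivity) e2
    (measure_union_le_ofReal_add (by positivity) (by positivity) e3
    (measure_union_le_ofReal_add (by positivity) (by positivity) e4
    (measure_union_le_ofReal_add (by positivity) (by positivity) e5
    (measure_union_le_ofReal_add (by positivity) (by positivity) e6 e7)))))
  refine ⟨_, u.trans (ENNReal.ofReal_le_ofReal (le_of_eq ?_)), fun ω hω => ?_⟩
  · field_simp
    ring
  simp only [Set.mem_union, Set.mem_ofPred_eq, not_or, not_le] at hω
  obtain ⟨w1, w2, w3, w4, w5, w6, w7⟩ := hω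
  have hdev : ∀ s : ℝ, s ^ 2 < (a * N) ^ 2 → |s / N| ≤ a := fun s hs => by
    rw [abs_div, abs_of_pos hNpos, div_le_iff₀ hNpos]
    exact (abs_lt_of_sq_lt_sq hs (by positivity)).le
  have hsub : ∀ z : Fin N → ℝ, (∑ i, (z i ^ 2 - 1)) / N = (∑ i, z i ^ 2) / N - 1 := fun z => by
    simp [Finset.sum_sub_distrib, sub_div, div_self hNpos.ne']
  refine neg_two_log_empiricalLikelihoodRatio_perturbed hN (fun i => x i ω) (fun i => y i ω)
    (fun i => x' i ω) (fun i => y' i ω) hδ0 hδ hA.le hδA hb0 hb1 hbA ha0.le ha hab hAN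
    ?_ (hdev _ w3) ?_ ?_ w5.le w6.le w7.le
  · rw [← hsub]; exact hdev _ w2
  · rw [← hsub]; exact hdev _ w4
  · rw [← add_div, div_le_iff₀ hNpos]
    exact w1.le

end NormalizedPairs

/-- Wilks' theorem for the empirical likelihood of normalized uncorrelated pairs, stable under
perturbations that are small in mean square. -/
theorem tendstoInDistribution_neg_two_log_empiricalLikelihoodRatio {Ω : ℕ → Type*}
    [∀ n, MeasurableSpace (Ω n)] {P : ∀ n, Measure (Ω n)} [∀ n, IsProbabilityMeasure (P n)]
    {N : ℕ → ℕ} (hN : Tendsto N atTop atTop) {x y x' y' : ∀ n, Fin (N n) → Ω n → ℝ} {K : ℝ}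
    {ε : ℕ → ℝ} (hε : Tendsto ε atTop (𝓝 0)) (h : ∀ n, NormalizedPairs (P n) (x n) (y n) K)
    (mx : ∀ n i, Measurable (x' n i)) (my : ∀ n i, Measurable (y' n i))
    (hx' : ∀ n i, MemLp (fun ω => x' n i ω - x n i ω) 2 (P n))
    (hy' : ∀ n i, MemLp (fun ω => y' n i ω - y n i ω) 2 (P n))
    (hx : ∀ n i, ∫ ω, (x' n i ω - x n i ω) ^ 2 ∂(P n) ≤ ε n)
    (hy : ∀ n i, ∫ ω, (y' n i ω - y n i ω) ^ 2 ∂(P n) ≤ ε n)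
    (hX : ∀ n, ∫ ω, (∑ i, (x' n i ω - x n i ω)) ^ 2 ∂(P n) ≤ N n * ε n)
    (hY : ∀ n, ∫ ω, (∑ i, (y' n i ω - y n i ω)) ^ 2 ∂(P n) ≤ N n * ε n) :
    TendstoInDistribution (fun n ω => (-2 : EReal) * ENNReal.log
      (empiricalLikelihoodRatio fun i => (x' n i ω, y' n i ω)))
      atTop (fun t : ℝ => (t : EReal)) P (chiSquare 2) := by
  refine tendstoInDistribution_of_close (tendstoInDistribution_normalizedSum hN h)
    (fun n => measurable_neg_two_log_empiricalLikelihoodRatio fun i => (mx n i).prodMk (my n i))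
    fun η hη θ hθ => ?_
  -- Makes `2 / A = θ / 2`; the other half of `θ` covers the terms that tend to zero. After `A` come
  -- `δ` (accuracy), `b` (maximum) and `a` (all deviations), each depending on the previous ones but
  -- not on `n`.
  set A : ℝ := 4 / θ with hA
  have hA0 : 0 < A := by positivity
  set δ : ℝ := min (1 / 20) (min (η / (21 * (A + 1))) (1 / (A + 1))) with hδ
  have hδ0 : 0 < δ := by positivity
  have hδ1 : δ ≤ 1 / 20 := min_le_left _ _
  have hδ2 : 21 * δ * (A + 1) ≤ η := by
    have : δ ≤ η / (21 * (A + 1)) := (min_le_right _ _).trans (min_le_left _ _)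
    rw [le_div_iff₀ (by positivity)] at this
    linarith
  have hδ3 : δ * (A + 1) ≤ 1 := by
    have : δ ≤ 1 / (A + 1) := (min_le_right _ _).trans (min_le_right _ _)
    rwa [le_div_iff₀ (by positivity)] at this
  set b : ℝ := min 1 (δ / (16 * (1 + (A + 1)))) with hb
  have hb0 : 0 < b := by positivity
  have hbA : 16 * (1 + (A + 1)) * b ≤ δ := by
    have : b ≤ δ / (16 * (1 + (A + 1))) := min_le_right _ _
    rw [le_div_iff₀ (by positivity)] at this
    linarith
  set a : ℝ := min (δ ^ 2 / 256) (b ^ 4) with ha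
  have ha0 : 0 < a := by positivity
  have hNr : Tendsto (fun n => (N n : ℝ)) atTop atTop := tendsto_natCast_atTop_atTop.comp hN
  have t1 : Tendsto (fun n => (A + 1) / (N n : ℝ)) atTop (𝓝 0) := tendsto_const_nhds.div_atTop hNr
  have t2 : Tendsto (fun n => 2 / A + (3 * K / a ^ 2 + 2 * K / a) / (N n : ℝ) + 4 * ε n / a)
      atTop (𝓝 (2 / A + 0 + 4 * 0 / a)) :=
    (tendsto_const_nhds.add (tendsto_const_nhds.div_atTop hNr)).add
      ((hε.const_mul 4).div_const a)
  have hlim : 2 / A + 0 + 4 * 0 / a < θ := by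
    rw [hA]
    field_simp
    nlinarith [mul_pos hθ ha0]
  filter_upwards [hN.eventually_gt_atTop 0, t1.eventually_le_const hδ0,
    t2.eventually_le_const hlim] with n hn h1 h2
  obtain ⟨B, hB, hB'⟩ := (h n).exists_exceptional_set hn (hx' n) (hy' n) (hx n) (hy n) (hX n) (hY n)
    hδ0 hδ1 hA0 hδ3 hb0.le (min_le_left _ _) hbA ha0 (min_le_left _ _) (min_le_right _ _) h1
  refine ⟨B, hB.trans (ENNReal.ofReal_le_ofReal h2), fun ω hω => ?_⟩
  obtain ⟨g, hg, hg'⟩ := hB' ω hω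
  exact ⟨g, hg, hg'.trans hδ2⟩

/-! ### Two independent samples, and all observations as one vector. -/

section Samples

variable {Ω : Type*} [MeasurableSpace Ω] {P : Measure Ω} [IsProbabilityMeasure P]

/-- The joint law is a product of two product measures; regrouping its coordinates makes it the
product of the laws of the pairs. -/
theorem iIndepFun_prodMk_of_indepFun {ι E F : Type*} [Fintype ι] [MeasurableSpace E]
    [MeasurableSpace F] {X : ι → Ω → E} {Y : ι → Ω → F} (mX : ∀ i, Measurable (X i))
    (mY : ∀ i, Measurable (Y i)) (hX : iIndepFun X P) (hY : iIndepFun Y P)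
    (hXY : IndepFun (fun ω i => X i ω) (fun ω i => Y i ω) P) :
    iIndepFun (fun i ω => (X i ω, Y i ω)) P := by
  have mX' : Measurable fun ω i => X i ω := measurable_pi_lambda _ mX
  have mY' : Measurable fun ω i => Y i ω := measurable_pi_lambda _ mY
  have := fun i => Measure.isProbabilityMeasure_map (mX i).aemeasurable (μ := P)
  have := fun i => Measure.isProbabilityMeasure_map (mY i).aemeasurable (μ := P)
  rw [iIndepFun_iff_map_fun_eq_pi_map fun i => ((mX i).prodMk (mY i)).aemeasurable]
  have e : ∀ i, P.map (fun ω => (X i ω, Y i ω)) = (P.map (X i)).prod (P.map (Y i)) := fun i =>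
    (indepFun_iff_map_prod_eq_prod_map_map (mX i).aemeasurable (mY i).aemeasurable).mp
      (hXY.comp (measurable_pi_apply i) (measurable_pi_apply i))
  simp only [e]
  have hmp := (measurePreserving_arrowProdEquivProdArrow E F ι (fun i => P.map (X i))
    fun i => P.map (Y i)).symm
  rw [← hmp.map_eq, ← hX.map_fun_eq_pi_map fun i => (mX i).aemeasurable,
    ← hY.map_fun_eq_pi_map fun i => (mY i).aemeasurable,
    ← (indepFun_iff_map_prod_eq_prod_map_map mX'.aemeasurable mY'.aemeasurable).mp hXY,
    Measure.map_map hmp.measurable (mX'.prodMk mY')]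
  rfl

variable {J L : Type*} [Fintype J] [Fintype L]

/-- The coordinates of the random vectors `z j`, as one family. -/
def stacked (z : J → Ω → L → ℝ) (x : J × L) (ω : Ω) : ℝ := z x.1 ω x.2

/-- Statistics centered at the sample mean involve all observations at once. Stacking brings them
under the moment bounds for a single vector: independence factorizes over observations, and the
assumption then factorizes within each. -/
theorem HasFactorizedMoments.stacked {z : J → Ω → L → ℝ} {Δ C : ℝ}
    (h : ∀ j, HasFactorizedMoments P (fun k ω => z j ω k) Δ C) (hind : iIndepFun z P) :
    HasFactorizedMoments P (stacked z) Δ C where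
  measurable x := (h x.1).measurable x.2
  memLp_eight x := (h x.1).memLp_eight x.2
  mean_zero x := (h x.1).mean_zero x.2
  second_moment x := (h x.1).second_moment x.2
  fourth_moment x := (h x.1).fourth_moment x.2
  eighth_moment_le x := (h x.1).eighth_moment_le x.2
  factorization l hl := by
    rw [Fintype.sum_prod_type] at hl
    simp only [Fintype.prod_prod_type, _root_.stacked]
    rw [hind.integral_fun_prod_comp (f := fun j (u : L → ℝ) => ∏ k, u k ^ l (j, k))
      (fun j => (measurable_pi_lambda _ (h j).measurable).aemeasurable)
      fun j => (Finset.measurable_fun_prod _ fun k _ =>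
        (measurable_pi_apply k).pow_const _).aestronglyMeasurable]
    refine Finset.prod_congr rfl fun j _ => (h j).factorization (fun k => l (j, k)) ?_
    exact (Finset.single_le_sum (f := fun j => ∑ k, l (j, k)) (fun _ _ => Nat.zero_le _)
      (Finset.mem_univ j)).trans hl

/-- Two independent samples of independent random vectors with factorized moments. -/
structure IndependentSamples (P : Measure Ω) (z z' : J → Ω → L → ℝ) (Δ C : ℝ) : Prop where
  moments_fst : ∀ j, HasFactorizedMoments P (fun k ω => z j ω k) Δ C
  moments_snd : ∀ j, HasFactorizedMoments P (fun k ω => z' j ω k) Δ C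
  indep_fst : iIndepFun z P
  indep_snd : iIndepFun z' P
  indep : IndepFun (fun ω j => z j ω) (fun ω j => z' j ω) P

namespace IndependentSamples

variable {z z' : J → Ω → L → ℝ} {Δ C : ℝ} (h : IndependentSamples P z z' Δ C)
include h

theorem measurable_fst (j : J) : Measurable (z j) :=
  measurable_pi_lambda _ (h.moments_fst j).measurable

theorem measurable_snd (j : J) : Measurable (z' j) :=
  measurable_pi_lambda _ (h.moments_snd j).measurable

theorem indep_pairs : iIndepFun (fun j ω => (z j ω, z' j ω)) P :=
  iIndepFun_prodMk_of_indepFun h.measurable_fst h.measurable_snd h.indep_fst h.indep_snd h.indep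

theorem indepFun_single (j : J) : IndepFun (fun ω k => z j ω k) (fun ω k => z' j ω k) P :=
  h.indep.comp (measurable_pi_apply j) (measurable_pi_apply j)

theorem indepFun_stacked :
    IndepFun (fun ω x => stacked z x ω) (fun ω x => stacked z' x ω) P :=
  h.indep.comp (φ := fun (u : J → L → ℝ) (x : J × L) => u x.1 x.2)
    (ψ := fun (u : J → L → ℝ) (x : J × L) => u x.1 x.2)
    (measurable_pi_lambda _ fun x => by fun_prop) (measurable_pi_lambda _ fun x => by fun_prop)

end IndependentSamples

end Samples

theorem firstHalf_injective {n : ℕ} : Function.Injective (firstHalf (n := n)) := fun i j hij => by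
  simpa [firstHalf, Fin.ext_iff] using hij

theorem secondHalf_injective {n : ℕ} : Function.Injective (secondHalf (n := n)) := fun i j hij => by
  simpa [secondHalf, Fin.ext_iff] using hij

theorem firstHalf_ne_secondHalf {n : ℕ} (i j : Fin (n / 2)) : firstHalf i ≠ secondHalf j := by
  simp only [firstHalf, secondHalf, ne_eq, Fin.ext_iff]
  omega

namespace MultivariateModel

variable {Ω : Type*} [MeasurableSpace Ω] {P : Measure Ω} [IsProbabilityMeasure P] {n p m : ℕ}
  {X : Fin n → Ω → Fin p → ℝ} {Γ : Matrix (Fin p) (Fin m) ℝ} {Z : Fin n → Ω → Fin m → ℝ}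
  {μ : Fin p → ℝ} {S : Matrix (Fin p) (Fin p) ℝ} {Δ C : ℝ} (h : MultivariateModel P X Γ Z μ S Δ C)
include h

theorem hasFactorizedMoments (i : Fin n) :
    HasFactorizedMoments P (fun k ω => Z i ω k) Δ C where
  measurable k := (measurable_pi_apply k).comp (h.measurable i)
  memLp_eight := h.memLp_eight i
  mean_zero := h.mean_zero i
  second_moment k := by
    have h2 : MemLp (fun ω => Z i ω k) 2 P := (h.memLp_eight i k).mono_exponent (by norm_num)
    have := h.cov_one i k k
    rw [covariance_eq_sub h2 h2, h.mean_zero, Matrix.one_apply_eq, zero_mul, sub_zero] at this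
    simpa only [sq, Pi.mul_apply] using this
  fourth_moment := h.fourth_moment i
  eighth_moment_le := h.eighth_moment_le i
  factorization := h.moment_factorization i

theorem independentSamples : IndependentSamples P (fun i : Fin (n / 2) => Z (firstHalf i))
    (fun i => Z (secondHalf i)) Δ C where
  moments_fst i := h.hasFactorizedMoments _
  moments_snd i := h.hasFactorizedMoments _
  indep_fst := h.indep.precomp firstHalf_injective
  indep_snd := h.indep.precomp secondHalf_injective
  indep := by
    classical
    have hd : Disjoint (Finset.univ.image (firstHalf (n := n)))
        (Finset.univ.image (secondHalf (n := n))) := by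
      rw [Finset.disjoint_left]
      intro a ha hb
      obtain ⟨i, -, rfl⟩ := Finset.mem_image.mp ha
      obtain ⟨j, -, hj⟩ := Finset.mem_image.mp hb
      exact firstHalf_ne_secondHalf i j hj.symm
    exact (h.indep.indepFun_finset _ _ hd h.measurable).comp
      (φ := fun u i => u ⟨firstHalf i, Finset.mem_image_of_mem _ (Finset.mem_univ i)⟩)
      (ψ := fun u i => u ⟨secondHalf i, Finset.mem_image_of_mem _ (Finset.mem_univ i)⟩)
      (measurable_pi_lambda _ fun i => measurable_pi_apply _)
      (measurable_pi_lambda _ fun i => measurable_pi_apply _)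

end MultivariateModel

/-! ### The estimating pair in terms of the latent vectors. -/

section Algebra

variable {L : Type*} [Fintype L] [DecidableEq L]

/-- The entries of `y yᵀ - c I`. -/
def centeredSquare (c : ℝ) (y : L → ℝ) (l : L × L) : ℝ :=
  y l.1 * y l.2 - if l.1 = l.2 then c else 0

/-- The Kronecker square of a matrix. -/
def kroneckerSq (B : Matrix L L ℝ) (l k : L × L) : ℝ := B l.1 k.1 * B l.2 k.2

/-- The quadratic form `bᵀ (y yᵀ - c I) b`. -/
def sumForm (b : L → ℝ) (c : ℝ) (y : L → ℝ) : ℝ :=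
  ∑ l : L × L, b l.1 * b l.2 * centeredSquare c y l

/-- The form `tr ((y yᵀ - c I) B (y' y'ᵀ - c I) Bᵀ)`. -/
def traceForm (B : Matrix L L ℝ) (c : ℝ) (y y' : L → ℝ) : ℝ :=
  ∑ l : L × L, (∑ k : L × L, kroneckerSq B l k * centeredSquare c y' k) * centeredSquare c y l

theorem centeredSquare_eq (c : ℝ) (y : L → ℝ) (l : L × L) :
    centeredSquare c y l = (vecMulVec y y - c • (1 : Matrix L L ℝ)) l.1 l.2 := by
  simp [centeredSquare, vecMulVec_apply, Matrix.one_apply]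

/-- Both matrices have the form `Γ (y yᵀ - c I) Γᵀ`. Cyclicity of the trace turns `Γ` into the Gram
matrix `ΓᵀΓ`, and the vector of ones is absorbed into `Γᵀ1`. -/
theorem estimatingPair_eq {p : ℕ} (Γ : Matrix (Fin p) L ℝ) (c : ℝ) (y y' : L → ℝ) :
    estimatingPair (vecMulVec (Γ *ᵥ y) (Γ *ᵥ y)) (vecMulVec (Γ *ᵥ y') (Γ *ᵥ y'))
      (c • (Γ * Γᵀ)) =
    (traceForm (Γᵀ * Γ) c y y', sumForm (Γᵀ *ᵥ 1) c y + sumForm (Γᵀ *ᵥ 1) c y') := by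
  have hy : ∀ y : L → ℝ, vecMulVec (Γ *ᵥ y) (Γ *ᵥ y) - c • (Γ * Γᵀ) =
      Γ * (vecMulVec y y - c • (1 : Matrix L L ℝ)) * Γᵀ := fun y => by
    rw [Matrix.mul_sub, Matrix.sub_mul, Matrix.mul_vecMulVec, Matrix.vecMulVec_mul,
      Matrix.mul_smul, Matrix.smul_mul, Matrix.mul_one, Matrix.vecMul_transpose]
  have hs : ∀ M : Matrix L L ℝ, (1 : Fin p → ℝ) ⬝ᵥ ((Γ * M * Γᵀ) *ᵥ 1) =
      ∑ l : L × L, (Γᵀ *ᵥ 1) l.1 * (Γᵀ *ᵥ 1) l.2 * M l.1 l.2 := fun M => by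
    rw [← Matrix.mulVec_mulVec, ← Matrix.mulVec_mulVec, Matrix.dotProduct_mulVec,
      ← Matrix.mulVec_transpose, Fintype.sum_prod_type]
    simp only [dotProduct, Matrix.mulVec, Finset.mul_sum]
    refine Finset.sum_congr rfl fun i _ => Finset.sum_congr rfl fun j _ => ?_
    simp only [← Finset.mul_sum]
    ring
  have ht : ∀ (B M M' : Matrix L L ℝ), Bᵀ = B → M'ᵀ = M' →
      trace (M * B * (M' * B)) =
      ∑ l : L × L, (∑ k : L × L, kroneckerSq B l k * M' k.1 k.2) * M l.1 l.2 := by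
    intro B M M' hB hM
    have hB' : ∀ i j, B i j = B j i := fun i j => by rw [← Matrix.transpose_apply B, hB]
    have hM' : ∀ i j, M' i j = M' j i := fun i j => by rw [← Matrix.transpose_apply M', hM]
    simp only [trace, Matrix.diag_apply, Fintype.sum_prod_type, kroneckerSq]
    refine Finset.sum_congr rfl fun i _ => ?_
    rw [Matrix.mul_assoc, Matrix.mul_apply]
    refine Finset.sum_congr rfl fun j _ => ?_
    rw [mul_comm, Matrix.mul_apply]
    simp only [Matrix.mul_apply, Finset.mul_sum]
    rw [Finset.sum_comm]
    congr 1
    refine Finset.sum_congr rfl fun b _ => Finset.sum_congr rfl fun a _ => ?_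
    rw [hM' a b, hB' b i]
    ring
  have h2 : ∀ A A' M : Matrix (Fin p) (Fin p) ℝ, A + A' - (2 : ℝ) • M = (A - M) + (A' - M) := by
    intro A A' M
    rw [two_smul]; abel
  rw [estimatingPair, h2, hy, hy, Matrix.add_mulVec, dotProduct_add, hs, hs]
  simp only [traceForm, sumForm, centeredSquare_eq]
  rw [← ht _ _ _ (by rw [Matrix.transpose_mul, Matrix.transpose_transpose]) (by
    rw [Matrix.transpose_sub, Matrix.transpose_smul, Matrix.transpose_one,
      Matrix.transpose_vecMulVec])]
  congr 1
  simp only [Matrix.mul_assoc]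
  rw [Matrix.trace_mul_comm]
  simp only [Matrix.mul_assoc]

end Algebra

/-! ### Statistics of weighted sums as forms in the stacked vectors. -/

section Lifts

variable {J L : Type*} [Fintype J] [Fintype L] [DecidableEq J] [DecidableEq L]

/-- The tensor square of a vector. -/
def tensorSq {κ : Type*} (w : κ → ℝ) (a : κ × κ) : ℝ := w a.1 * w a.2

theorem sum_tensorSq_mul {κ : Type*} [Fintype κ] (w w' : κ → ℝ) :
    ∑ a, tensorSq w a * tensorSq w' a = (∑ a, w a * w' a) ^ 2 := by
  rw [sq, Finset.sum_mul_sum, Fintype.sum_prod_type]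
  refine Finset.sum_congr rfl fun i _ => Finset.sum_congr rfl fun j _ => ?_
  simp only [tensorSq]
  ring

/-- The coefficients of a quadratic form in stacked vectors, with weights `W` on the vectors. -/
def liftCoeff (W : J × J → ℝ) (D : L × L → ℝ) (α : (J × L) × (J × L)) : ℝ :=
  W (α.1.1, α.2.1) * D (α.1.2, α.2.2)

/-- The coefficients of a biquadratic form in stacked vectors, with weights `W` on the vectors. -/
def biliftCoeff (W : (J × J) × (J × J) → ℝ) (D : L × L → L × L → ℝ) (α β : (J × L) × (J × L)) :
    ℝ :=
  W ((α.1.1, α.2.1), (β.1.1, β.2.1)) * D (α.1.2, α.2.2) (β.1.2, β.2.2)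

theorem sum_prod_prod_comm (f : J × J → L × L → ℝ) :
    ∑ α : (J × L) × (J × L), f (α.1.1, α.2.1) (α.1.2, α.2.2) = ∑ a, ∑ l, f a l := by
  rw [← Fintype.sum_prod_type']
  exact Fintype.sum_equiv (Equiv.prodProdProdComm J L J L) _ _ fun _ => rfl

theorem sum_liftCoeff_sq (W : J × J → ℝ) (D : L × L → ℝ) :
    ∑ α, liftCoeff W D α ^ 2 = (∑ a, W a ^ 2) * ∑ l, D l ^ 2 := by
  simp only [liftCoeff]
  rw [sum_prod_prod_comm fun a l => (W a * D l) ^ 2, Finset.sum_mul_sum]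
  simp only [mul_pow]

/-- Coefficient norms are multiplicative, so the effect of centering is governed by the weight
tensor alone, whatever `D` is. -/
theorem sum_biliftCoeff_sq (W : (J × J) × (J × J) → ℝ) (D : L × L → L × L → ℝ) :
    ∑ α, ∑ β, biliftCoeff W D α β ^ 2 = (∑ a, W a ^ 2) * ∑ l, ∑ k, D l k ^ 2 := by
  have e : ∀ α, ∑ β, biliftCoeff W D α β ^ 2 =
      (∑ b, W ((α.1.1, α.2.1), b) ^ 2) * ∑ k, D (α.1.2, α.2.2) k ^ 2 := fun α =>
    sum_liftCoeff_sq (fun b => W ((α.1.1, α.2.1), b)) (D (α.1.2, α.2.2))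
  simp only [e]
  rw [sum_prod_prod_comm fun a l => (∑ b, W (a, b) ^ 2) * ∑ k, D l k ^ 2,
    Fintype.sum_prod_type (f := fun a : (J × J) × (J × J) => W a ^ 2), Finset.sum_mul_sum]

variable {Ω : Type*} (z z' : J → Ω → L → ℝ)

/-- The centering constants of the stacked form collect to `∑ w_j²`, the variance of a coordinate of
the weighted sum. For weights centered at the sample mean this is the `(N - 1) / N` of the
unknown-mean statistic. -/
theorem quadForm_liftCoeff_tensorSq (w : J → ℝ) (D : L × L → ℝ) (ω : Ω) :
    quadForm (stacked z) (liftCoeff (tensorSq w) D) ω =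
      ∑ l, D l * centeredSquare (∑ j, w j ^ 2) (∑ j, w j • z j ω) l := by
  let f : J × J → L × L → ℝ := fun a l => D l * (w a.1 * z a.1 ω l.1 * (w a.2 * z a.2 ω l.2) -
    if l.1 = l.2 then (if a.1 = a.2 then w a.1 * w a.2 else 0) else 0)
  have e : ∀ α : (J × L) × (J × L), liftCoeff (tensorSq w) D α *
      centeredProduct (stacked z) α.1 α.2 ω = f (α.1.1, α.2.1) (α.1.2, α.2.2) := fun α => by
    simp only [f, liftCoeff, tensorSq, centeredProduct, stacked, Prod.ext_iff]
    by_cases h1 : α.1.1 = α.2.1 <;> by_cases h2 : α.1.2 = α.2.2 <;> simp [h1, h2] <;> ring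
  rw [quadForm, Finset.sum_congr rfl fun α _ => e α, sum_prod_prod_comm f, Finset.sum_comm]
  refine Finset.sum_congr rfl fun l _ => ?_
  simp only [f]
  rw [← Finset.mul_sum, Finset.sum_sub_distrib, centeredSquare, Fintype.sum_prod_type]
  congr 2
  · simp only [Finset.sum_apply, Pi.smul_apply, smul_eq_mul, Finset.sum_mul_sum]
  · split_ifs
    · rw [Fintype.sum_prod_type]
      simp [sq]
    · simp

theorem biquadForm_biliftCoeff_tensorSq (w : J → ℝ) (B : Matrix L L ℝ) (ω : Ω) :
    biquadForm (stacked z) (stacked z') (biliftCoeff (tensorSq (tensorSq w)) (kroneckerSq B)) ω =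
      traceForm B (∑ j, w j ^ 2) (∑ j, w j • z j ω) (∑ j, w j • z' j ω) := by
  have e : ∀ α : (J × L) × (J × L), quadForm (stacked z')
      (biliftCoeff (tensorSq (tensorSq w)) (kroneckerSq B) α) ω =
      liftCoeff (tensorSq w) (fun l => ∑ k, kroneckerSq B l k *
        centeredSquare (∑ j, w j ^ 2) (∑ j, w j • z' j ω) k) α := fun α => by
    have e' : biliftCoeff (tensorSq (tensorSq w)) (kroneckerSq B) α = fun β =>
        tensorSq w (α.1.1, α.2.1) * liftCoeff (tensorSq w) (kroneckerSq B (α.1.2, α.2.2)) β :=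
      funext fun β => by
        simp only [biliftCoeff, liftCoeff]
        rw [tensorSq, mul_assoc]
    rw [e', quadForm]
    simp only [mul_assoc]
    rw [← Finset.mul_sum]
    rw [liftCoeff, ← quadForm_liftCoeff_tensorSq]
    rfl
  rw [biquadForm]
  simp only [e]
  exact quadForm_liftCoeff_tensorSq z w _ ω

theorem sumForm_eq_quadForm (w : J → ℝ) (b : L → ℝ) (ω : Ω) :
    sumForm b (∑ j, w j ^ 2) (∑ j, w j • z j ω) =
      quadForm (stacked z) (liftCoeff (tensorSq w) (tensorSq b)) ω := by
  rw [quadForm_liftCoeff_tensorSq]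
  rfl

theorem quadForm_liftCoeff_sum_sub {ι : Type*} (I : Finset ι) (s t : ι → J × J → ℝ)
    (D : L × L → ℝ) (ω : Ω) :
    quadForm (stacked z) (liftCoeff (fun a => ∑ i ∈ I, (s i a - t i a)) D) ω =
      ∑ i ∈ I, (quadForm (stacked z) (liftCoeff (s i) D) ω -
        quadForm (stacked z) (liftCoeff (t i) D) ω) := by
  simp only [quadForm, liftCoeff, Finset.sum_mul, sub_mul, ← Finset.sum_sub_distrib]
  rw [Finset.sum_comm]

theorem biquadForm_biliftCoeff_sum_sub {ι : Type*} (I : Finset ι)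
    (s t : ι → (J × J) × (J × J) → ℝ) (D : L × L → L × L → ℝ) (ω : Ω) :
    biquadForm (stacked z) (stacked z') (biliftCoeff (fun a => ∑ i ∈ I, (s i a - t i a)) D) ω =
      ∑ i ∈ I, (biquadForm (stacked z) (stacked z') (biliftCoeff (s i) D) ω -
        biquadForm (stacked z) (stacked z') (biliftCoeff (t i) D) ω) := by
  have e : ∀ α : (J × L) × (J × L), quadForm (stacked z')
      (biliftCoeff (fun a => ∑ i ∈ I, (s i a - t i a)) D α) ω =
      ∑ i ∈ I, (quadForm (stacked z') (biliftCoeff (s i) D α) ω -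
        quadForm (stacked z') (biliftCoeff (t i) D α) ω) := fun α =>
    quadForm_liftCoeff_sum_sub z' I (fun i b => s i ((α.1.1, α.2.1), b))
      (fun i b => t i ((α.1.1, α.2.1), b)) (D (α.1.2, α.2.2)) ω
  simp only [biquadForm, e, Finset.sum_mul, sub_mul, ← Finset.sum_sub_distrib]
  rw [Finset.sum_comm]

end Lifts

/-! ### Gram matrices of the weight tensors. -/

section Tensors

/-- When `s` is the image of `t` under an orthogonal projection, the cross Gram matrix equals that
of `s`, as `hss` and `hst` express; expanding the square leaves `H - G`. -/
theorem sum_sq_sum_sub {κ ι : Type*} [Fintype κ] (I : Finset ι) (s t : ι → κ → ℝ)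
    (G H : ι → ι → ℝ) (hss : ∀ i j, ∑ a, s i a * s j a = G i j)
    (hst : ∀ i j, ∑ a, s i a * t j a = G i j) (htt : ∀ i j, ∑ a, t i a * t j a = H i j) :
    ∑ a, (∑ i ∈ I, (s i a - t i a)) ^ 2 = ∑ i ∈ I, ∑ j ∈ I, (H i j - G j i) := by
  have e : ∀ a, (∑ i ∈ I, (s i a - t i a)) ^ 2 = ∑ i ∈ I, ∑ j ∈ I,
      (s i a * s j a - s i a * t j a + t i a * t j a - s j a * t i a) := fun a => by
    rw [sq, Finset.sum_mul_sum]
    exact Finset.sum_congr rfl fun i _ => Finset.sum_congr rfl fun j _ => by ring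
  simp only [e]
  rw [Finset.sum_comm]
  refine Finset.sum_congr rfl fun i _ => ?_
  rw [Finset.sum_comm]
  refine Finset.sum_congr rfl fun j _ => ?_
  rw [Finset.sum_sub_distrib, Finset.sum_add_distrib, Finset.sum_sub_distrib, hss, hst, htt, hst]
  ring

/-- Off the diagonal the terms are nonpositive because `r` is even; on the diagonal Bernoulli's
inequality gives `r / N`. The bound is used both for one observation and for the whole sample. -/
theorem sum_sum_indicator_sub_pow_le {N : ℕ} (I : Finset (Fin N)) (r : ℕ) (hr : Even r) :
    ∑ i ∈ I, ∑ j ∈ I, ((if i = j then (1 : ℝ) else 0) - ((if j = i then 1 else 0) - 1 / N) ^ r) ≤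
      r * I.card / N := by
  calc _ ≤ ∑ i ∈ I, ∑ j ∈ I, (if i = j then (r : ℝ) / N else 0) := by
        refine Finset.sum_le_sum fun i _ => Finset.sum_le_sum fun j _ => ?_
        by_cases hij : i = j
        · have hN : (1 : ℝ) ≤ N := by exact_mod_cast i.pos
          have h1 : 1 / (N : ℝ) ≤ 1 := by rw [div_le_one (by linarith)]; exact hN
          have := one_add_mul_le_pow (a := -(1 / (N : ℝ))) (by linarith) r
          simp only [hij, if_true]
          have e : (r : ℝ) * -(1 / N) = -(r / N) := by ring
          rw [e, ← sub_eq_add_neg, ← sub_eq_add_neg] at this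
          linarith
        · simp only [hij, Ne.symm hij, if_false, zero_sub]
          have := hr.pow_nonneg (-(1 / (N : ℝ)))
          simpa using this
    _ = ∑ i ∈ I, (r : ℝ) / N := Finset.sum_congr rfl fun i hi => by simp [hi]
    _ = _ := by simp; ring

/-- The weights that single out the `i`-th observation. -/
def unitWeight {N : ℕ} (i j : Fin N) : ℝ := if i = j then 1 else 0

/-- The weights that center the `i`-th observation at the sample mean. -/
noncomputable def centeredWeight {N : ℕ} (i j : Fin N) : ℝ := (if i = j then 1 else 0) - 1 / N

variable {N : ℕ}

theorem sum_unitWeight_mul (i j : Fin N) :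
    ∑ a, unitWeight i a * unitWeight j a = if i = j then 1 else 0 := by
  simp [unitWeight]

theorem sum_centeredWeight_mul_unitWeight (i j : Fin N) :
    ∑ a, centeredWeight i a * unitWeight j a = (if i = j then 1 else 0) - 1 / N := by
  simp [unitWeight, centeredWeight]

theorem sum_centeredWeight_mul (i j : Fin N) :
    ∑ a, centeredWeight i a * centeredWeight j a = (if i = j then 1 else 0) - 1 / N := by
  have hN : (N : ℝ) ≠ 0 := by exact_mod_cast i.pos.ne'
  simp only [centeredWeight, sub_mul, mul_sub, Finset.sum_sub_distrib]
  simp [hN]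

theorem sum_sq_sum_tensorSq_sub_le (I : Finset (Fin N)) :
    ∑ a, (∑ i ∈ I, (tensorSq (centeredWeight i) a - tensorSq (unitWeight i) a)) ^ 2 ≤
      2 * I.card / N := by
  rw [sum_sq_sum_sub I _ _ (fun i j => ((if i = j then 1 else 0) - 1 / N) ^ 2)
    (fun i j => if i = j then 1 else 0)]
  · exact sum_sum_indicator_sub_pow_le I 2 (by decide)
  · intro i j; rw [sum_tensorSq_mul, sum_centeredWeight_mul]
  · intro i j; rw [sum_tensorSq_mul, sum_centeredWeight_mul_unitWeight]
  · intro i j; rw [sum_tensorSq_mul, sum_unitWeight_mul]; split_ifs <;> norm_num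

theorem sum_sq_sum_tensorSq_tensorSq_sub_le (I : Finset (Fin N)) :
    ∑ a, (∑ i ∈ I, (tensorSq (tensorSq (centeredWeight i)) a -
      tensorSq (tensorSq (unitWeight i)) a)) ^ 2 ≤ 4 * I.card / N := by
  rw [sum_sq_sum_sub I _ _ (fun i j => ((if i = j then 1 else 0) - 1 / N) ^ 4)
    (fun i j => if i = j then 1 else 0)]
  · exact sum_sum_indicator_sub_pow_le I 4 (by decide)
  · intro i j; rw [sum_tensorSq_mul, sum_tensorSq_mul, sum_centeredWeight_mul, ← pow_mul]
  · intro i j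
    rw [sum_tensorSq_mul, sum_tensorSq_mul, sum_centeredWeight_mul_unitWeight, ← pow_mul]
  · intro i j
    rw [sum_tensorSq_mul, sum_tensorSq_mul, sum_unitWeight_mul]
    split_ifs <;> norm_num

end Tensors

/-! ### Lower bounds for the variances. -/

section Variances

variable {L : Type*} [Fintype L] [DecidableEq L]

/-- A lower bound for the ratio of second moments of quadratic forms to their Gaussian
counterparts. -/
noncomputable def varianceRatio (Δ : ℝ) : ℝ := min 2 (2 + Δ) / 4

theorem varianceRatio_pos {Δ : ℝ} (hΔ : 1 < 3 + Δ) : 0 < varianceRatio Δ := by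
  have : 0 < min 2 (2 + Δ) := lt_min (by norm_num) (by linarith)
  unfold varianceRatio
  linarith

/-- Compared entry by entry after symmetrization: off the diagonal the coefficient is `1/2`, on the
diagonal `(2 + Δ) / 4`. -/
theorem le_secondMomentForm (Δ : ℝ) (A : L × L → ℝ) :
    varianceRatio Δ * ∑ α, (A α + A α.swap) ^ 2 ≤ secondMomentForm Δ A := by
  have hsw : ∑ α : L × L, A α.swap ^ 2 = ∑ α, A α ^ 2 :=
    Fintype.sum_equiv (Equiv.prodComm L L) _ _ fun _ => rfl
  have hd : ∑ x, A (x, x) ^ 2 = ∑ α : L × L, if α.1 = α.2 then A α ^ 2 else 0 := by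
    rw [Fintype.sum_prod_type]
    simp
  have h1 : ∑ α, (A α ^ 2 + A α * A α.swap) = ∑ α : L × L, (A α + A α.swap) ^ 2 / 2 := by
    have e : ∀ α : L × L, (A α + A α.swap) ^ 2 / 2 =
        A α ^ 2 / 2 + A α * A α.swap + A α.swap ^ 2 / 2 := fun α => by ring
    simp only [e, Finset.sum_add_distrib, ← Finset.sum_div, hsw]
    ring
  rw [secondMomentForm, h1, hd, Finset.mul_sum, Finset.mul_sum, ← Finset.sum_add_distrib]
  have m1 : varianceRatio Δ ≤ 1 / 2 := by
    have := min_le_left 2 (2 + Δ)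
    unfold varianceRatio
    linarith
  have m2 : varianceRatio Δ ≤ (2 + Δ) / 4 := by
    have := min_le_right 2 (2 + Δ)
    unfold varianceRatio
    linarith
  refine Finset.sum_le_sum fun ⟨a, b⟩ _ => ?_
  simp only [Prod.swap_prod_mk]
  split_ifs with hab
  · subst hab
    nlinarith [mul_le_mul_of_nonneg_right m2 (sq_nonneg (A (a, a) + A (a, a)))]
  · nlinarith [mul_le_mul_of_nonneg_right m1 (sq_nonneg (A (a, b) + A (b, a)))]

theorem sum_sq_tensorSq (b : L → ℝ) : ∑ l, tensorSq b l ^ 2 = (∑ l, b l ^ 2) ^ 2 := by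
  simpa only [sq] using sum_tensorSq_mul b b

/-- The sum of the squares of the entries of a matrix. -/
def sumSq (B : Matrix L L ℝ) : ℝ := ∑ l, ∑ k, B l k ^ 2

theorem sum_sq_kroneckerSq (B : Matrix L L ℝ) :
    ∑ l, ∑ k, kroneckerSq B l k ^ 2 = sumSq B ^ 2 := by
  simp only [kroneckerSq, mul_pow, Fintype.sum_prod_type, sumSq]
  simp only [← Finset.mul_sum, ← Finset.sum_mul, sq]

/-- The second moment of `sumForm b 1 y + sumForm b 1 y'`. -/
def sumVariance (Δ : ℝ) (b : L → ℝ) : ℝ := 2 * secondMomentForm Δ (tensorSq b)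

/-- The second moment of `traceForm B 1 y y'`. -/
def traceVariance (Δ : ℝ) (B : Matrix L L ℝ) : ℝ :=
  2 * ∑ l, secondMomentForm Δ (kroneckerSq B l) +
    Δ * ∑ x, secondMomentForm Δ (kroneckerSq B (x, x))

theorem le_sumVariance (Δ : ℝ) (b : L → ℝ) :
    8 * varianceRatio Δ * (∑ l, b l ^ 2) ^ 2 ≤ sumVariance Δ b := by
  have h := le_secondMomentForm Δ (tensorSq b)
  have e : ∑ α, (tensorSq b α + tensorSq b α.swap) ^ 2 = 4 * ∑ α, tensorSq b α ^ 2 := by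
    rw [Finset.mul_sum]
    exact Finset.sum_congr rfl fun α _ => by simp only [tensorSq, Prod.fst_swap, Prod.snd_swap]; ring
  rw [e, sum_sq_tensorSq] at h
  unfold sumVariance
  linarith

/-- The factor `varianceRatio Δ` is lost twice, once for each of the two vectors. -/
theorem le_traceVariance {Δ : ℝ} (hΔ : 1 < 3 + Δ) (B : Matrix L L ℝ) :
    8 * varianceRatio Δ ^ 2 * sumSq B ^ 2 ≤ traceVariance Δ B := by
  have hκ := varianceRatio_pos hΔ
  set q : L × L → ℝ := fun l => secondMomentForm Δ (kroneckerSq B l) with hq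
  have hq' : ∀ l, varianceRatio Δ * ∑ α, (kroneckerSq B l α + kroneckerSq B l α.swap) ^ 2 ≤ q l :=
    fun l => le_secondMomentForm Δ _
  have hq0 : ∀ l, 0 ≤ q l := fun l => le_trans (by positivity) (hq' l)
  have hd : ∑ x, q (x, x) ≤ ∑ l, q l := by
    have : ∑ x, q (x, x) = ∑ α : L × L, if α.1 = α.2 then q α else 0 := by
      rw [Fintype.sum_prod_type]
      simp
    rw [this]
    refine Finset.sum_le_sum fun α _ => ?_
    split_ifs
    · exact le_rfl
    · exact hq0 α
  have hd0 : 0 ≤ ∑ x, q (x, x) := Finset.sum_nonneg fun x _ => hq0 _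
  -- The sum over the diagonal lies between `0` and the full sum; which end matters depends on the
  -- sign of `Δ`.
  have h1 : 4 * varianceRatio Δ * ∑ l, q l ≤ traceVariance Δ B := by
    unfold traceVariance varianceRatio
    rcases le_total 0 Δ with h0 | h0
    · rw [min_eq_left (by linarith)]
      nlinarith [mul_nonneg h0 hd0]
    · rw [min_eq_right (by linarith)]
      nlinarith [mul_le_mul_of_nonpos_left hd h0]
  have h2 : 2 * sumSq B ^ 2 ≤ ∑ l, ∑ α : L × L, (kroneckerSq B l α + kroneckerSq B l α.swap) ^ 2 := by
    have hsw : ∀ l, ∑ α : L × L, kroneckerSq B l α.swap ^ 2 = ∑ α, kroneckerSq B l α ^ 2 := fun l =>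
      Fintype.sum_equiv (Equiv.prodComm L L) _ _ fun _ => rfl
    have e : ∀ l, ∑ α : L × L, (kroneckerSq B l α + kroneckerSq B l α.swap) ^ 2 =
        2 * ∑ α, kroneckerSq B l α ^ 2 +
          2 * ∑ α : L × L, kroneckerSq B l α * kroneckerSq B l α.swap := fun l => by
      have : ∀ α : L × L, (kroneckerSq B l α + kroneckerSq B l α.swap) ^ 2 = kroneckerSq B l α ^ 2 +
        2 * (kroneckerSq B l α * kroneckerSq B l α.swap) + kroneckerSq B l α.swap ^ 2 := fun α => by
        ring
      simp only [this, Finset.sum_add_distrib, hsw, ← Finset.mul_sum]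
      ring
    simp only [e, Finset.sum_add_distrib, ← Finset.mul_sum, sum_sq_kroneckerSq]
    -- After exchanging the sums, each term is the square of an entry of `BᵀB`, so symmetrization
    -- cannot cancel the norm.
    have hn : 0 ≤ ∑ l, ∑ α : L × L, kroneckerSq B l α * kroneckerSq B l α.swap := by
      rw [Finset.sum_comm]
      refine Finset.sum_nonneg fun α _ => ?_
      have : ∑ l, kroneckerSq B l α * kroneckerSq B l α.swap =
          (∑ l, B l α.1 * B l α.2) * ∑ l, B l α.1 * B l α.2 := by
        rw [Finset.sum_mul_sum, Fintype.sum_prod_type]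
        refine Finset.sum_congr rfl fun i _ => Finset.sum_congr rfl fun j _ => ?_
        simp only [kroneckerSq, Prod.fst_swap, Prod.snd_swap]
        ring
      rw [this]
      exact mul_self_nonneg _
    linarith
  have h3 : varianceRatio Δ * (2 * sumSq B ^ 2) ≤ ∑ l, q l := by
    refine (mul_le_mul_of_nonneg_left h2 hκ.le).trans ?_
    rw [Finset.mul_sum]
    exact Finset.sum_le_sum fun l _ => hq' l
  calc _ = 4 * varianceRatio Δ * (varianceRatio Δ * (2 * sumSq B ^ 2)) := by ring
    _ ≤ 4 * varianceRatio Δ * ∑ l, q l := by gcongr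
    _ ≤ _ := h1

end Variances

/-! ### Normalization of the statistics and the effect of centering. -/

section Statistics

variable {Ω : Type*} [MeasurableSpace Ω] {P : Measure Ω} [IsProbabilityMeasure P]
  {L : Type*} [Fintype L] [DecidableEq L] {Δ C : ℝ}

theorem centeredProduct_comm (ζ : L → Ω → ℝ) (x y : L) (ω : Ω) :
    centeredProduct ζ x y ω = centeredProduct ζ y x ω := by
  unfold centeredProduct
  by_cases h : x = y
  · rw [h]
  · rw [if_neg h, if_neg (Ne.symm h), mul_comm]

namespace HasFactorizedMoments

variable {ζ ζ' : L → Ω → ℝ} (h : HasFactorizedMoments P ζ Δ C) (h' : HasFactorizedMoments P ζ' Δ C)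
  (hind : IndepFun (fun ω x => ζ x ω) (fun ω x => ζ' x ω) P)
include h h' hind

theorem integral_biquadForm_kroneckerSq_sq (B : Matrix L L ℝ) :
    ∫ ω, biquadForm ζ ζ' (kroneckerSq B) ω ^ 2 ∂P = traceVariance Δ B := by
  refine integral_biquadForm_sq h h' hind (kroneckerSq B) fun α ω => ?_
  refine Fintype.sum_equiv (Equiv.prodComm L L) _ _ fun β => ?_
  simp only [kroneckerSq, Equiv.prodComm_apply, Prod.fst_swap, Prod.snd_swap,
    centeredProduct_comm ζ' β.2 β.1]
  ring

theorem integral_quadForm_add_sq (A : L × L → ℝ) :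
    ∫ ω, (quadForm ζ A ω + quadForm ζ' A ω) ^ 2 ∂P = 2 * secondMomentForm Δ A := by
  have e : ∀ ω, (quadForm ζ A ω + quadForm ζ' A ω) ^ 2 =
      quadForm ζ A ω ^ 2 + 2 * (quadForm ζ A ω * quadForm ζ' A ω) + quadForm ζ' A ω ^ 2 :=
    fun ω => by ring
  have hm : Integrable (fun ω => quadForm ζ A ω * quadForm ζ' A ω) P :=
    ((h.memLp_quadForm A).mono_exponent (by norm_num : (2 : ℝ≥0∞) ≤ 4)).integrable_mul
      ((h'.memLp_quadForm A).mono_exponent (by norm_num : (2 : ℝ≥0∞) ≤ 4))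
  simp only [e]
  rw [integral_add ((h.integrable_quadForm_sq A).fun_add (hm.const_mul 2))
    (h'.integrable_quadForm_sq A), integral_add (h.integrable_quadForm_sq A) (hm.const_mul 2),
    integral_const_mul, h.integral_quadForm_sq, h'.integral_quadForm_sq,
    (indepFun_quadForm hind A A).integral_fun_mul_eq_mul_integral
      (h.measurable_quadForm A).aestronglyMeasurable
      (h'.measurable_quadForm A).aestronglyMeasurable, h.integral_quadForm]
  ring

theorem integral_quadForm_add_pow_four_le (A : L × L → ℝ) :
    ∫ ω, (quadForm ζ A ω + quadForm ζ' A ω) ^ 4 ∂P ≤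
      16 * quadraticMomentConst Δ C * (∑ α, A α ^ 2) ^ 2 := by
  have i := (h.memLp_quadForm A).integrable_pow_four
  have i' := (h'.memLp_quadForm A).integrable_pow_four
  calc _ ≤ ∫ ω, (8 * quadForm ζ A ω ^ 4 + 8 * quadForm ζ' A ω ^ 4) ∂P :=
        integral_mono (((h.memLp_quadForm A).add (h'.memLp_quadForm A)).integrable_pow_four)
          ((i.const_mul 8).fun_add (i'.const_mul 8)) fun ω => by
            have := Even.add_pow_le (n := 4) (by decide) (a := quadForm ζ A ω)
              (b := quadForm ζ' A ω)
            rw [show (2 : ℝ) ^ (4 - 1) = 8 by norm_num] at this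
            simp only [Pi.add_apply]
            linarith
    _ ≤ _ := by
        rw [integral_add (i.const_mul 8) (i'.const_mul 8), integral_const_mul, integral_const_mul]
        linarith [h.integral_quadForm_pow_four_le A, h'.integral_quadForm_pow_four_le A]

end HasFactorizedMoments
/-- The trace statistic, with the vectors weighted by `w`. -/
def traceStat {N : ℕ} (z z' : Fin N → Ω → L → ℝ) (B : Matrix L L ℝ) (w : Fin N → ℝ) (ω : Ω) : ℝ :=
  traceForm B (∑ j, w j ^ 2) (∑ j, w j • z j ω) (∑ j, w j • z' j ω)

/-- The sum statistic, with the vectors weighted by `w`. -/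
def sumStat {N : ℕ} (z z' : Fin N → Ω → L → ℝ) (b : L → ℝ) (w : Fin N → ℝ) (ω : Ω) : ℝ :=
  sumForm b (∑ j, w j ^ 2) (∑ j, w j • z j ω) + sumForm b (∑ j, w j ^ 2) (∑ j, w j • z' j ω)

theorem sum_unitWeight_smul {N : ℕ} {E : Type*} [AddCommGroup E] [Module ℝ E] (i : Fin N)
    (v : Fin N → E) : ∑ j, unitWeight i j • v j = v i := by
  simp [unitWeight]

theorem sum_unitWeight_sq {N : ℕ} (i : Fin N) : ∑ j, unitWeight i j ^ 2 = 1 := by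
  simp [unitWeight]

/-- A bound for the normalized fourth moments. -/
noncomputable def kurtosisBound (Δ C : ℝ) : ℝ :=
  (quadraticMomentConst Δ C / (8 * varianceRatio Δ ^ 2)) ^ 2 +
    16 * quadraticMomentConst Δ C / (8 * varianceRatio Δ) ^ 2

/-- A bound for the normalized effect of the centering at the sample mean. -/
noncomputable def centeringBound (Δ C : ℝ) : ℝ :=
  4 * quadraticMomentConst Δ C / (8 * varianceRatio Δ ^ 2) +
    8 * √(quadraticMomentConst Δ C) / (8 * varianceRatio Δ)

namespace IndependentSamples

variable {N : ℕ} {z z' : Fin N → Ω → L → ℝ} (h : IndependentSamples P z z' Δ C)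
include h

theorem moments_stacked_fst : HasFactorizedMoments P (stacked z) Δ C :=
  HasFactorizedMoments.stacked h.moments_fst h.indep_fst

theorem moments_stacked_snd : HasFactorizedMoments P (stacked z') Δ C :=
  HasFactorizedMoments.stacked h.moments_snd h.indep_snd

theorem memLp_traceStat (B : Matrix L L ℝ) (w : Fin N → ℝ) :
    MemLp (traceStat z z' B w) 4 P := by
  unfold traceStat
  simp only [← biquadForm_biliftCoeff_tensorSq]
  exact HasFactorizedMoments.memLp_biquadForm h.moments_stacked_fst h.moments_stacked_snd
    h.indepFun_stacked _

theorem measurable_traceStat (B : Matrix L L ℝ) (w : Fin N → ℝ) :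
    Measurable (traceStat z z' B w) := by
  unfold traceStat
  simp only [← biquadForm_biliftCoeff_tensorSq]
  exact HasFactorizedMoments.measurable_biquadForm h.moments_stacked_fst h.moments_stacked_snd _

theorem memLp_sumStat (b : L → ℝ) (w : Fin N → ℝ) : MemLp (sumStat z z' b w) 4 P := by
  unfold sumStat
  simp only [sumForm_eq_quadForm]
  exact (h.moments_stacked_fst.memLp_quadForm _).add (h.moments_stacked_snd.memLp_quadForm _)

theorem measurable_sumStat (b : L → ℝ) (w : Fin N → ℝ) : Measurable (sumStat z z' b w) := by
  unfold sumStat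
  simp only [sumForm_eq_quadForm]
  exact (h.moments_stacked_fst.measurable_quadForm _).add
    (h.moments_stacked_snd.measurable_quadForm _)

/-- The summed difference is one biquadratic form in the stacked vectors. Bounding it as a whole
keeps the cancellation between observations, which a term-by-term estimate would lose. -/
theorem integral_sq_sum_traceStat_sub_le (B : Matrix L L ℝ) (I : Finset (Fin N)) :
    ∫ ω, (∑ i ∈ I, (traceStat z z' B (centeredWeight i) ω -
      traceStat z z' B (unitWeight i) ω)) ^ 2 ∂P ≤
      quadraticMomentConst Δ C * (4 * I.card / N * sumSq B ^ 2) := by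
  unfold traceStat
  simp only [← biquadForm_biliftCoeff_tensorSq, ← biquadForm_biliftCoeff_sum_sub]
  refine (HasFactorizedMoments.integral_biquadForm_sq_le h.moments_stacked_fst
    h.moments_stacked_snd h.indepFun_stacked _).trans ?_
  rw [sum_biliftCoeff_sq, sum_sq_kroneckerSq]
  exact mul_le_mul_of_nonneg_left (mul_le_mul_of_nonneg_right
    (sum_sq_sum_tensorSq_tensorSq_sub_le I) (sq_nonneg _)) (quadraticMomentConst_nonneg Δ C)

theorem integral_sq_sum_sumStat_sub_le (b : L → ℝ) (I : Finset (Fin N)) :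
    ∫ ω, (∑ i ∈ I, (sumStat z z' b (centeredWeight i) ω -
      sumStat z z' b (unitWeight i) ω)) ^ 2 ∂P ≤
      4 * √(quadraticMomentConst Δ C) * (2 * I.card / N * (∑ l, b l ^ 2) ^ 2) := by
  set A := liftCoeff (fun a : Fin N × Fin N => ∑ i ∈ I,
    (tensorSq (centeredWeight i) a - tensorSq (unitWeight i) a)) (tensorSq b) with hA
  have e : ∀ ω, ∑ i ∈ I, (sumStat z z' b (centeredWeight i) ω - sumStat z z' b (unitWeight i) ω) =
      quadForm (stacked z) A ω + quadForm (stacked z') A ω := fun ω => by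
    rw [hA, quadForm_liftCoeff_sum_sub, quadForm_liftCoeff_sum_sub, ← Finset.sum_add_distrib]
    refine Finset.sum_congr rfl fun i _ => ?_
    simp only [sumStat, sumForm_eq_quadForm]
    ring
  have hS : ∑ α, A α ^ 2 ≤ 2 * I.card / N * (∑ l, b l ^ 2) ^ 2 := by
    rw [hA, sum_liftCoeff_sq, sum_sq_tensorSq]
    exact mul_le_mul_of_nonneg_right (sum_sq_sum_tensorSq_sub_le I) (sq_nonneg _)
  have hK := Real.sqrt_nonneg (quadraticMomentConst Δ C)
  have i1 := h.moments_stacked_fst.integrable_quadForm_sq A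
  have i2 := h.moments_stacked_snd.integrable_quadForm_sq A
  have b1 := h.moments_stacked_fst.integral_quadForm_sq_le A
  have b2 := h.moments_stacked_snd.integral_quadForm_sq_le A
  have b3 := mul_le_mul_of_nonneg_left hS hK
  simp only [e]
  calc _ ≤ ∫ ω, (2 * quadForm (stacked z) A ω ^ 2 + 2 * quadForm (stacked z') A ω ^ 2) ∂P := by
        refine integral_mono ?_ ((i1.const_mul 2).fun_add (i2.const_mul 2)) fun ω => ?_
        · exact (((h.moments_stacked_fst.memLp_quadForm A).add
            (h.moments_stacked_snd.memLp_quadForm A)).mono_exponent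
            (by norm_num : (2 : ℝ≥0∞) ≤ 4)).integrable_sq
        · simp only
          nlinarith [sq_nonneg (quadForm (stacked z) A ω - quadForm (stacked z') A ω)]
    _ ≤ _ := by
        rw [integral_add (i1.const_mul 2) (i2.const_mul 2), integral_const_mul, integral_const_mul]
        linarith

theorem traceStat_unitWeight (B : Matrix L L ℝ) (i : Fin N) (ω : Ω) :
    traceStat z z' B (unitWeight i) ω =
      biquadForm (fun k ω => z i ω k) (fun k ω => z' i ω k) (kroneckerSq B) ω := by
  rw [traceStat, sum_unitWeight_smul, sum_unitWeight_smul, sum_unitWeight_sq]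
  rfl

theorem sumStat_unitWeight (b : L → ℝ) (i : Fin N) (ω : Ω) :
    sumStat z z' b (unitWeight i) ω = quadForm (fun k ω => z i ω k) (tensorSq b) ω +
      quadForm (fun k ω => z' i ω k) (tensorSq b) ω := by
  rw [sumStat, sum_unitWeight_smul, sum_unitWeight_smul, sum_unitWeight_sq]
  rfl

/-- Upper bounds for fourth moments and lower bounds for variances carry the same powers of `sumSq
B` and `∑ b²`, which cancel; the kurtosis bound is free of the dimensions and of the coefficients.
-/
theorem normalizedPairs (hΔ : 1 < 3 + Δ) {B : Matrix L L ℝ} {b : L → ℝ} (hB : 0 < sumSq B)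
    (hb : 0 < ∑ l, b l ^ 2) :
    NormalizedPairs P (fun i ω => (√(traceVariance Δ B))⁻¹ * traceStat z z' B (unitWeight i) ω)
      (fun i ω => (√(sumVariance Δ b))⁻¹ * sumStat z z' b (unitWeight i) ω)
      (kurtosisBound Δ C) := by
  have hκ := varianceRatio_pos hΔ
  have hK := quadraticMomentConst_nonneg Δ C
  have hT0 : 0 < 8 * varianceRatio Δ ^ 2 * sumSq B ^ 2 := by positivity
  have hV0 : 0 < 8 * varianceRatio Δ * (∑ l, b l ^ 2) ^ 2 := by positivity
  have hT := hT0.trans_le (le_traceVariance hΔ B)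
  have hV := hV0.trans_le (le_sumVariance Δ b)
  have p2 : ∀ v : ℝ, 0 < v → (√v)⁻¹ ^ 2 = v⁻¹ := fun v hv => by
    rw [inv_pow, Real.sq_sqrt hv.le]
  have p4 : ∀ v : ℝ, 0 < v → (√v)⁻¹ ^ 4 = (v ^ 2)⁻¹ := fun v hv => by
    rw [show (4 : ℕ) = 2 * 2 by rfl, pow_mul, p2 v hv, inv_pow]
  refine ⟨fun i => (h.measurable_traceStat B _).const_mul _,
    fun i => (h.measurable_sumStat b _).const_mul _, ?_,
    fun i => (h.memLp_traceStat B _).const_mul _, fun i => (h.memLp_sumStat b _).const_mul _,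
    fun i => ?_, fun i => ?_, fun i => ?_, fun i => ?_, fun i => ?_, fun i => ?_, fun i => ?_⟩
  · have := h.indep_pairs.comp (fun _ u => ((√(traceVariance Δ B))⁻¹ * traceForm B 1 u.1 u.2,
      (√(sumVariance Δ b))⁻¹ * (sumForm b 1 u.1 + sumForm b 1 u.2))) fun _ => by
        unfold traceForm sumForm centeredSquare
        fun_prop
    refine this.congr fun i => Eventually.of_forall fun ω => ?_
    simp only [Function.comp_apply, traceStat, sumStat, sum_unitWeight_smul, sum_unitWeight_sq]
  · rw [integral_const_mul]
    simp only [h.traceStat_unitWeight]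
    rw [HasFactorizedMoments.integral_biquadForm (h.moments_fst i) (h.moments_snd i)
      (h.indepFun_single i), mul_zero]
  · rw [integral_const_mul]
    simp only [h.sumStat_unitWeight]
    rw [integral_add (((h.moments_fst i).memLp_quadForm _).integrable (by norm_num))
      (((h.moments_snd i).memLp_quadForm _).integrable (by norm_num)),
      (h.moments_fst i).integral_quadForm, (h.moments_snd i).integral_quadForm]
    simp
  · simp only [mul_pow, h.traceStat_unitWeight]
    rw [integral_const_mul, HasFactorizedMoments.integral_biquadForm_kroneckerSq_sq
      (h.moments_fst i) (h.moments_snd i) (h.indepFun_single i), p2 _ hT, inv_mul_cancel₀ hT.ne']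
  · simp only [mul_pow, h.sumStat_unitWeight]
    rw [integral_const_mul, HasFactorizedMoments.integral_quadForm_add_sq
      (h.moments_fst i) (h.moments_snd i) (h.indepFun_single i), p2 _ hV]
    exact inv_mul_cancel₀ hV.ne'
  · have e : ∀ ω, (√(traceVariance Δ B))⁻¹ * traceStat z z' B (unitWeight i) ω *
        ((√(sumVariance Δ b))⁻¹ * sumStat z z' b (unitWeight i) ω) =
        (√(traceVariance Δ B))⁻¹ * (√(sumVariance Δ b))⁻¹ *
        (traceStat z z' B (unitWeight i) ω * sumStat z z' b (unitWeight i) ω) := fun ω => by ring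
    simp only [e]
    rw [integral_const_mul]
    simp only [h.traceStat_unitWeight, h.sumStat_unitWeight, mul_add]
    have hi := HasFactorizedMoments.integral_biquadForm_mul_quadForm
      (h.moments_fst i) (h.moments_snd i) (h.indepFun_single i) (kroneckerSq B) (tensorSq b)
    have m1 := (HasFactorizedMoments.memLp_biquadForm (h.moments_fst i) (h.moments_snd i)
      (h.indepFun_single i) (kroneckerSq B)).mono_exponent (by norm_num : (2 : ℝ≥0∞) ≤ 4)
    have m2 := ((h.moments_fst i).memLp_quadForm (tensorSq b)).mono_exponent
      (by norm_num : (2 : ℝ≥0∞) ≤ 4)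
    have m3 := ((h.moments_snd i).memLp_quadForm (tensorSq b)).mono_exponent
      (by norm_num : (2 : ℝ≥0∞) ≤ 4)
    refine mul_eq_zero_of_right _
      ((integral_add (m1.integrable_mul m2) (m1.integrable_mul m3)).trans ?_)
    exact (congrArg₂ (· + ·) hi.1 hi.2).trans (add_zero 0)
  · simp only [mul_pow, h.traceStat_unitWeight]
    rw [integral_const_mul, p4 _ hT]
    have := HasFactorizedMoments.integral_biquadForm_pow_four_le
      (h.moments_fst i) (h.moments_snd i) (h.indepFun_single i) (kroneckerSq B)
    rw [sum_sq_kroneckerSq] at this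
    calc _ ≤ ((8 * varianceRatio Δ ^ 2 * sumSq B ^ 2) ^ 2)⁻¹ *
          (quadraticMomentConst Δ C * sumSq B ^ 2) ^ 2 := by
          gcongr
          exact le_traceVariance hΔ B
      _ = (quadraticMomentConst Δ C / (8 * varianceRatio Δ ^ 2)) ^ 2 := by field_simp
      _ ≤ _ := le_add_of_nonneg_right (by positivity)
  · simp only [mul_pow, h.sumStat_unitWeight]
    rw [integral_const_mul, p4 _ hV]
    have := HasFactorizedMoments.integral_quadForm_add_pow_four_le
      (h.moments_fst i) (h.moments_snd i) (h.indepFun_single i) (tensorSq b)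
    rw [sum_sq_tensorSq] at this
    calc _ ≤ ((8 * varianceRatio Δ * (∑ l, b l ^ 2) ^ 2) ^ 2)⁻¹ *
          (16 * quadraticMomentConst Δ C * ((∑ l, b l ^ 2) ^ 2) ^ 2) := by
          gcongr
          exact le_sumVariance Δ b
      _ = 16 * quadraticMomentConst Δ C / (8 * varianceRatio Δ) ^ 2 := by field_simp
      _ ≤ _ := le_add_of_nonneg_left (by positivity)

theorem integral_sq_sum_normalized_traceStat_sub_le (hΔ : 1 < 3 + Δ) {B : Matrix L L ℝ}
    (hB : 0 < sumSq B) (I : Finset (Fin N)) :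
    ∫ ω, (∑ i ∈ I, ((√(traceVariance Δ B))⁻¹ * traceStat z z' B (centeredWeight i) ω -
      (√(traceVariance Δ B))⁻¹ * traceStat z z' B (unitWeight i) ω)) ^ 2 ∂P ≤
      I.card * (centeringBound Δ C / N) := by
  have hκ := varianceRatio_pos hΔ
  have hK := quadraticMomentConst_nonneg Δ C
  have hT0 : 0 < 8 * varianceRatio Δ ^ 2 * sumSq B ^ 2 := by positivity
  have hT := hT0.trans_le (le_traceVariance hΔ B)
  simp only [← mul_sub, ← Finset.mul_sum, mul_pow]
  rw [integral_const_mul, inv_pow, Real.sq_sqrt hT.le]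
  calc _ ≤ (8 * varianceRatio Δ ^ 2 * sumSq B ^ 2)⁻¹ *
        (quadraticMomentConst Δ C * (4 * I.card / N * sumSq B ^ 2)) := by
        gcongr
        · exact le_traceVariance hΔ B
        · exact h.integral_sq_sum_traceStat_sub_le B I
    _ = I.card * (4 * quadraticMomentConst Δ C / (8 * varianceRatio Δ ^ 2) / N) := by
        field_simp
    _ ≤ _ := by
        gcongr
        exact le_add_of_nonneg_right (by positivity)

theorem integral_sq_sum_normalized_sumStat_sub_le (hΔ : 1 < 3 + Δ) {b : L → ℝ}
    (hb : 0 < ∑ l, b l ^ 2) (I : Finset (Fin N)) :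
    ∫ ω, (∑ i ∈ I, ((√(sumVariance Δ b))⁻¹ * sumStat z z' b (centeredWeight i) ω -
      (√(sumVariance Δ b))⁻¹ * sumStat z z' b (unitWeight i) ω)) ^ 2 ∂P ≤
      I.card * (centeringBound Δ C / N) := by
  have hκ := varianceRatio_pos hΔ
  have hK := quadraticMomentConst_nonneg Δ C
  have hV0 : 0 < 8 * varianceRatio Δ * (∑ l, b l ^ 2) ^ 2 := by positivity
  have hV := hV0.trans_le (le_sumVariance Δ b)
  simp only [← mul_sub, ← Finset.mul_sum, mul_pow]
  rw [integral_const_mul, inv_pow, Real.sq_sqrt hV.le]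
  calc _ ≤ (8 * varianceRatio Δ * (∑ l, b l ^ 2) ^ 2)⁻¹ *
        (4 * √(quadraticMomentConst Δ C) * (2 * I.card / N * (∑ l, b l ^ 2) ^ 2)) := by
        gcongr
        · exact le_sumVariance Δ b
        · exact h.integral_sq_sum_sumStat_sub_le b I
    _ = I.card * (8 * √(quadraticMomentConst Δ C) / (8 * varianceRatio Δ) / N) := by
        field_simp
        ring
    _ ≤ _ := by
        gcongr
        exact le_add_of_nonneg_left (by positivity)

end IndependentSamples

end Statistics

/-! ### Reduction of the multivariate model and conclusion. -/

theorem sum_sq_transpose_mulVec_one {p : ℕ} {L : Type*} [Fintype L]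
    (Γ : Matrix (Fin p) L ℝ) : ∑ l, (Γᵀ *ᵥ 1) l ^ 2 = ∑ i, ∑ j, (Γ * Γᵀ) i j := by
  simp only [Matrix.mulVec, dotProduct, Matrix.transpose_apply, Pi.one_apply, mul_one, sq,
    Finset.sum_mul_sum, Matrix.mul_apply]
  rw [Finset.sum_comm]
  exact Finset.sum_congr rfl fun i _ => Finset.sum_comm

/-- If the Gram matrix vanished then so would `Γ`. Thus the single assumption on the sum of the
entries of `Σ` makes both variances nondegenerate. -/
theorem sumSq_gram_pos {p : ℕ} {L : Type*} [Fintype L] {Γ : Matrix (Fin p) L ℝ}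
    (h : 0 < ∑ l, (Γᵀ *ᵥ 1) l ^ 2) : 0 < sumSq (Γᵀ * Γ) := by
  have h0 : 0 ≤ sumSq (Γᵀ * Γ) := Finset.sum_nonneg fun _ _ => Finset.sum_nonneg fun _ _ =>
    sq_nonneg _
  refine h0.lt_of_ne fun h1 => ?_
  have hB : Γᵀ * Γ = 0 := by
    ext l k
    have h2 := (Finset.sum_eq_zero_iff_of_nonneg fun l _ =>
      Finset.sum_nonneg fun k _ => sq_nonneg ((Γᵀ * Γ) l k)).mp h1.symm l (Finset.mem_univ l)
    have h3 := (Finset.sum_eq_zero_iff_of_nonneg fun k _ => sq_nonneg ((Γᵀ * Γ) l k)).mp h2 k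
      (Finset.mem_univ k)
    simpa using h3
  have hΓ : Γ = 0 := by
    rw [← Matrix.conjTranspose_eq_transpose_of_trivial] at hB
    exact Matrix.conjTranspose_mul_self_eq_zero.mp hB
  simp [hΓ] at h

namespace MultivariateModel

variable {Ω : Type*} [MeasurableSpace Ω] {P : Measure Ω} [IsProbabilityMeasure P] {n p m : ℕ}
  {X : Fin n → Ω → Fin p → ℝ} {Γ : Matrix (Fin p) (Fin m) ℝ} {Z : Fin n → Ω → Fin m → ℝ}
  {μ : Fin p → ℝ} {S : Matrix (Fin p) (Fin p) ℝ} {Δ C : ℝ} (h : MultivariateModel P X Γ Z μ S Δ C)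
include h

theorem pairKnown_eq (ω : Ω) (i : Fin (n / 2)) :
    pairKnown (fun i => X i ω) μ S i =
      (traceStat (fun i : Fin (n / 2) => Z (firstHalf i)) (fun i => Z (secondHalf i)) (Γᵀ * Γ)
        (unitWeight i) ω,
      sumStat (fun i : Fin (n / 2) => Z (firstHalf i)) (fun i => Z (secondHalf i)) (Γᵀ *ᵥ 1)
        (unitWeight i) ω) := by
  rw [traceStat, sumStat, sum_unitWeight_smul, sum_unitWeight_smul, sum_unitWeight_sq,
    ← estimatingPair_eq, pairKnown, one_smul, h.factor]
  simp only [centeredOuter, h.decomposition, add_sub_cancel_right]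

/-- The location `μ` cancels, and subtracting the sample mean becomes a change of weights on the
latent vectors. -/
theorem sub_mean_eq {k : ℕ} (f : Fin k → Fin n) (i : Fin k) (ω : Ω) :
    X (f i) ω - (k : ℝ)⁻¹ • ∑ j, X (f j) ω =
      Γ *ᵥ ∑ j, centeredWeight i j • Z (f j) ω := by
  have hk : (k : ℝ) ≠ 0 := by exact_mod_cast i.pos.ne'
  have e : ∑ j, centeredWeight i j • Z (f j) ω =
      Z (f i) ω - (k : ℝ)⁻¹ • ∑ j, Z (f j) ω := by
    simp [centeredWeight, sub_smul, Finset.sum_sub_distrib, Finset.smul_sum]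
  simp only [h.decomposition]
  rw [e, Matrix.mulVec_sub, Matrix.mulVec_smul, Matrix.mulVec_sum, Finset.sum_add_distrib, smul_add]
  simp [← Nat.cast_smul_eq_nsmul ℝ, smul_smul, hk]

theorem pairUnknown_eq (ω : Ω) (i : Fin (n / 2)) :
    pairUnknown (fun i => X i ω) S i =
      (traceStat (fun i : Fin (n / 2) => Z (firstHalf i)) (fun i => Z (secondHalf i)) (Γᵀ * Γ)
        (centeredWeight i) ω,
      sumStat (fun i : Fin (n / 2) => Z (firstHalf i)) (fun i => Z (secondHalf i)) (Γᵀ *ᵥ 1)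
        (centeredWeight i) ω) := by
  have hk : ((n / 2 : ℕ) : ℝ) ≠ 0 := by exact_mod_cast i.pos.ne'
  have hw : ∑ j, centeredWeight i j ^ 2 = (((n / 2 : ℕ) : ℝ) - 1) / ((n / 2 : ℕ) : ℝ) := by
    have := sum_centeredWeight_mul i i
    simp only [← sq, if_true] at this
    rw [this]
    field_simp
  rw [traceStat, sumStat, hw, ← estimatingPair_eq, pairUnknown, h.factor]
  simp only [centeredOuter, meanFirst, meanSecond, h.sub_mean_eq]

theorem likelihoodKnown_eq (ω : Ω) {a b : ℝ} (ha : a ≠ 0) (hb : b ≠ 0) :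
    likelihoodKnown (fun i => X i ω) μ S = empiricalLikelihoodRatio fun i : Fin (n / 2) =>
      (a * traceStat (fun i : Fin (n / 2) => Z (firstHalf i)) (fun i => Z (secondHalf i)) (Γᵀ * Γ)
        (unitWeight i) ω,
      b * sumStat (fun i : Fin (n / 2) => Z (firstHalf i)) (fun i => Z (secondHalf i)) (Γᵀ *ᵥ 1)
        (unitWeight i) ω) := by
  rw [empiricalLikelihoodRatio_smul (fun i => (_, _)) ha hb, likelihoodKnown]
  exact congrArg _ (funext fun i => h.pairKnown_eq ω i)

theorem likelihoodUnknown_eq (ω : Ω) {a b : ℝ} (ha : a ≠ 0) (hb : b ≠ 0) :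
    likelihoodUnknown (fun i => X i ω) S = empiricalLikelihoodRatio fun i : Fin (n / 2) =>
      (a * traceStat (fun i : Fin (n / 2) => Z (firstHalf i)) (fun i => Z (secondHalf i)) (Γᵀ * Γ)
        (centeredWeight i) ω,
      b * sumStat (fun i : Fin (n / 2) => Z (firstHalf i)) (fun i => Z (secondHalf i)) (Γᵀ *ᵥ 1)
        (centeredWeight i) ω) := by
  rw [empiricalLikelihoodRatio_smul (fun i => (_, _)) ha hb, likelihoodUnknown]
  exact congrArg _ (funext fun i => h.pairUnknown_eq ω i)

end MultivariateModel

theorem mainTheorem3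
    {Ω : ℕ → Type*} [∀ n, MeasurableSpace (Ω n)]
    (P : ∀ n, Measure (Ω n)) [∀ n, IsProbabilityMeasure (P n)]
    (p m : ℕ → ℕ)
    (X : ∀ n, Fin n → Ω n → Fin (p n) → ℝ)
    (Γ : ∀ n, Matrix (Fin (p n)) (Fin (m n)) ℝ)
    (Z : ∀ n, Fin n → Ω n → Fin (m n) → ℝ)
    (μ : ∀ n, Fin (p n) → ℝ)
    (S S₀ : ∀ n, Matrix (Fin (p n)) (Fin (p n)) ℝ)
    (Δ C : ℝ)
    (hB : ∀ n, MultivariateModel (P n) (X n) (Γ n) (Z n) (μ n) (S n) Δ C)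
    (hS : ∀ n, 0 < ∑ i, ∑ j, S n i j)
    (hH₀ : ∀ n, S n = S₀ n) :
    TendstoInDistribution
        (fun n ω => (-2 : EReal) * ENNReal.log (likelihoodKnown (fun i => X n i ω) (μ n) (S₀ n)))
        atTop (fun t : ℝ => (t : EReal)) P (chiSquare 2) ∧
      TendstoInDistribution
        (fun n ω => (-2 : EReal) * ENNReal.log (likelihoodUnknown (fun i => X n i ω) (S₀ n)))
        atTop (fun t : ℝ => (t : EReal)) P (chiSquare 2) := by
  obtain rfl : S = S₀ := funext hH₀
  have hΔ : 1 < 3 + Δ := (hB 0).one_lt_fourth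
  have hN : Tendsto (fun n : ℕ => n / 2) atTop atTop :=
    tendsto_atTop_atTop.mpr fun b => ⟨2 * b, fun a ha => by omega⟩
  have hb : ∀ n, 0 < ∑ l, ((Γ n)ᵀ *ᵥ 1) l ^ 2 := fun n => by
    rw [sum_sq_transpose_mulVec_one, (hB n).factor]
    exact hS n
  have hG : ∀ n, 0 < sumSq ((Γ n)ᵀ * Γ n) := fun n => sumSq_gram_pos (hb n)
  have hκ := varianceRatio_pos hΔ
  have hT : ∀ n, (√(traceVariance Δ ((Γ n)ᵀ * Γ n)))⁻¹ ≠ 0 := fun n => by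
    have h0 : 0 < 8 * varianceRatio Δ ^ 2 * sumSq ((Γ n)ᵀ * Γ n) ^ 2 := by
      have := hG n
      positivity
    have := h0.trans_le (le_traceVariance hΔ _)
    positivity
  have hV : ∀ n, (√(sumVariance Δ ((Γ n)ᵀ *ᵥ 1)))⁻¹ ≠ 0 := fun n => by
    have h0 : 0 < 8 * varianceRatio Δ * (∑ l, ((Γ n)ᵀ *ᵥ 1) l ^ 2) ^ 2 := by
      have := hb n
      positivity
    have := h0.trans_le (le_sumVariance Δ _)
    positivity
  have hs := fun n => (hB n).independentSamples
  have hpairs := fun n => (hs n).normalizedPairs hΔ (hG n) (hb n)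
  constructor
  · simp only [fun n ω => (hB n).likelihoodKnown_eq ω (hT n) (hV n)]
    -- For a known mean the perturbed pairs are the pairs themselves, and `ε = 0`.
    refine tendstoInDistribution_neg_two_log_empiricalLikelihoodRatio hN
      (tendsto_const_nhds (x := (0 : ℝ))) hpairs (fun n => (hpairs n).measurable_fst)
      (fun n => (hpairs n).measurable_snd) ?_ ?_ ?_ ?_ ?_ ?_ <;> simp
  · simp only [fun n ω => (hB n).likelihoodUnknown_eq ω (hT n) (hV n)]
    have hε : Tendsto (fun n : ℕ => centeringBound Δ C / ((n / 2 : ℕ) : ℝ)) atTop (𝓝 0) :=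
      tendsto_const_nhds.div_atTop (tendsto_natCast_atTop_atTop.comp hN)
    refine tendstoInDistribution_neg_two_log_empiricalLikelihoodRatio hN hε hpairs
      (fun n i => ((hs n).measurable_traceStat _ _).const_mul _)
      (fun n i => ((hs n).measurable_sumStat _ _).const_mul _)
      (fun n i => ((((hs n).memLp_traceStat _ _).const_mul _).sub
        ((hpairs n).memLp_fst i)).mono_exponent (by norm_num))
      (fun n i => ((((hs n).memLp_sumStat _ _).const_mul _).sub
        ((hpairs n).memLp_snd i)).mono_exponent (by norm_num))
      (fun n i => ?_) (fun n i => ?_) (fun n => ?_) fun n => ?_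
    -- Singletons give the individual bounds; the full index set gives the bounds for the sums.
    · simpa using (hs n).integral_sq_sum_normalized_traceStat_sub_le hΔ (hG n) {i}
    · simpa using (hs n).integral_sq_sum_normalized_sumStat_sub_le hΔ (hb n) {i}
    · simpa using (hs n).integral_sq_sum_normalized_traceStat_sub_le hΔ (hG n) Finset.univ
    · simpa using (hs n).integral_sq_sum_normalized_sumStat_sub_le hΔ (hb n) Finset.univ
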